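/- Let $d\ge 1$ and let $v_1,\dots,v_n\in\mathbb{R}^d$ be $n\ge 1$ distinct points. Suppose that each $v_i$ is present independently of the others with probability $p_i\in(0,1)$, and let $\mathcal P$ denote the resulting random set of points. For $S\subseteq\{1,\dots,n\}$ let $\Pr[S]=\prod_{i\in S}p_i\prod_{i\notin S}(1-p_i)$, and define the (weighted Minkowski sum) set $$M=\sum_{\emptyset\ne S\subseteq\{1,\dots,n\}}\Pr[S]\cdot\mathrm{conv}\{v_i : i\in S\}\subset\mathbb{R}^d .$$ For a nonempty compact set $K$ write $f(K,u)=\max_{x\in K}\langle u,x\rangle$, and put $f(\emptyset,u)=0$. Let $\Gamma$ be the set of the hyperplanes $\{u:\langle u,v_i-v_j\rangle=0\}$, $1\le i<j\le n$, and let $\mathbb{A}(\Gamma)$ be the set of the full-dimensional closed cones into which these hyperplanes partition $\mathbb{R}^d$ (the closures of the connected components of the complement of $\bigcup\Gamma$). Then: 1. $M$ is a convex polytope, that is, it has finitely many vertices (extreme points) and is their convex hull, and $f(M,u)=\mathbb{E}_{P\sim\mathcal P}[f(P,u)]$ for all $u\in\mathbb{R}^d$. 2. There is a bijection $\varphi$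 from $\mathbb{A}(\Gamma)$ onto the set of vertices of $M$ such that for every $C\in\mathbb{A}(\Gamma)$ the function $f(M,\cdot)$ is differentiable at every $u\in\mathrm{int}\,C$, with gradient $\varphi(C)$. In particular the number $|M|$ of vertices of $M$ equals $|\mathbb{A}(\Gamma)|$. 3. $|M|=O(n^{2d-2})$; the implied constant depends only on $d$. 4. $M$ can be computed in $O(n^{2d-1}\log n)$ time for every fixed $d\ge1$, and in $O(n^2\log n)$ time for $d=2$. Precisely: for every $d\ge 1$ there are a program of the real RAM and a constant $K$, both depending only on $d$, such that on every input of $n\ge1$ distinct points and probabilities in $(0,1)$ the program halts after at most $K\,n^{2d-1}\log(n+1)$ steps and outputs the list of all vertices of $M$, without repetition; for $d=2$ there are such a program and a constant $K$ with at most $K\,n^{2}\log(n+1)$ steps. (The real RAM has integer and real registers and memory cells, the latter addressed through integer registers; in one step it performs one addition or truncated subtraction of natural numbers, one exact arithmetic operation $+,-,\times,/$ on reals, one load, store or assignment of an integer constant, or one comparison of two integers or two reals; there is no rounding operation.) -/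

import Mathlib

open scoped Pointwise

noncomputable section

/-! ### Uncertain points, existential model -/

/-- The probability that the realization of the uncertain points `0, …, n - 1`, each of which is
present independently of the others with probability `p i`, is exactly the set `S`. -/
def realizationProb {n : ℕ} (p : Fin n → ℝ) (S : Finset (Fin n)) : ℝ :=
  (∏ i ∈ S, p i) * ∏ i ∈ Sᶜ, (1 - p i)

/-- The support function `f(K, u) = sup_{x ∈ K} ⟨u, x⟩`. It is used for nonempty bounded sets, and
for the empty realization, where its value is `0` (an empty realization contributes nothing to the
expectation). -/
def supportFn {d : ℕ} (K : Set (EuclideanSpace ℝ (Fin d))) (u : EuclideanSpace ℝ (Fin d)) : ℝ :=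
  sSup ((fun x => inner ℝ u x) '' K)

/-- The expected support function `f(𝒫, u) = E_{P ∼ 𝒫} [f(P, u)]`. -/
def expectedSupport {d n : ℕ} (v : Fin n → EuclideanSpace ℝ (Fin d)) (p : Fin n → ℝ)
    (u : EuclideanSpace ℝ (Fin d)) : ℝ :=
  ∑ S : Finset (Fin n), realizationProb p S * supportFn (v '' (S : Set (Fin n))) u

/-- The weighted Minkowski sum `M = ∑_P Pr[P] • ConvH(P)` over the nonempty realizations. -/
def minkowskiM {d n : ℕ} (v : Fin n → EuclideanSpace ℝ (Fin d)) (p : Fin n → ℝ) :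
    Set (EuclideanSpace ℝ (Fin d)) :=
  ∑ S : Finset (Fin n) with S.Nonempty,
    realizationProb p S • convexHull ℝ (v '' (S : Set (Fin n)))

/-! ### The arrangement of separating hyperplanes -/

/-- The set `Γ` of separating hyperplanes: for every pair of points, the hyperplane through the
origin that is orthogonal to their difference. -/
def separatingHyperplanes {d n : ℕ} (v : Fin n → EuclideanSpace ℝ (Fin d)) :
    Set (Submodule ℝ (EuclideanSpace ℝ (Fin d))) :=
  {H | ∃ i j : Fin n, i < j ∧ H = (Submodule.span ℝ {v i - v j})ᗮ}

/-- The complement of the union of all separating hyperplanes. -/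
def arrangementComplement {d n : ℕ} (v : Fin n → EuclideanSpace ℝ (Fin d)) :
    Set (EuclideanSpace ℝ (Fin d)) :=
  (⋃ H ∈ separatingHyperplanes v, (H : Set (EuclideanSpace ℝ (Fin d))))ᶜ

/-- The arrangement `A(Γ)`: its members are the (closed) full-dimensional cones into which the
separating hyperplanes partition the space, that is, the closures of the connected components of
the complement of the hyperplanes. -/
def arrangementCones {d n : ℕ} (v : Fin n → EuclideanSpace ℝ (Fin d)) :
    Set (Set (EuclideanSpace ℝ (Fin d))) :=
  {C | ∃ u ∈ arrangementComplement v,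
    C = closure (connectedComponentIn (arrangementComplement v) u)}

/-! ### The real RAM

Programs work on integer registers, real registers, an integer memory and a real memory. The
memories are accessed only by indirect addressing through integer registers. Every instruction and
every evaluation of a test costs one time unit. The available operations are addition and
(truncated) subtraction of natural numbers, exact arithmetic on reals, and comparisons; there is
no rounding and no other passage from reals to integers than branching on a comparison. -/

/-- The contents of the registers and of the memories. -/
structure RAMState where
  /-- integer registers -/
  ireg : ℕ → ℕ
  /-- real registers -/
  rreg : ℕ → ℝ
  /-- integer memory -/
  imem : ℕ → ℕ
  /-- real memory -/
  rmem : ℕ → ℝ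

/-- The elementary instructions. -/
inductive RAMInstr where
  | iconst (a c : ℕ)
  | iadd (a b c : ℕ)
  | isub (a b c : ℕ)
  | iload (a b : ℕ)
  | istore (a b : ℕ)
  | rconst (a : ℕ) (c : ℤ)
  | radd (a b c : ℕ)
  | rsub (a b c : ℕ)
  | rmul (a b c : ℕ)
  | rdiv (a b c : ℕ)
  | rload (a b : ℕ)
  | rstore (a b : ℕ)

/-- The effect of an elementary instruction. -/
def RAMInstr.run (s : RAMState) : RAMInstr → RAMState
  | .iconst a c => { s with ireg := Function.update s.ireg a c }
  | .iadd a b c => { s with ireg := Function.update s.ireg a (s.ireg b + s.ireg c) }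
  | .isub a b c => { s with ireg := Function.update s.ireg a (s.ireg b - s.ireg c) }
  | .iload a b => { s with ireg := Function.update s.ireg a (s.imem (s.ireg b)) }
  | .istore a b => { s with imem := Function.update s.imem (s.ireg a) (s.ireg b) }
  | .rconst a c => { s with rreg := Function.update s.rreg a (c : ℝ) }
  | .radd a b c => { s with rreg := Function.update s.rreg a (s.rreg b + s.rreg c) }
  | .rsub a b c => { s with rreg := Function.update s.rreg a (s.rreg b - s.rreg c) }
  | .rmul a b c => { s with rreg := Function.update s.rreg a (s.rreg b * s.rreg c) }
  | .rdiv a b c => { s with rreg := Function.update s.rreg a (s.rreg b / s.rreg c) }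
  | .rload a b => { s with rreg := Function.update s.rreg a (s.rmem (s.ireg b)) }
  | .rstore a b => { s with rmem := Function.update s.rmem (s.ireg a) (s.rreg b) }

/-- The tests: strict comparison of two integer registers, or of two real registers. -/
inductive RAMTest where
  | ilt (a b : ℕ)
  | rlt (a b : ℕ)

/-- The truth value of a test. -/
def RAMTest.holds (s : RAMState) : RAMTest → Prop
  | .ilt a b => s.ireg a < s.ireg b
  | .rlt a b => s.rreg a < s.rreg b

/-- Programs of the real RAM, in structured form. A program is a finite object; it contains no
real constants. -/
inductive RAMProg where
  | skip
  | exec (i : RAMInstr)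
  | seq (P Q : RAMProg)
  | ite (b : RAMTest) (P Q : RAMProg)
  | loop (b : RAMTest) (P : RAMProg)

/-- `RAMRuns P s t s'`: started in state `s`, the program `P` halts in state `s'` after exactly
`t` steps. -/
inductive RAMRuns : RAMProg → RAMState → ℕ → RAMState → Prop where
  | skip (s : RAMState) : RAMRuns .skip s 1 s
  | exec (i : RAMInstr) (s : RAMState) : RAMRuns (.exec i) s 1 (i.run s)
  | seq {P Q : RAMProg} {s s' s'' : RAMState} {t t' : ℕ} :
      RAMRuns P s t s' → RAMRuns Q s' t' s'' → RAMRuns (.seq P Q) s (t + t') s''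
  | ite_true {b : RAMTest} {P Q : RAMProg} {s s' : RAMState} {t : ℕ} :
      b.holds s → RAMRuns P s t s' → RAMRuns (.ite b P Q) s (t + 1) s'
  | ite_false {b : RAMTest} {P Q : RAMProg} {s s' : RAMState} {t : ℕ} :
      ¬ b.holds s → RAMRuns Q s t s' → RAMRuns (.ite b P Q) s (t + 1) s'
  | loop_false {b : RAMTest} {P : RAMProg} {s : RAMState} :
      ¬ b.holds s → RAMRuns (.loop b P) s 1 s
  | loop_true {b : RAMTest} {P : RAMProg} {s s' s'' : RAMState} {t t' : ℕ} :
      b.holds s → RAMRuns P s t s' → RAMRuns (.loop b P) s' t' s'' →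
      RAMRuns (.loop b P) s (t + t' + 1) s''

/-- The initial state for an input of `n` uncertain points in dimension `d`: integer register `0`
holds `n`; the `d` coordinates of point `i`, followed by its probability, occupy the real memory
cells `i * (d + 1), …, i * (d + 1) + d`; everything else is `0`. -/
def ramInput {d n : ℕ} (v : Fin n → EuclideanSpace ℝ (Fin d)) (p : Fin n → ℝ) : RAMState where
  ireg := fun a => if a = 0 then n else 0
  rreg := fun _ => 0
  imem := fun _ => 0
  rmem := fun a =>
    if hi : a / (d + 1) < n then
      if hj : a % (d + 1) < d then v ⟨a / (d + 1), hi⟩ ⟨a % (d + 1), hj⟩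
      else p ⟨a / (d + 1), hi⟩
    else 0

/-- The output read off a final state: a list of points of `ℝ^d`, whose length is held by integer
register `0`, and whose coordinates are stored consecutively in the real memory, from address `0`
on. -/
def ramOutput (d : ℕ) (s : RAMState) (i : Fin (s.ireg 0)) : EuclideanSpace ℝ (Fin d) :=
  WithLp.toLp 2 (fun j : Fin d => s.rmem ((i : ℕ) * d + (j : ℕ)))

/-- The polytope `M` of any `n ≥ 1` distinct uncertain points in `ℝ^d` with probabilities strictly
between `0` and `1` can be computed in time `O(T n)`: a single program, depending only on `d`, lists
the vertices of `M`, without repetition, in at most `K * T n` steps. -/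
def ComputesMInTime (d : ℕ) (T : ℕ → ℝ) : Prop :=
  ∃ (prog : RAMProg) (K : ℝ), ∀ (n : ℕ) (v : Fin n → EuclideanSpace ℝ (Fin d)) (p : Fin n → ℝ),
    1 ≤ n → Function.Injective v → (∀ i, 0 < p i ∧ p i < 1) →
      ∃ (t : ℕ) (s : RAMState), RAMRuns prog (ramInput v p) t s ∧
        Function.Injective (ramOutput d s) ∧
        Set.range (ramOutput d s) = (minkowskiM v p).extremePoints ℝ ∧
        (t : ℝ) ≤ K * T n

end

/-! Maximizing a linear functional `⟨u, ·⟩` over a Minkowski sum means maximizing it over every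
summand. If `u` distinguishes the points, each hull `conv {v i : i ∈ S}` has a single maximizer, the
last point of `S` in the order along `u`. So `M` has a single maximizer `vertTop v p u`, which is a
vertex and depends only on that order. Conversely `M` is the hull of a finite set, so a vertex is
strictly exposed by an open set of directions, and this set contains a generic one
(`exists_generic_of_mem_extremePoints`). Different orders give different vertices: every two-point
realization `{i, j}` has positive weight, and a sum of unique maximizers determines its summands
(`beats_of_vertTop_eq`). Since the cones of the arrangement are exactly the regions of constant
order, on which the support function is linear, vertices and cones correspond. Grouping realizations
by their last point gives each vertex in closed form, with coefficient `p i * ∏ (1 - p j)` over the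
points `j` that come after `i` (`vertTop_eq_vertOf`).

For the count, a generic direction is projected successively onto nearest hyperplanes of the
arrangement, inside the orthogonal complement of the normals met so far (`Descent.step_pos`). After
`d - 1` projections only a line is left, and its direction is a positive multiple of an
orthogonalized vector `± e_q`. Read backwards, the order of the points is the lexicographic order
given by this last direction followed by the orthogonalized differences, of which there are at most
`n ^ 2` for each row. If the directions stop separating points early, zero rows fill the table.
Conversely a lexicographic order without ties is the order along `∑ ε ^ k • r k` for small `ε > 0`;
appending the standard basis to the table excludes ties. Hence `extremePoints_eq_candRows` is an
equality: it bounds the number of vertices by `3 * d * n ^ (2 * d - 2)`, and it shows that an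
enumeration of all tables produces every vertex and nothing else.

The algorithm enumerates the tables, sorts the points by their lexicographic keys and accumulates
the coefficients as running products, in `O(n log n)` for each table. A last sort removes
repetitions. In the plane a rotational sweep is faster: the `n ^ 2` ordered pairs are sorted by the
angle of their difference, each event changes at most two coefficients in constant time, and a
vertex is emitted after each group of events of equal angle (`extremePoints_eq_sweep`).

The programs are written in a small language of bounded loops with a total semantics and an exact
cost function. `Cmd.compile_spec` transfers both to the real RAM. Correctness then consists of loop
invariants, and most frame conditions are checked by computation on the syntax. -/

open scoped Pointwise

noncomputable section

open Finset

/-! ### Generic directions and the extreme points of the Minkowski sum -/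

section Geometry

variable {d n : ℕ} {v : Fin n → EuclideanSpace ℝ (Fin d)} {p : Fin n → ℝ}

/-- A direction is generic if it distinguishes all the points. -/
def Generic (v : Fin n → EuclideanSpace ℝ (Fin d)) (u : EuclideanSpace ℝ (Fin d)) : Prop :=
  ∀ i j, i ≠ j → inner ℝ u (v i) ≠ inner ℝ u (v j)

/-- In the order of the points along the direction `u`, point `i` comes after point `j`. -/
def Beats (v : Fin n → EuclideanSpace ℝ (Fin d)) (u : EuclideanSpace ℝ (Fin d)) (i j : Fin n) :
    Prop :=
  inner ℝ u (v j) < inner ℝ u (v i)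

open Classical in
/-- The expected maximal point with respect to the relation `B`. -/
def vertOf (v : Fin n → EuclideanSpace ℝ (Fin d)) (p : Fin n → ℝ) (B : Fin n → Fin n → Prop) :
    EuclideanSpace ℝ (Fin d) :=
  ∑ i, (p i * ∏ j with B j i, (1 - p j)) • v i

theorem vertOf_congr {B B' : Fin n → Fin n → Prop} (h : ∀ i j, i ≠ j → (B i j ↔ B' i j))
    (hB : ∀ i, ¬ B i i) (hB' : ∀ i, ¬ B' i i) : vertOf v p B = vertOf v p B' := by
  have : B = B' := by
    funext i j
    by_cases hij : i = j
    · subst hij; simp [hB, hB']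
    · simp [h i j hij]
  rw [this]

theorem mem_arrangementComplement {u : EuclideanSpace ℝ (Fin d)} :
    u ∈ arrangementComplement v ↔ Generic v u := by
  have key : ∀ i j, u ∈ (Submodule.span ℝ {v i - v j})ᗮ ↔ inner ℝ u (v i) = inner ℝ u (v j) := by
    intro i j
    rw [Submodule.mem_orthogonal_singleton_iff_inner_left, inner_sub_right, sub_eq_zero]
  simp only [arrangementComplement, separatingHyperplanes, Set.mem_compl_iff, Set.mem_iUnion,
    Set.mem_ofPred_eq, not_exists, SetLike.mem_coe, Generic]
  constructor
  · intro h i j hij he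
    rcases lt_or_gt_of_ne hij with hlt | hlt
    · exact h _ ⟨i, j, hlt, rfl⟩ ((key i j).2 he)
    · exact h _ ⟨j, i, hlt, rfl⟩ ((key j i).2 he.symm)
  · rintro h H ⟨i, j, hij, rfl⟩ hu
    exact h i j hij.ne ((key i j).1 hu)

/-- Nonemptiness stands inside the existential so that choosing the witness gives a total function
of `S`; its value at the empty realization is arbitrary and never matters. -/
theorem exists_argmax (v : Fin n → EuclideanSpace ℝ (Fin d)) (u : EuclideanSpace ℝ (Fin d))
    (S : Finset (Fin n)) : ∃ t : EuclideanSpace ℝ (Fin d),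
      S.Nonempty → ∃ i ∈ S, t = v i ∧ ∀ j ∈ S, inner ℝ u (v j) ≤ (inner ℝ u (v i) : ℝ) := by
  by_cases h : S.Nonempty
  · obtain ⟨i, hi, hm⟩ := S.exists_max_image (fun j => (inner ℝ u (v j) : ℝ)) h
    exact ⟨v i, fun _ => ⟨i, hi, rfl, hm⟩⟩
  · exact ⟨0, fun h' => absurd h' h⟩

/-- A point of the realization `S` that is extreme in direction `u`. -/
def topPt (v : Fin n → EuclideanSpace ℝ (Fin d)) (u : EuclideanSpace ℝ (Fin d))
    (S : Finset (Fin n)) : EuclideanSpace ℝ (Fin d) :=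
  (exists_argmax v u S).choose

theorem topPt_spec (v : Fin n → EuclideanSpace ℝ (Fin d)) (u : EuclideanSpace ℝ (Fin d))
    {S : Finset (Fin n)} (hS : S.Nonempty) : ∃ i ∈ S, topPt v u S = v i ∧
      ∀ j ∈ S, inner ℝ u (v j) ≤ (inner ℝ u (v i) : ℝ) :=
  (exists_argmax v u S).choose_spec hS

/-- The weighted sum of the extreme points of the realizations in direction `u`. -/
def vertTop (v : Fin n → EuclideanSpace ℝ (Fin d)) (p : Fin n → ℝ)
    (u : EuclideanSpace ℝ (Fin d)) : EuclideanSpace ℝ (Fin d) :=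
  ∑ S : Finset (Fin n) with S.Nonempty, realizationProb p S • topPt v u S

theorem realizationProb_pos (hp : ∀ i, 0 < p i ∧ p i < 1) (S : Finset (Fin n)) :
    0 < realizationProb p S :=
  mul_pos (prod_pos fun i _ => (hp i).1) (prod_pos fun i _ => by linarith [(hp i).2])

theorem mem_minkowskiM {x : EuclideanSpace ℝ (Fin d)} :
    x ∈ minkowskiM v p ↔ ∃ y : Finset (Fin n) → EuclideanSpace ℝ (Fin d),
      (∀ S : Finset (Fin n), S.Nonempty → y S ∈ convexHull ℝ (v '' (S : Set (Fin n)))) ∧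
      ∑ S : Finset (Fin n) with S.Nonempty, realizationProb p S • y S = x := by
  unfold minkowskiM
  rw [Set.mem_finsetSum]
  constructor
  · rintro ⟨g, hg, hx⟩
    have : ∀ S : Finset (Fin n), ∃ y, S.Nonempty →
        y ∈ convexHull ℝ (v '' (S : Set (Fin n))) ∧ realizationProb p S • y = g S := by
      intro S
      by_cases h : S.Nonempty
      · obtain ⟨y, hy, he⟩ := Set.mem_smul_set.1 (hg (i := S) (by simpa using h))
        exact ⟨y, fun _ => ⟨hy, he⟩⟩
      · exact ⟨0, fun h' => absurd h' h⟩
    choose y hy using this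
    refine ⟨y, fun S hS => (hy S hS).1, ?_⟩
    rw [← hx]
    exact sum_congr rfl fun S hS => (hy S (by simpa using hS)).2
  · rintro ⟨y, hy, hx⟩
    exact ⟨fun S => realizationProb p S • y S,
      fun {S} hS => Set.smul_mem_smul_set (hy S (by simpa using hS)), hx⟩

theorem topPt_mem_convexHull (u : EuclideanSpace ℝ (Fin d)) {S : Finset (Fin n)}
    (hS : S.Nonempty) : topPt v u S ∈ convexHull ℝ (v '' (S : Set (Fin n))) := by
  obtain ⟨i, hi, he, -⟩ := topPt_spec v u hS
  rw [he]
  exact subset_convexHull _ _ ⟨i, hi, rfl⟩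

theorem vertTop_mem (u : EuclideanSpace ℝ (Fin d)) : vertTop v p u ∈ minkowskiM v p :=
  mem_minkowskiM.2 ⟨topPt v u, fun _ hS => topPt_mem_convexHull u hS, rfl⟩

theorem inner_le_topPt {u y : EuclideanSpace ℝ (Fin d)} {S : Finset (Fin n)} (hS : S.Nonempty)
    (hy : y ∈ convexHull ℝ (v '' (S : Set (Fin n)))) :
    inner ℝ u y ≤ (inner ℝ u (topPt v u S) : ℝ) := by
  obtain ⟨i, hi, he, hm⟩ := topPt_spec v u hS
  rw [he]
  have : convexHull ℝ (v '' (S : Set (Fin n))) ⊆ {y | inner ℝ u y ≤ (inner ℝ u (v i) : ℝ)} := by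
    refine convexHull_min ?_ (convex_halfSpace_le ⟨fun x y => inner_add_right _ _ _,
      fun c x => by simp [inner_smul_right]⟩ _)
    rintro _ ⟨j, hj, rfl⟩
    exact hm j hj
  exact this hy

/-- An open half-space stays convex when one boundary point is added. With `convexHull_min` this
carries strict inequality from the generators of a hull to all its points except `t`, and so gives
uniqueness of maximizers. -/
theorem convex_lt_or_eq (u t : EuclideanSpace ℝ (Fin d)) :
    Convex ℝ {y | y = t ∨ inner ℝ u y < (inner ℝ u t : ℝ)} := by
  intro x hx y hy a b ha hb hab
  simp only [Set.mem_ofPred_eq, inner_add_right, inner_smul_right] at *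
  rcases ha.eq_or_lt with rfl | ha
  · have : b = 1 := by linarith
    subst this; simpa using hy
  rcases hb.eq_or_lt with rfl | hb
  · have : a = 1 := by linarith
    subst this; simpa using hx
  have e : (inner ℝ u t : ℝ) = a * inner ℝ u t + b * inner ℝ u t := by rw [← add_mul, hab, one_mul]
  rcases hx with rfl | hx
  · rcases hy with rfl | hy
    · left; rw [← add_smul, hab, one_smul]
    · right
      have := mul_lt_mul_of_pos_left hy hb
      linarith
  · right
    rw [e]
    have : (inner ℝ u y : ℝ) ≤ inner ℝ u t := by rcases hy with rfl | hy; exacts [le_rfl, hy.le]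
    have h1 := mul_lt_mul_of_pos_left hx ha
    have h2 := mul_le_mul_of_nonneg_left this hb.le
    linarith

theorem eq_topPt_of_inner_eq {u y : EuclideanSpace ℝ (Fin d)} (hu : Generic v u)
    {S : Finset (Fin n)} (hS : S.Nonempty) (hy : y ∈ convexHull ℝ (v '' (S : Set (Fin n))))
    (h : inner ℝ u y = (inner ℝ u (topPt v u S) : ℝ)) : y = topPt v u S := by
  obtain ⟨i, hi, he, hm⟩ := topPt_spec v u hS
  rw [he] at h ⊢
  have : convexHull ℝ (v '' (S : Set (Fin n))) ⊆
      {y | y = v i ∨ inner ℝ u y < (inner ℝ u (v i) : ℝ)} := by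
    refine convexHull_min ?_ (convex_lt_or_eq _ _)
    rintro _ ⟨j, hj, rfl⟩
    by_cases hij : j = i
    · left; rw [hij]
    · right; exact lt_of_le_of_ne (hm j hj) (hu j i hij)
  rcases this hy with h' | h'
  · exact h'
  · exact absurd h h'.ne

theorem inner_sum_realization (u : EuclideanSpace ℝ (Fin d))
    (y : Finset (Fin n) → EuclideanSpace ℝ (Fin d)) :
    (inner ℝ u (∑ S : Finset (Fin n) with S.Nonempty, realizationProb p S • y S) : ℝ) =
      ∑ S : Finset (Fin n) with S.Nonempty, realizationProb p S * inner ℝ u (y S) := by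
  simp [inner_sum, inner_smul_right]

theorem inner_le_vertTop (hp : ∀ i, 0 < p i ∧ p i < 1) {u x : EuclideanSpace ℝ (Fin d)}
    (hx : x ∈ minkowskiM v p) : inner ℝ u x ≤ (inner ℝ u (vertTop v p u) : ℝ) := by
  obtain ⟨y, hy, rfl⟩ := mem_minkowskiM.1 hx
  rw [vertTop, inner_sum_realization, inner_sum_realization]
  refine sum_le_sum fun S hS => mul_le_mul_of_nonneg_left ?_ (realizationProb_pos hp S).le
  have hS' : S.Nonempty := by simpa using hS
  exact inner_le_topPt hS' (hy S hS')

/-- Termwise inequalities with positive weights can add up to an equality only if each is an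
equality. So a representation of the maximizer can be read off summand by summand; this is what
later separates vertices of different orders. -/
theorem eq_topPt_of_inner_sum_eq (hp : ∀ i, 0 < p i ∧ p i < 1) {u : EuclideanSpace ℝ (Fin d)}
    (hu : Generic v u) {y : Finset (Fin n) → EuclideanSpace ℝ (Fin d)}
    (hy : ∀ S : Finset (Fin n), S.Nonempty → y S ∈ convexHull ℝ (v '' (S : Set (Fin n))))
    (h : inner ℝ u (∑ S : Finset (Fin n) with S.Nonempty, realizationProb p S • y S) =
      (inner ℝ u (vertTop v p u) : ℝ)) {S : Finset (Fin n)} (hS : S.Nonempty) :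
    y S = topPt v u S := by
  rw [vertTop, inner_sum_realization, inner_sum_realization] at h
  have := (sum_eq_sum_iff_of_le (fun S hS => mul_le_mul_of_nonneg_left
    (inner_le_topPt (by simpa using hS) (hy S (by simpa using hS)))
      (realizationProb_pos hp S).le)).1 h S (by simpa using hS)
  exact eq_topPt_of_inner_eq hu hS (hy S hS)
    (mul_left_cancel₀ (realizationProb_pos hp S).ne' this)

theorem eq_vertTop (hp : ∀ i, 0 < p i ∧ p i < 1) {u x : EuclideanSpace ℝ (Fin d)}
    (hu : Generic v u) (hx : x ∈ minkowskiM v p)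
    (h : inner ℝ u x = (inner ℝ u (vertTop v p u) : ℝ)) : x = vertTop v p u := by
  obtain ⟨y, hy, rfl⟩ := mem_minkowskiM.1 hx
  exact sum_congr rfl fun S hS => by
    rw [eq_topPt_of_inner_sum_eq hp hu hy h (by simpa using hS)]

/-- Convex hulls commute with scaling and with Minkowski sums, so the finite sum of the scaled
finite point sets generates `M`. -/
theorem minkowskiM_eq_convexHull (v : Fin n → EuclideanSpace ℝ (Fin d)) (p : Fin n → ℝ) :
    ∃ F : Set (EuclideanSpace ℝ (Fin d)), F.Finite ∧ minkowskiM v p = convexHull ℝ F := by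
  refine ⟨∑ S : Finset (Fin n) with S.Nonempty, realizationProb p S • (v '' (S : Set (Fin n))),
    ?_, ?_⟩
  · refine sum_induction _ Set.Finite (fun _ _ => Set.Finite.add) Set.finite_zero fun S _ => ?_
    exact ((S.finite_toSet.image v).image _)
  · rw [minkowskiM, convexHull_sum]
    simp [convexHull_smul]

theorem vertTop_mem_extremePoints (hp : ∀ i, 0 < p i ∧ p i < 1) {u : EuclideanSpace ℝ (Fin d)}
    (hu : Generic v u) : vertTop v p u ∈ (minkowskiM v p).extremePoints ℝ := by
  refine mem_extremePoints.2 ⟨vertTop_mem u, fun x hx y hy hxy => ?_⟩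
  obtain ⟨a, b, ha, hb, hab, he⟩ := hxy
  have h1 := inner_le_vertTop hp hx (u := u)
  have h2 := inner_le_vertTop hp hy (u := u)
  have h3 : (inner ℝ u (vertTop v p u) : ℝ) = a * inner ℝ u x + b * inner ℝ u y := by
    conv_lhs => rw [← he]
    simp [inner_add_right, inner_smul_right]
  have hb' : b = 1 - a := by linarith
  subst hb'
  constructor
  · refine eq_vertTop hp hu hx (le_antisymm h1 ?_)
    nlinarith
  · refine eq_vertTop hp hu hy (le_antisymm h2 ?_)
    nlinarith

theorem generic_dense (hv : Function.Injective v) : Dense {u | Generic v u} := by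
  have : {u | Generic v u} = ⋂ q : {q : Fin n × Fin n // q.1 ≠ q.2},
      {u | (inner ℝ u (v q.1.1 - v q.1.2) : ℝ) ≠ 0} := by
    ext u
    simp [Generic, inner_sub_right, sub_eq_zero]
  rw [this]
  refine dense_iInter_of_isOpen (fun q => ?_) fun q => ?_
  · exact isOpen_ne_fun (by fun_prop) continuous_const
  · have hw : v q.1.1 - v q.1.2 ≠ 0 := sub_ne_zero.2 fun h => q.2 (hv h)
    set w := v q.1.1 - v q.1.2
    intro u
    -- A direction on the hyperplane `w⊥` leaves it at once when moved along `w`, because `⟨w, w⟩ ≠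
    -- 0`.
    have ht : Filter.Tendsto (fun ε : ℝ => u + ε • w) (nhdsWithin 0 {0}ᶜ) (nhds u) := by
      have : Filter.Tendsto (fun ε : ℝ => u + ε • w) (nhds 0) (nhds (u + (0 : ℝ) • w)) :=
        (Continuous.tendsto (by fun_prop) 0)
      simpa using this.mono_left nhdsWithin_le_nhds
    by_cases hu : (inner ℝ u w : ℝ) = 0
    · refine mem_closure_of_tendsto ht ?_
      filter_upwards [self_mem_nhdsWithin] with ε hε
      simp only [inner_add_left, hu, zero_add, inner_smul_left]
      exact mul_ne_zero (by simpa using hε) (by simpa using hw)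
    · exact subset_closure hu

/-- An extreme point of a finitely generated hull is strictly separated from the other generators.
Being finitely many strict inequalities, this is an open condition on the direction, so density
allows the direction to be made generic. -/
theorem exists_generic_of_mem_extremePoints (hv : Function.Injective v)
    (hp : ∀ i, 0 < p i ∧ p i < 1) {x : EuclideanSpace ℝ (Fin d)}
    (hx : x ∈ (minkowskiM v p).extremePoints ℝ) : ∃ u, Generic v u ∧ vertTop v p u = x := by
  obtain ⟨F, hF, hM⟩ := minkowskiM_eq_convexHull v p
  have hxF : x ∈ F := extremePoints_convexHull_subset (𝕜 := ℝ) (hM ▸ hx)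
  have hxn : x ∉ convexHull ℝ (F \ {x}) := by
    intro h
    have := ((convex_convexHull ℝ F).mem_extremePoints_iff_mem_sdiff_convexHull_sdiff).1 (hM ▸ hx)
    exact this.2 (convexHull_mono (Set.sdiff_subset_sdiff_left (subset_convexHull _ _)) h)
  obtain ⟨f, c, hc, hf⟩ := geometric_hahn_banach_point_closed (convex_convexHull ℝ (F \ {x}))
    ((hF.subset Set.sdiff_subset).isClosed_convexHull ℝ) hxn
  -- Separation puts `x` on the side where `f` is small; the sign is changed so that `x` becomes the
  -- maximizer.
  set g := -(InnerProductSpace.toDual ℝ (EuclideanSpace ℝ (Fin d))).symm f with hg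
  have hgi : ∀ y, (inner ℝ g y : ℝ) = - f y := by intro y; simp [hg]
  have hopen : IsOpen {u : EuclideanSpace ℝ (Fin d) | ∀ y ∈ F \ {x},
      (inner ℝ u y : ℝ) < inner ℝ u x} := by
    have : {u : EuclideanSpace ℝ (Fin d) | ∀ y ∈ F \ {x}, (inner ℝ u y : ℝ) < inner ℝ u x} =
      ⋂ y ∈ F \ {x}, {u | (inner ℝ u y : ℝ) < inner ℝ u x} := by ext; simp
    rw [this]
    exact (hF.subset Set.sdiff_subset).isOpen_biInter fun y _ =>
      isOpen_lt (by fun_prop) (by fun_prop)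
  obtain ⟨u, hu1, hu2⟩ := (generic_dense hv).inter_open_nonempty _ hopen ⟨g, fun y hy => by
    rw [hgi, hgi]; linarith [hf y (subset_convexHull _ _ hy)]⟩
  refine ⟨u, hu2, ?_⟩
  have hsub : convexHull ℝ F ⊆ {y | y = x ∨ inner ℝ u y < (inner ℝ u x : ℝ)} := by
    refine convexHull_min (fun y hy => ?_) (convex_lt_or_eq _ _)
    by_cases hyx : y = x
    · exact Or.inl hyx
    · exact Or.inr (hu1 y ⟨hy, hyx⟩)
  rcases hsub (hM ▸ vertTop_mem u) with h | h
  · exact h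
  · exact absurd (inner_le_vertTop hp hx.1) (not_le.2 h)

theorem finite_extremePoints (v : Fin n → EuclideanSpace ℝ (Fin d)) (p : Fin n → ℝ) :
    ((minkowskiM v p).extremePoints ℝ).Finite := by
  obtain ⟨F, hF, hM⟩ := minkowskiM_eq_convexHull v p
  exact hF.subset (hM ▸ extremePoints_convexHull_subset)

theorem minkowskiM_eq_convexHull_extremePoints (v : Fin n → EuclideanSpace ℝ (Fin d))
    (p : Fin n → ℝ) : minkowskiM v p = convexHull ℝ ((minkowskiM v p).extremePoints ℝ) := by
  obtain ⟨F, hF, hM⟩ := minkowskiM_eq_convexHull v p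
  have h := closure_convexHull_extremePoints (s := minkowskiM v p)
    (hM ▸ hF.isCompact_convexHull ℝ) (hM ▸ convex_convexHull ℝ F)
  rw [((finite_extremePoints v p).isClosed_convexHull ℝ).closure_eq] at h
  exact h.symm

theorem supportFn_eq_vertTop (hp : ∀ i, 0 < p i ∧ p i < 1) (u : EuclideanSpace ℝ (Fin d)) :
    supportFn (minkowskiM v p) u = inner ℝ u (vertTop v p u) :=
  IsGreatest.csSup_eq ⟨⟨_, vertTop_mem u, rfl⟩, by
    rintro _ ⟨x, hx, rfl⟩; exact inner_le_vertTop hp hx⟩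

theorem supportFn_eq_expectedSupport (hp : ∀ i, 0 < p i ∧ p i < 1)
    (u : EuclideanSpace ℝ (Fin d)) : supportFn (minkowskiM v p) u = expectedSupport v p u := by
  rw [supportFn_eq_vertTop hp, vertTop, inner_sum_realization, expectedSupport, sum_filter]
  refine sum_congr rfl fun S _ => ?_
  split_ifs with hS
  · congr 1
    obtain ⟨i, hi, he, hm⟩ := topPt_spec v u hS
    rw [he]
    have hg : IsGreatest ((fun x => (inner ℝ u x : ℝ)) '' (v '' (S : Set (Fin n))))
      (inner ℝ u (v i)) := ⟨⟨_, ⟨i, hi, rfl⟩, rfl⟩, ?_⟩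
    · exact hg.csSup_eq.symm
    rintro _ ⟨_, ⟨j, hj, rfl⟩, rfl⟩
    exact hm j hj
  · rw [not_nonempty_iff_eq_empty] at hS
    simp [hS, supportFn]

/-- Expand the product of the sums `a j + b j`, where `a j` is `p j` or `0` if `B j`, and `b j` is
`1 - p j` or `0` if `j = i`. The term of `S` survives exactly if `S` contains `i` and avoids `B`. As
a product, the factor at `i` is `p i`, those in `B` are `1 - p j`, and all the others are `1`. -/
theorem sum_realizationProb_top (p : Fin n → ℝ) (B : Fin n → Prop) [DecidablePred B] (i : Fin n)
    (hi : ¬ B i) :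
    ∑ S : Finset (Fin n) with i ∈ S ∧ ∀ j ∈ S, ¬ B j, realizationProb p S =
      p i * ∏ j with B j, (1 - p j) := by
  have h := prod_add (fun j => if B j then 0 else p j) (fun j => if j = i then 0 else 1 - p j)
    (univ : Finset (Fin n))
  have hl : ∏ j, ((if B j then 0 else p j) + (if j = i then 0 else 1 - p j)) =
      p i * ∏ j with B j, (1 - p j) := by
    rw [← mul_prod_erase univ _ (mem_univ i), prod_filter]
    rw [← mul_prod_erase univ (fun j => if B j then 1 - p j else 1) (mem_univ i)]
    simp only [hi, if_false, if_true, add_zero, one_mul]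
    congr 1
    refine prod_congr rfl fun j hj => ?_
    have : j ≠ i := ne_of_mem_erase hj
    by_cases hB : B j <;> simp [hB, this]
  rw [← hl, h, powerset_univ, sum_filter]
  refine sum_congr rfl fun S _ => ?_
  rw [← compl_eq_univ_sdiff]
  split_ifs with hS
  · rw [realizationProb]
    congr 1
    · exact prod_congr rfl fun j hj => by simp [hS.2 j hj]
    · refine prod_congr rfl fun j hj => ?_
      have : j ≠ i := by rintro rfl; exact (mem_compl.1 hj) hS.1
      simp [this]
  · rw [not_and_or] at hS
    symm
    rcases hS with hS | hS
    · rw [prod_eq_zero (i := i) (s := Sᶜ) (by simpa using hS) (by simp), mul_zero]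
    · push Not at hS
      obtain ⟨j, hj, hB⟩ := hS
      rw [prod_eq_zero hj (by simp [hB]), zero_mul]

theorem Beats.irrefl (u : EuclideanSpace ℝ (Fin d)) (i : Fin n) : ¬ Beats v u i i := lt_irrefl _

/-- Nonempty realizations are grouped by their last point. Genericity makes that point unique, so
the inner sum over `i` collapses to one term. -/
theorem vertTop_eq_vertOf {u : EuclideanSpace ℝ (Fin d)} (hu : Generic v u) :
    vertTop v p u = vertOf v p (Beats v u) := by
  classical
  have h1 : ∀ i, p i * ∏ j with Beats v u j i, (1 - p j) =
      ∑ S : Finset (Fin n) with i ∈ S ∧ ∀ j ∈ S, ¬ Beats v u j i, realizationProb p S :=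
    fun i => (sum_realizationProb_top p (fun j => Beats v u j i) i (Beats.irrefl u i)).symm
  rw [vertTop, vertOf, sum_filter]
  simp_rw [h1, sum_smul, sum_filter]
  rw [sum_comm]
  refine sum_congr rfl fun S _ => ?_
  split_ifs with hS
  · obtain ⟨i, hi, he, hm⟩ := topPt_spec v u hS
    rw [sum_eq_single i, if_pos ⟨hi, fun j hj => not_lt.2 (hm j hj)⟩, he]
    · intro k _ hk
      rw [if_neg]
      rintro ⟨hkS, hk'⟩
      exact hk' i hi (lt_of_le_of_ne (hm k hkS) (hu k i hk))
    · simp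
  · rw [not_nonempty_iff_eq_empty] at hS
    subst hS
    simp

/-- One inclusion of orders suffices, because both are total on distinct points. -/
theorem vertTop_congr {u u' : EuclideanSpace ℝ (Fin d)} (hu : Generic v u) (hu' : Generic v u')
    (h : ∀ i j, Beats v u i j → Beats v u' i j) : vertTop v p u = vertTop v p u' := by
  rw [vertTop_eq_vertOf hu, vertTop_eq_vertOf hu']
  refine vertOf_congr (fun i j hij => ⟨h i j, fun h' => ?_⟩) (Beats.irrefl u) (Beats.irrefl u')
  rcases lt_or_gt_of_ne (hu i j hij) with hlt | hlt
  · exact absurd (h j i hlt) (lt_asymm h')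
  · exact hlt

/-- The realization `{i, j}` has positive weight, so equality of the vertices forces its last point
to be the same in both directions. -/
theorem beats_of_vertTop_eq (hp : ∀ i, 0 < p i ∧ p i < 1) {u u' : EuclideanSpace ℝ (Fin d)}
    (hu' : Generic v u') (h : vertTop v p u = vertTop v p u')
    (i j : Fin n) (hij : Beats v u i j) : Beats v u' i j := by
  classical
  have hne : i ≠ j := by rintro rfl; exact Beats.irrefl u _ hij
  have hS : ({i, j} : Finset (Fin n)).Nonempty := ⟨i, by simp⟩
  have e := eq_topPt_of_inner_sum_eq hp hu' (fun S hS => topPt_mem_convexHull u hS)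
    (by rw [← h]; rfl) hS
  obtain ⟨k, hk, hke, hkm⟩ := topPt_spec v u hS
  obtain ⟨l, hl, hle, hlm⟩ := topPt_spec v u' hS
  have hki : v k = v i := by
    have := hkm i (by simp)
    simp only [mem_insert, mem_singleton] at hk
    rcases hk with rfl | rfl
    · rfl
    · exact absurd hij (not_lt.2 this)
  have hm := hlm j (by simp)
  rw [← hle, ← e, hke, hki] at hm
  exact lt_of_le_of_ne hm (hu' j i hne.symm)

/-! ### The cones of the arrangement and the bijection with the vertices -/

/-- The open cone of the directions inducing the same order of the points as `u`. -/
def orderCone (v : Fin n → EuclideanSpace ℝ (Fin d)) (u : EuclideanSpace ℝ (Fin d)) :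
    Set (EuclideanSpace ℝ (Fin d)) :=
  {w | ∀ i j, Beats v u i j → Beats v w i j}

theorem self_mem_orderCone (u : EuclideanSpace ℝ (Fin d)) : u ∈ orderCone v u :=
  fun _ _ h => h

theorem generic_of_mem_orderCone {u w : EuclideanSpace ℝ (Fin d)} (hu : Generic v u)
    (hw : w ∈ orderCone v u) : Generic v w := by
  intro i j hij
  rcases lt_or_gt_of_ne (hu i j hij) with h | h
  · exact (hw j i h).ne
  · exact (hw i j h).ne'

theorem orderCone_eq (u : EuclideanSpace ℝ (Fin d)) :
    orderCone v u = ⋂ i, ⋂ j, ⋂ _ : Beats v u i j,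
      {w | (inner ℝ w (v j) : ℝ) < inner ℝ w (v i)} := by
  ext w
  simp [orderCone, Beats]

theorem isOpen_orderCone (u : EuclideanSpace ℝ (Fin d)) : IsOpen (orderCone v u) := by
  rw [orderCone_eq]
  exact isOpen_iInter_of_finite fun i => isOpen_iInter_of_finite fun j =>
    isOpen_iInter_of_finite fun _ => isOpen_lt (by fun_prop) (by fun_prop)

theorem convex_orderCone (u : EuclideanSpace ℝ (Fin d)) : Convex ℝ (orderCone v u) := by
  rw [orderCone_eq]
  refine convex_iInter fun i => convex_iInter fun j => convex_iInter fun _ => ?_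
  have : {w : EuclideanSpace ℝ (Fin d) | (inner ℝ w (v j) : ℝ) < inner ℝ w (v i)} =
      {w | 0 < (inner ℝ (v i - v j) w : ℝ)} := by
    ext w
    simp [inner_sub_left, real_inner_comm w]
  rw [this]
  exact convex_halfSpace_gt ⟨fun x y => inner_add_right _ _ _,
    fun c x => by simp [inner_smul_right]⟩ _

/-- Along a connected subset of the complement, `⟨w, v i - v j⟩` cannot change sign without
vanishing. In the other direction, the order cone is convex, hence connected, and avoids all the
hyperplanes. -/
theorem connectedComponentIn_arrangementComplement {u : EuclideanSpace ℝ (Fin d)}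
    (hu : Generic v u) :
    connectedComponentIn (arrangementComplement v) u = orderCone v u := by
  apply Set.Subset.antisymm
  · intro w hw i j hij
    have hpre : IsPreconnected
        ((fun w : EuclideanSpace ℝ (Fin d) => (inner ℝ w (v i) - inner ℝ w (v j) : ℝ)) ''
          connectedComponentIn (arrangementComplement v) u) :=
      isPreconnected_connectedComponentIn.image _ (by fun_prop)
    have huc : u ∈ connectedComponentIn (arrangementComplement v) u :=
      mem_connectedComponentIn (mem_arrangementComplement.2 hu)
    have hne : i ≠ j := by rintro rfl; exact Beats.irrefl u _ hij
    by_contra hcon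
    have hmem : (0 : ℝ) ∈ Set.Icc (inner ℝ w (v i) - inner ℝ w (v j) : ℝ)
        (inner ℝ u (v i) - inner ℝ u (v j)) :=
      ⟨sub_nonpos.2 (not_lt.1 hcon), (sub_pos.2 hij).le⟩
    obtain ⟨z, hz, hz0⟩ := hpre.ordConnected.out ⟨w, hw, rfl⟩ ⟨u, huc, rfl⟩ hmem
    exact mem_arrangementComplement.1 (connectedComponentIn_subset _ _ hz) i j hne
      (sub_eq_zero.1 hz0)
  · exact (convex_orderCone u).isPreconnected.subset_connectedComponentIn (self_mem_orderCone u)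
      fun w hw => mem_arrangementComplement.2 (generic_of_mem_orderCone hu hw)

theorem mem_arrangementCones {C : Set (EuclideanSpace ℝ (Fin d))} :
    C ∈ arrangementCones v ↔ ∃ u, Generic v u ∧ C = closure (orderCone v u) := by
  constructor
  · rintro ⟨u, hu, rfl⟩
    have hu' := mem_arrangementComplement.1 hu
    exact ⟨u, hu', by rw [connectedComponentIn_arrangementComplement hu']⟩
  · rintro ⟨u, hu, rfl⟩
    exact ⟨u, mem_arrangementComplement.2 hu, by
      rw [connectedComponentIn_arrangementComplement hu]⟩

/-- An open convex set is recovered from its closure, so a member of the arrangement, which is a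
closed cone, still determines an order of the points. -/
theorem interior_closure_orderCone (u : EuclideanSpace ℝ (Fin d)) :
    interior (closure (orderCone v u)) = orderCone v u := by
  have h := (isOpen_orderCone (v := v) u).interior_eq
  rw [(convex_orderCone u).interior_closure_eq_interior_of_nonempty_interior
    (h.symm ▸ ⟨u, self_mem_orderCone u⟩), h]

theorem hasGradientAt_supportFn (hp : ∀ i, 0 < p i ∧ p i < 1) {u w : EuclideanSpace ℝ (Fin d)}
    (hu : Generic v u) (hw : w ∈ orderCone v u) :
    HasGradientAt (supportFn (minkowskiM v p)) (vertTop v p u) w := by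
  have h1 : HasGradientAt (fun x : EuclideanSpace ℝ (Fin d) => (inner ℝ (vertTop v p u) x : ℝ))
      (vertTop v p u) w :=
    ((InnerProductSpace.toDual ℝ (EuclideanSpace ℝ (Fin d))) (vertTop v p u)).hasFDerivAt
  refine HasGradientAt.congr_of_eventuallyEq h1 ?_
  filter_upwards [(isOpen_orderCone u).mem_nhds hw] with x hx
  rw [supportFn_eq_vertTop hp, real_inner_comm,
    vertTop_congr hu (generic_of_mem_orderCone hu hx) hx]

theorem exists_equiv_arrangementCones (hv : Function.Injective v)
    (hp : ∀ i, 0 < p i ∧ p i < 1) :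
    ∃ φ : arrangementCones v ≃ (minkowskiM v p).extremePoints ℝ,
      ∀ C : arrangementCones v, ∀ u ∈ interior (C : Set (EuclideanSpace ℝ (Fin d))),
        HasGradientAt (supportFn (minkowskiM v p)) (φ C : EuclideanSpace ℝ (Fin d)) u := by
  choose dir hdir hC using fun C : arrangementCones v => mem_arrangementCones.1 C.2
  refine ⟨Equiv.ofBijective (fun C => ⟨vertTop v p (dir C), vertTop_mem_extremePoints hp (hdir C)⟩)
    ⟨fun C C' h => ?_, fun x => ?_⟩, fun C u hu => ?_⟩
  · have h' : vertTop v p (dir C) = vertTop v p (dir C') := congrArg Subtype.val h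
    apply Subtype.ext
    rw [hC C, hC C']
    congr 1
    ext w
    exact ⟨fun hw i j hij => hw i j (beats_of_vertTop_eq hp (hdir C) h'.symm i j hij),
      fun hw i j hij => hw i j (beats_of_vertTop_eq hp (hdir C') h' i j hij)⟩
  · obtain ⟨u, hu, hx⟩ := exists_generic_of_mem_extremePoints hv hp x.2
    refine ⟨⟨closure (orderCone v u), mem_arrangementCones.2 ⟨u, hu, rfl⟩⟩, Subtype.ext ?_⟩
    rw [← hx]
    set C : arrangementCones v :=
      ⟨closure (orderCone v u), mem_arrangementCones.2 ⟨u, hu, rfl⟩⟩ with hCdef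
    have e : orderCone v u = orderCone v (dir C) := by
      rw [← interior_closure_orderCone u, ← interior_closure_orderCone (dir C), ← hC C]
    exact vertTop_congr (hdir C) hu (e ▸ self_mem_orderCone u : u ∈ orderCone v (dir C))
  · rw [hC C, interior_closure_orderCone] at hu
    exact hasGradientAt_supportFn hp (hdir C) hu

end Geometry

/-! ### Lexicographic orders, candidate directions and the number of vertices -/

section Lexicographic

variable {d n : ℕ} {v : Fin n → EuclideanSpace ℝ (Fin d)} {p : Fin n → ℝ}

/-- Point `i` comes after point `j` in the lexicographic order given by the rows `r 0, …, r (D-1)`. -/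
def LexBeats (v : Fin n → EuclideanSpace ℝ (Fin d)) (r : ℕ → EuclideanSpace ℝ (Fin d)) (D : ℕ)
    (i j : Fin n) : Prop :=
  ∃ l < D, (∀ l' < l, (inner ℝ (r l') (v i - v j) : ℝ) = 0) ∧ 0 < (inner ℝ (r l) (v i - v j) : ℝ)

/-- After the factor `ε ^ l` is split off, the remaining polynomial has value `a l > 0` at `0`. -/
theorem eventually_sum_pow_mul_pos {a : ℕ → ℝ} {D l : ℕ} (hl : l < D) (h0 : ∀ l' < l, a l' = 0)
    (hpos : 0 < a l) : ∀ᶠ ε : ℝ in nhdsWithin 0 (Set.Ioi 0), 0 < ∑ k ∈ range D, ε ^ k * a k := by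
  obtain ⟨m, rfl⟩ : ∃ m, D = l + (m + 1) := ⟨D - l - 1, by omega⟩
  have hc : Continuous fun ε : ℝ => ∑ k ∈ range (m + 1), ε ^ k * a (l + k) := by fun_prop
  have h1 : ∀ᶠ ε : ℝ in nhdsWithin 0 (Set.Ioi 0),
      0 < ∑ k ∈ range (m + 1), ε ^ k * a (l + k) := by
    refine nhdsWithin_le_nhds (hc.continuousAt.eventually_mem (Ioi_mem_nhds ?_))
    rw [sum_range_succ']
    simpa using hpos
  filter_upwards [h1, self_mem_nhdsWithin] with ε h hε
  rw [sum_range_add, sum_eq_zero (s := range l) fun k hk => by rw [h0 k (mem_range.1 hk), mul_zero],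
    zero_add]
  have : ∑ k ∈ range (m + 1), ε ^ (l + k) * a (l + k) =
      ε ^ l * ∑ k ∈ range (m + 1), ε ^ k * a (l + k) := by
    rw [mul_sum]
    exact sum_congr rfl fun k _ => by rw [pow_add, mul_assoc]
  rw [this]
  exact mul_pos (pow_pos hε _) h

theorem LexBeats.asymm {r : ℕ → EuclideanSpace ℝ (Fin d)} {D : ℕ} {i j : Fin n}
    (h : LexBeats v r D i j) : ¬ LexBeats v r D j i := by
  obtain ⟨l, hl, h0, hp⟩ := h
  rintro ⟨l', hl', h0', hp'⟩
  have e : ∀ k, (inner ℝ (r k) (v i - v j) : ℝ) = - inner ℝ (r k) (v j - v i) := fun k => by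
    rw [← inner_neg_right, neg_sub]
  rcases lt_trichotomy l l' with h | rfl | h
  · rw [e, h0' l h] at hp; simp at hp
  · rw [e] at hp; linarith
  · have := h0 l' h; rw [e] at this; linarith

theorem LexBeats.irrefl (r : ℕ → EuclideanSpace ℝ (Fin d)) (D : ℕ) (i : Fin n) :
    ¬ LexBeats v r D i i := fun h => h.asymm h

theorem LexBeats.total {r : ℕ → EuclideanSpace ℝ (Fin d)} {D : ℕ} {i j : Fin n}
    (h : ∃ l < D, (inner ℝ (r l) (v i - v j) : ℝ) ≠ 0) :
    LexBeats v r D i j ∨ LexBeats v r D j i := by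
  classical
  obtain ⟨hl, hne⟩ := Nat.find_spec h
  have hmin : ∀ l' < Nat.find h, (inner ℝ (r l') (v i - v j) : ℝ) = 0 := fun l' hl' => by
    by_contra hc
    exact Nat.find_min h hl' ⟨hl'.trans hl, hc⟩
  generalize Nat.find h = l at hl hne hmin
  rcases lt_or_gt_of_ne hne with hlt | hlt
  · right
    refine ⟨_, hl, fun l' hl' => ?_, ?_⟩
    · rw [← neg_sub, inner_neg_right, hmin l' hl', neg_zero]
    · rw [← neg_sub, inner_neg_right]; linarith
  · exact Or.inl ⟨_, hl, hmin, hlt⟩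

/-- The direction is `∑ ε ^ k • r k`: for small `ε` the first nonzero inner product decides the
sign. There are finitely many pairs, so one `ε` serves all of them. -/
theorem exists_generic_of_lexBeats {r : ℕ → EuclideanSpace ℝ (Fin d)} {D : ℕ}
    (htot : ∀ i j, i ≠ j → ∃ l < D, (inner ℝ (r l) (v i - v j) : ℝ) ≠ 0) :
    ∃ u, Generic v u ∧ ∀ i j, Beats v u i j ↔ LexBeats v r D i j := by
  have hev : ∀ᶠ ε : ℝ in nhdsWithin 0 (Set.Ioi 0), ∀ i j, LexBeats v r D i j →
      Beats v (∑ k ∈ range D, ε ^ k • r k) i j := by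
    refine Filter.eventually_all.2 fun i => Filter.eventually_all.2 fun j => ?_
    by_cases h : LexBeats v r D i j
    · obtain ⟨l, hl, h0, hp⟩ := h
      filter_upwards [eventually_sum_pow_mul_pos hl h0 hp] with ε hε _
      rw [Beats, ← sub_pos, ← inner_sub_right]
      simpa [sum_inner, inner_smul_left] using hε
    · exact Filter.Eventually.of_forall fun ε h' => absurd h' h
  obtain ⟨ε, hε⟩ := hev.exists
  refine ⟨_, fun i j hij => ?_, fun i j => ⟨fun h => ?_, hε i j⟩⟩
  · rcases LexBeats.total (htot i j hij) with h | h
    · exact (hε _ _ h).ne'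
    · exact (hε _ _ h).ne
  · have hij : i ≠ j := by rintro rfl; exact Beats.irrefl _ _ h
    rcases LexBeats.total (htot i j hij) with h' | h'
    · exact h'
    · exact absurd (hε _ _ h') (lt_asymm h)

/-- This keeps spurious points out of the output: a table need not come from a face of the
arrangement, only separate the points. -/
theorem vertOf_lexBeats_mem_extremePoints (hp : ∀ i, 0 < p i ∧ p i < 1)
    {r : ℕ → EuclideanSpace ℝ (Fin d)} {D : ℕ}
    (htot : ∀ i j, i ≠ j → ∃ l < D, (inner ℝ (r l) (v i - v j) : ℝ) ≠ 0) :
    vertOf v p (LexBeats v r D) ∈ (minkowskiM v p).extremePoints ℝ := by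
  obtain ⟨u, hu, h⟩ := exists_generic_of_lexBeats htot
  have : LexBeats v r D = Beats v u := by funext i j; exact propext (h i j).symm
  rw [this, ← vertTop_eq_vertOf hu]
  exact vertTop_mem_extremePoints hp hu

theorem vertTop_eq_of_lexBeats {u : EuclideanSpace ℝ (Fin d)} (hu : Generic v u)
    {r : ℕ → EuclideanSpace ℝ (Fin d)} {D : ℕ} (h : ∀ i j, Beats v u i j → LexBeats v r D i j) :
    vertTop v p u = vertOf v p (LexBeats v r D) := by
  rw [vertTop_eq_vertOf hu]
  refine vertOf_congr (fun i j hij => ⟨h i j, fun h' => ?_⟩) (Beats.irrefl u) (LexBeats.irrefl r D)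
  rcases lt_or_gt_of_ne (hu i j hij) with hlt | hlt
  · exact absurd (h j i hlt) h'.asymm
  · exact hlt

/-! ### Candidate directions by Gram–Schmidt orthogonalization -/

/-- The component of `y` orthogonal to `g`; it is `y` if `g = 0`. -/
def orthStep (g y : EuclideanSpace ℝ (Fin d)) : EuclideanSpace ℝ (Fin d) :=
  y - ((inner ℝ g y : ℝ) / (inner ℝ g g : ℝ)) • g

/-- Successive orthogonalization of `y` against the rows `r (m + 1), …, r (m + k)`. -/
def orthReduce (r : ℕ → EuclideanSpace ℝ (Fin d)) (m : ℕ) : ℕ → EuclideanSpace ℝ (Fin d) →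
    EuclideanSpace ℝ (Fin d)
  | 0, y => y
  | k + 1, y => orthStep (r (m + 1 + k)) (orthReduce r m k y)

theorem inner_orthStep_self (g y : EuclideanSpace ℝ (Fin d)) :
    (inner ℝ g (orthStep g y) : ℝ) = 0 := by
  rw [orthStep, inner_sub_right, inner_smul_right]
  by_cases hg : g = 0
  · simp [hg]
  · have : (inner ℝ g g : ℝ) ≠ 0 := by simpa using hg
    field_simp
    ring

theorem inner_orthStep {g x : EuclideanSpace ℝ (Fin d)} (h : (inner ℝ x g : ℝ) = 0)
    (y : EuclideanSpace ℝ (Fin d)) : (inner ℝ x (orthStep g y) : ℝ) = inner ℝ x y := by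
  rw [orthStep, inner_sub_right, inner_smul_right, h, mul_zero, sub_zero]

theorem inner_orthReduce {r : ℕ → EuclideanSpace ℝ (Fin d)} {m : ℕ}
    {x : EuclideanSpace ℝ (Fin d)} {k : ℕ}
    (h : ∀ l < k, (inner ℝ x (r (m + 1 + l)) : ℝ) = 0) (y : EuclideanSpace ℝ (Fin d)) :
    (inner ℝ x (orthReduce r m k y) : ℝ) = inner ℝ x y := by
  induction k with
  | zero => rfl
  | succ k ih =>
    rw [orthReduce, inner_orthStep (h k (by omega)), ih fun l hl => h l (by omega)]

theorem inner_row_orthReduce {r : ℕ → EuclideanSpace ℝ (Fin d)} {m k : ℕ}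
    (ho : ∀ l < k, ∀ l' < k, l ≠ l' → (inner ℝ (r (m + 1 + l)) (r (m + 1 + l')) : ℝ) = 0)
    (y : EuclideanSpace ℝ (Fin d)) {l : ℕ} (hl : l < k) :
    (inner ℝ (r (m + 1 + l)) (orthReduce r m k y) : ℝ) = 0 := by
  induction k with
  | zero => omega
  | succ k ih =>
    rw [orthReduce]
    rcases Nat.lt_succ_iff_lt_or_eq.1 hl with h | rfl
    · rw [inner_orthStep (ho l hl k (by omega) h.ne)]
      exact ih (fun l hl l' hl' => ho l (by omega) l' (by omega)) h
    · exact inner_orthStep_self _ _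

/-- The tables of rows that arise from `r` by filling the rows `m, m - 1, …, 1` with
orthogonalized differences of points, and row `0` with an orthogonalized signed basis vector or
zero vector. -/
def candRows (v : Fin n → EuclideanSpace ℝ (Fin d)) : ℕ → (ℕ → EuclideanSpace ℝ (Fin d)) →
    Set (ℕ → EuclideanSpace ℝ (Fin d))
  | 0, r => ⋃ q : Fin d, ⋃ s : Fin 3, {Function.update r 0
      (orthReduce r 0 (d - 1) (EuclideanSpace.single q ((s : ℕ) - 1 : ℝ)))}
  | m + 1, r => ⋃ i : Fin n, ⋃ j : Fin n, candRows v m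
      (Function.update r (m + 1) (orthReduce r (m + 1) (d - 1 - (m + 1)) (v i - v j)))

theorem candRows_apply_of_gt {m : ℕ} {r r' : ℕ → EuclideanSpace ℝ (Fin d)}
    (h : r' ∈ candRows v m r) {l : ℕ} (hl : m < l) : r' l = r l := by
  induction m generalizing r with
  | zero =>
    simp only [candRows, Set.mem_iUnion, Set.mem_singleton_iff] at h
    obtain ⟨q, s, rfl⟩ := h
    rw [Function.update_of_ne (by omega)]
  | succ m ih =>
    simp only [candRows, Set.mem_iUnion] at h
    obtain ⟨i, j, h⟩ := h
    rw [ih h (by omega), Function.update_of_ne (by omega)]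

theorem ncard_iUnion_le_mul {ι α : Type*} [Fintype ι] (s : ι → Set α) (hs : ∀ i, (s i).Finite)
    (c : ℕ) (hc : ∀ i, (s i).ncard ≤ c) :
    (⋃ i, s i).Finite ∧ (⋃ i, s i).ncard ≤ Fintype.card ι * c := by
  classical
  refine ⟨Set.finite_iUnion hs, ?_⟩
  have : (⋃ i, s i) = ((univ.biUnion fun i => (hs i).toFinset : Finset α) : Set α) := by
    ext; simp
  rw [this, Set.ncard_coe_finset]
  refine (card_biUnion_le_card_mul _ _ c fun i _ => ?_)
  rw [← Set.ncard_eq_toFinset_card _ (hs i)]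
  exact hc i

theorem ncard_candRows_le (m : ℕ) (r : ℕ → EuclideanSpace ℝ (Fin d)) :
    (candRows v m r).Finite ∧ (candRows v m r).ncard ≤ n ^ (2 * m) * (d * 3) := by
  induction m generalizing r with
  | zero =>
    simp only [candRows, mul_zero, pow_zero, one_mul]
    have h : ∀ q : Fin d, _ := fun q => ncard_iUnion_le_mul (fun s : Fin 3 => {Function.update r 0
      (orthReduce r 0 (d - 1) (EuclideanSpace.single q ((s : ℕ) - 1 : ℝ)))})
      (fun _ => Set.finite_singleton _) 1 (fun _ => by simp)
    have := ncard_iUnion_le_mul _ (fun q => (h q).1) 3 fun q => by simpa using (h q).2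
    simpa using this
  | succ m ih =>
    simp only [candRows]
    have h : ∀ i : Fin n, _ := fun i => ncard_iUnion_le_mul (fun j : Fin n => candRows v m
      (Function.update r (m + 1) (orthReduce r (m + 1) (d - 1 - (m + 1)) (v i - v j))))
      (fun j => (ih _).1) _ (fun j => (ih _).2)
    have := ncard_iUnion_le_mul _ (fun i => (h i).1) _ fun i => (h i).2
    refine ⟨this.1, this.2.trans (le_of_eq ?_)⟩
    simp only [Fintype.card_fin]
    ring

/-- The state of the descent from a generic direction `u₀` after the rows `m + 1, …, d - 1` have
been chosen: `u` is the projection of `u₀` to a face of its cone. -/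
structure Descent (v : Fin n → EuclideanSpace ℝ (Fin d)) (u₀ : EuclideanSpace ℝ (Fin d)) (m : ℕ)
    (r : ℕ → EuclideanSpace ℝ (Fin d)) (u : EuclideanSpace ℝ (Fin d)) : Prop where
  orth : ∀ l, m < l → l < d → ∀ l', m < l' → l' < d → l ≠ l' → (inner ℝ (r l) (r l') : ℝ) = 0
  perp : ∀ l, m < l → l < d → (inner ℝ (r l) u : ℝ) = 0
  -- In dual form: the differences orthogonal to `u` lie in the span of the rows chosen so far.
  span : ∀ i j, (inner ℝ u (v i - v j) : ℝ) = 0 → ∀ x : EuclideanSpace ℝ (Fin d),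
    (∀ l, m < l → l < d → (inner ℝ x (r l) : ℝ) = 0) → (inner ℝ x (v i - v j) : ℝ) = 0
  sign : ∀ i j, Beats v u₀ i j → 0 < (inner ℝ u (v i - v j) : ℝ) ∨
    ((inner ℝ u (v i - v j) : ℝ) = 0 ∧ ∃ l, m < l ∧ l < d ∧
      (∀ l', m < l' → l' < l → (inner ℝ (r l') (v i - v j) : ℝ) = 0) ∧
      0 < (inner ℝ (r l) (v i - v j) : ℝ))
  -- Zero rows are allowed only after `u` has become orthogonal to all differences, when the descent
  -- is already complete.
  nondeg : (∀ l, m < l → l < d → r l ≠ 0) ∨ ∀ i j, (inner ℝ u (v i - v j) : ℝ) = 0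

theorem orthReduce_row {u₀ u : EuclideanSpace ℝ (Fin d)} {m : ℕ}
    {r : ℕ → EuclideanSpace ℝ (Fin d)} (h : Descent v u₀ m r u) (y : EuclideanSpace ℝ (Fin d))
    {l : ℕ} (hl : m < l) (hld : l < d) :
    (inner ℝ (r l) (orthReduce r m (d - 1 - m) y) : ℝ) = 0 := by
  obtain ⟨k, rfl⟩ : ∃ k, l = m + 1 + k := ⟨l - m - 1, by omega⟩
  exact inner_row_orthReduce (fun l hl l' hl' hne => h.orth _ (by omega) (by omega) _ (by omega)
    (by omega) (by omega)) y (by omega)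

theorem inner_orthReduce_of_perp {m : ℕ} {r : ℕ → EuclideanSpace ℝ (Fin d)}
    {x : EuclideanSpace ℝ (Fin d)} (hx : ∀ l, m < l → l < d → (inner ℝ x (r l) : ℝ) = 0)
    (y : EuclideanSpace ℝ (Fin d)) :
    (inner ℝ x (orthReduce r m (d - 1 - m) y) : ℝ) = inner ℝ x y :=
  inner_orthReduce (fun l _ => hx _ (by omega) (by omega)) y

theorem Descent.init {u₀ : EuclideanSpace ℝ (Fin d)} (hu : Generic v u₀)
    (r : ℕ → EuclideanSpace ℝ (Fin d)) : Descent v u₀ (d - 1) r u₀ where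
  orth l _ _ := by omega
  perp l _ _ := by omega
  span i j h x _ := by
    by_cases hij : i = j
    · simp [hij]
    · rw [inner_sub_right, sub_eq_zero] at h
      exact absurd h (hu i j hij)
  sign i j h := Or.inl (by rw [inner_sub_right]; exact sub_pos.2 h)
  nondeg := Or.inl fun l _ _ => by omega

/-- No hyperplane is left to project to, so the table is filled with a zero row. The pair `(i, i)`
provides it, which keeps the degenerate case among the same candidates. -/
theorem Descent.step_zero {u₀ u : EuclideanSpace ℝ (Fin d)} {m : ℕ}
    {r : ℕ → EuclideanSpace ℝ (Fin d)} (h : Descent v u₀ (m + 1) r u)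
    (h0 : ∀ i j, (inner ℝ u (v i - v j) : ℝ) = 0) (i : Fin n) :
    Descent v u₀ m
      (Function.update r (m + 1) (orthReduce r (m + 1) (d - 1 - (m + 1)) (v i - v i))) u := by
  have hz : orthReduce r (m + 1) (d - 1 - (m + 1)) (v i - v i) = 0 := by
    rw [← inner_self_eq_zero (𝕜 := ℝ), inner_orthReduce_of_perp, sub_self, inner_zero_right]
    intro l hl hld
    rw [real_inner_comm, orthReduce_row h _ hl hld]
  rw [hz]
  have e : ∀ l, m < l → Function.update r (m + 1) 0 l = 0 ∨
      (m + 1 < l ∧ Function.update r (m + 1) 0 l = r l) := by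
    intro l hl
    by_cases hlm : l = m + 1
    · left; simp [hlm]
    · right; exact ⟨by omega, by rw [Function.update_of_ne hlm]⟩
  refine ⟨fun l hl hld l' hl' hld' hne => ?_, fun l hl hld => ?_, fun i j hw x hx => ?_,
    fun i j hb => ?_, Or.inr h0⟩
  · rcases e l hl with e1 | ⟨g1, e1⟩
    · rw [e1, inner_zero_left]
    · rcases e l' hl' with e2 | ⟨g2, e2⟩
      · rw [e2, inner_zero_right]
      · rw [e1, e2, h.orth l g1 hld l' g2 hld' hne]
  · rcases e l hl with e1 | ⟨g1, e1⟩
    · rw [e1, inner_zero_left]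
    · rw [e1, h.perp l g1 hld]
  · refine h.span i j hw x fun l hl hld => ?_
    have := hx l (by omega) hld
    rwa [Function.update_of_ne (by omega)] at this
  · rcases h.sign i j hb with h1 | ⟨h1, l, hl, hld, h2, h3⟩
    · exact absurd (h0 i j) h1.ne'
    · refine Or.inr ⟨h1, l, by omega, hld, fun l' hl' hll' => ?_, ?_⟩
      · rcases e l' hl' with e1 | ⟨g1, e1⟩
        · rw [e1, inner_zero_left]
        · rw [e1, h2 l' g1 hll']
      · rwa [Function.update_of_ne (by omega)]

/-- Let `G w` be the component of `w` orthogonal to the rows. Within the orthogonal complement of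
the rows, `⟨u, w⟩ / ‖G w‖` is the distance from `u` to the hyperplane `w⊥`. The new `u` is the foot
of the perpendicular on a nearest hyperplane. By Cauchy–Schwarz no positive inner product with a
difference becomes negative, and it becomes zero only if `G w` is parallel to the new row `g`. Such
ties are decided by `g`, since `t * ⟨g, w⟩` equals the old, positive value `⟨u, w⟩`. -/
theorem Descent.step_pos {u₀ u : EuclideanSpace ℝ (Fin d)} {m : ℕ}
    {r : ℕ → EuclideanSpace ℝ (Fin d)} (h : Descent v u₀ (m + 1) r u) (hm : m + 1 < d)
    {i₀ j₀ : Fin n} (h0 : (inner ℝ u (v i₀ - v j₀) : ℝ) ≠ 0) :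
    ∃ i j u', Descent v u₀ m
      (Function.update r (m + 1) (orthReduce r (m + 1) (d - 1 - (m + 1)) (v i - v j))) u' := by
  classical
  set G := orthReduce r (m + 1) (d - 1 - (m + 1)) with hG
  have hperp' : ∀ l, m + 1 < l → l < d → (inner ℝ u (r l) : ℝ) = 0 := fun l hl hld => by
    rw [real_inner_comm, h.perp l hl hld]
  have huG : ∀ y, (inner ℝ u (G y) : ℝ) = inner ℝ u y := inner_orthReduce_of_perp hperp'
  have hGr : ∀ y l, m + 1 < l → l < d → (inner ℝ (r l) (G y) : ℝ) = 0 := fun y l hl hld =>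
    orthReduce_row h y hl hld
  have hrG : ∀ y l, m + 1 < l → l < d → (inner ℝ (G y) (r l) : ℝ) = 0 := fun y l hl hld => by
    rw [real_inner_comm, hGr y l hl hld]
  have hGG : ∀ y z, (inner ℝ (G y) (G z) : ℝ) = inner ℝ (G y) z := fun y z =>
    inner_orthReduce_of_perp (hrG y) z
  have hGne : ∀ y, (inner ℝ u y : ℝ) ≠ 0 → 0 < ‖G y‖ := fun y hy => by
    rw [norm_pos_iff]
    intro hc
    rw [← huG, hc, inner_zero_right] at hy
    exact hy rfl
  obtain ⟨q, hq, hmin⟩ := exists_min_image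
    (univ.filter fun q : Fin n × Fin n => 0 < (inner ℝ u (v q.1 - v q.2) : ℝ))
    (fun q => (inner ℝ u (v q.1 - v q.2) : ℝ) / ‖G (v q.1 - v q.2)‖) (by
      rcases lt_or_gt_of_ne h0 with hlt | hlt
      · refine ⟨(j₀, i₀), ?_⟩
        rw [← neg_sub, inner_neg_right] at hlt
        simpa using hlt
      · exact ⟨(i₀, j₀), by simpa using hlt⟩)
  replace hq : 0 < (inner ℝ u (v q.1 - v q.2) : ℝ) := by simpa using hq
  set w₀ := v q.1 - v q.2 with hw₀
  set g := G w₀ with hg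
  have hgpos : 0 < ‖g‖ := hGne _ hq.ne'
  -- Chosen so that `u - t • g` is orthogonal to `g`.
  set t := (inner ℝ u w₀ : ℝ) / ‖g‖ ^ 2 with ht
  have htpos : 0 < t := div_pos hq (by positivity)
  have hug : (inner ℝ u g : ℝ) = t * ‖g‖ ^ 2 := by
    rw [huG, ht]; field_simp
  have hu' : ∀ w, (inner ℝ (u - t • g) w : ℝ) = inner ℝ u w - t * inner ℝ g w := fun w => by
    rw [inner_sub_left, inner_smul_left]; rfl
  have hmin' : ∀ i j, 0 < (inner ℝ u (v i - v j) : ℝ) →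
      t * (‖g‖ * ‖G (v i - v j)‖) ≤ inner ℝ u (v i - v j) := by
    intro i j hij
    have h1 := hmin (i, j) (by simpa using hij)
    have h2 : 0 < ‖G (v i - v j)‖ := hGne _ hij.ne'
    rw [le_div_iff₀ h2] at h1
    refine le_trans (le_of_eq ?_) h1
    rw [ht]
    field_simp
  have hpos : ∀ i j, 0 < (inner ℝ u (v i - v j) : ℝ) →
      0 ≤ (inner ℝ (u - t • g) (v i - v j) : ℝ) := by
    intro i j hij
    rw [hu', ← hGG]
    have h1 := real_inner_le_norm g (G (v i - v j))
    have h2 := hmin' i j hij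
    have h3 := mul_le_mul_of_nonneg_left h1 htpos.le
    linarith
  -- A new tie is the equality case of Cauchy–Schwarz: `G w` is a multiple of `g`, hence `w` lies in
  -- the span of `g` and the old rows.
  have hpar : ∀ i j, 0 < (inner ℝ u (v i - v j) : ℝ) →
      (inner ℝ (u - t • g) (v i - v j) : ℝ) = 0 → ∀ x : EuclideanSpace ℝ (Fin d),
      (∀ l, m < l → l < d → (inner ℝ x (Function.update r (m + 1) g l) : ℝ) = 0) →
      (inner ℝ x (v i - v j) : ℝ) = 0 := by
    intro i j hij hz x hx
    have h2 := hmin' i j hij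
    rw [hu', ← hGG] at hz
    have h1 : (inner ℝ g (G (v i - v j)) : ℝ) = ‖g‖ * ‖G (v i - v j)‖ := by
      refine le_antisymm (real_inner_le_norm _ _) ?_
      have : t * (‖g‖ * ‖G (v i - v j)‖) ≤ t * inner ℝ g (G (v i - v j)) := by linarith
      exact le_of_mul_le_mul_left this htpos
    rw [inner_eq_norm_mul_iff_real] at h1
    have hxg : (inner ℝ x g : ℝ) = 0 := by
      have := hx (m + 1) (by omega) hm
      rwa [Function.update_self] at this
    have hxr : ∀ l, m + 1 < l → l < d → (inner ℝ x (r l) : ℝ) = 0 := fun l hl hld => by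
      have := hx l (by omega) hld
      rwa [Function.update_of_ne (by omega)] at this
    rw [← inner_orthReduce_of_perp hxr]
    have h3 := congrArg (fun y => (inner ℝ x y : ℝ)) h1
    simp only [inner_smul_right, hxg, mul_zero] at h3
    exact (mul_eq_zero.1 h3.symm).resolve_left hgpos.ne'
  -- Old ties stay tied: their differences lie in the span of the old rows, to which `g` is
  -- orthogonal.
  have hzero : ∀ i j, (inner ℝ u (v i - v j) : ℝ) = 0 → (inner ℝ g (v i - v j) : ℝ) = 0 :=
    fun i j hij => h.span i j hij g (hrG w₀)
  refine ⟨q.1, q.2, u - t • g, ?_⟩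
  rw [← hw₀, ← hg]
  have e : ∀ l, m < l → (l = m + 1 ∧ Function.update r (m + 1) g l = g) ∨
      (m + 1 < l ∧ Function.update r (m + 1) g l = r l) := by
    intro l hl
    by_cases hlm : l = m + 1
    · left; exact ⟨hlm, by simp [hlm]⟩
    · right; exact ⟨by omega, by rw [Function.update_of_ne hlm]⟩
  refine ⟨fun l hl hld l' hl' hld' hne => ?_, fun l hl hld => ?_, fun i j hw x hx => ?_,
    fun i j hb => ?_, ?_⟩
  · rcases e l hl with ⟨g1, e1⟩ | ⟨g1, e1⟩ <;> rcases e l' hl' with ⟨g2, e2⟩ | ⟨g2, e2⟩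
    · omega
    · rw [e1, e2, hrG _ _ g2 hld']
    · rw [e1, e2, hGr _ _ g1 hld]
    · rw [e1, e2, h.orth l g1 hld l' g2 hld' hne]
  · rw [real_inner_comm, hu']
    rcases e l hl with ⟨g1, e1⟩ | ⟨g1, e1⟩
    · rw [e1, hug, real_inner_self_eq_norm_sq, sub_self]
    · rw [e1, hperp' l g1 hld, hrG _ _ g1 hld, mul_zero, sub_zero]
  · rcases lt_trichotomy (inner ℝ u (v i - v j) : ℝ) 0 with hlt | heq | hgt
    · have h1 := hpar j i (by rw [← neg_sub, inner_neg_right]; linarith)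
        (by rw [← neg_sub (v i), inner_neg_right, hw, neg_zero]) x hx
      rw [← neg_sub, inner_neg_right, h1, neg_zero]
    · refine h.span i j heq x fun l hl hld => ?_
      have := hx l (by omega) hld
      rwa [Function.update_of_ne (by omega)] at this
    · exact hpar i j hgt hw x hx
  · rcases h.sign i j hb with h1 | ⟨h1, l, hl, hld, h2, h3⟩
    · rcases (hpos i j h1).lt_or_eq with h2 | h2
      · exact Or.inl h2
      · refine Or.inr ⟨h2.symm, m + 1, by omega, hm, fun l' _ _ => by omega, ?_⟩
        rw [Function.update_self]
        rw [hu'] at h2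
        have : 0 < t * inner ℝ g (v i - v j) := by linarith
        exact pos_of_mul_pos_right this htpos.le
    · refine Or.inr ⟨by rw [hu', h1, hzero i j h1, mul_zero, sub_zero], l, by omega, hld,
        fun l' hl' hll' => ?_, ?_⟩
      · rcases e l' hl' with ⟨-, e1⟩ | ⟨g1, e1⟩
        · rw [e1, hzero i j h1]
        · rw [e1, h2 l' g1 hll']
      · rwa [Function.update_of_ne (by omega)]
  · left
    intro l hl hld
    rcases e l hl with ⟨-, e1⟩ | ⟨g1, e1⟩
    · rw [e1]; exact norm_pos_iff.1 hgpos
    · rw [e1]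
      exact (h.nondeg.resolve_right fun hc => h0 (hc i₀ j₀)) l g1 hld

/-- After `d - 1` nonzero orthogonal rows, their orthogonal complement is the line through `u`. A
signed basis vector with positive inner product with `u` therefore projects to a positive multiple
of `u`, and that multiple can replace `u` as row `0`. -/
theorem Descent.exists_candRows_zero {u₀ u : EuclideanSpace ℝ (Fin d)}
    {r : ℕ → EuclideanSpace ℝ (Fin d)} (h : Descent v u₀ 0 r u) (hd : 0 < d) :
    ∃ r' ∈ candRows v 0 r, ∀ i j, Beats v u₀ i j → LexBeats v r' d i j := by
  suffices hs : ∃ (q : Fin d) (s : Fin 3) (c : ℝ),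
      (0 < c ∨ ∀ i j, (inner ℝ u (v i - v j) : ℝ) = 0) ∧ ∀ x, (inner ℝ
        (orthReduce r 0 (d - 1) (EuclideanSpace.single q ((s : ℕ) - 1 : ℝ))) x : ℝ) =
        c * inner ℝ u x by
    obtain ⟨q, s, c, hc, he⟩ := hs
    refine ⟨_, Set.mem_iUnion.2 ⟨q, Set.mem_iUnion.2 ⟨s, rfl⟩⟩, fun i j hb => ?_⟩
    rcases h.sign i j hb with h1 | ⟨h1, l, hl, hld, h2, h3⟩
    · refine ⟨0, hd, fun _ _ => by omega, ?_⟩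
      rw [Function.update_self, he]
      rcases hc with hc | hc
      · exact mul_pos hc h1
      · exact absurd (hc i j) h1.ne'
    · refine ⟨l, hld, fun l' hl' => ?_, by rwa [Function.update_of_ne (by omega)]⟩
      by_cases hl0 : l' = 0
      · rw [hl0, Function.update_self, he, h1, mul_zero]
      · rw [Function.update_of_ne hl0, h2 l' (by omega) hl']
  -- If `u` no longer distinguishes any points, row `0` is irrelevant and is taken to be zero, which
  -- is the choice `s = 1`.
  by_cases h0 : ∀ i j, (inner ℝ u (v i - v j) : ℝ) = 0
  · refine ⟨⟨0, hd⟩, 1, 0, Or.inr h0, fun x => ?_⟩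
    have hz : orthReduce r 0 (d - 1)
        (EuclideanSpace.single (⟨0, hd⟩ : Fin d) (((1 : Fin 3) : ℕ) - 1 : ℝ)) = 0 := by
      rw [← inner_self_eq_zero (𝕜 := ℝ)]
      have hp := inner_orthReduce_of_perp (m := 0) (r := r) (x := orthReduce r 0 (d - 1)
        (EuclideanSpace.single (⟨0, hd⟩ : Fin d) (((1 : Fin 3) : ℕ) - 1 : ℝ)))
        (fun l hl hld => by rw [real_inner_comm]; exact orthReduce_row h _ hl hld)
      rw [Nat.sub_zero] at hp
      rw [hp]
      have hs0 : EuclideanSpace.single (⟨0, hd⟩ : Fin d) (((1 : Fin 3) : ℕ) - 1 : ℝ) = 0 := by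
        ext; simp
      rw [hs0, inner_zero_right]
    rw [hz, inner_zero_left, zero_mul]
  · have hr := h.nondeg.resolve_right h0
    push Not at h0
    obtain ⟨i₀, j₀, h0⟩ := h0
    have hu : u ≠ 0 := by rintro rfl; simp at h0
    obtain ⟨q, hq⟩ : ∃ q, u q ≠ 0 := by
      by_contra hc
      push Not at hc
      exact hu (by ext q; simpa using hc q)
    -- The values `0` and `2` of `s` stand for the signs `-1` and `+1`; the sign of `u q` is taken.
    obtain ⟨s, hs⟩ : ∃ s : Fin 3, 0 < ((s : ℕ) - 1 : ℝ) * u q := by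
      rcases lt_or_gt_of_ne hq with hlt | hgt
      · exact ⟨0, by simpa using hlt⟩
      · exact ⟨2, by norm_num; exact hgt⟩
    set y : EuclideanSpace ℝ (Fin d) := EuclideanSpace.single q ((s : ℕ) - 1 : ℝ) with hy
    have huy : (inner ℝ u y : ℝ) = ((s : ℕ) - 1 : ℝ) * u q := by
      rw [hy, EuclideanSpace.inner_single_right]; simp
    have hperp' : ∀ l, 0 < l → l < d → (inner ℝ u (r l) : ℝ) = 0 := fun l hl hld => by
      rw [real_inner_comm, h.perp l hl hld]
    set z := orthReduce r 0 (d - 1) y with hz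
    have hzr : ∀ l, 0 < l → l < d → (inner ℝ (r l) z : ℝ) = 0 := fun l hl hld =>
      orthReduce_row h y hl hld
    have huz : (inner ℝ u z : ℝ) = inner ℝ u y := inner_orthReduce_of_perp hperp' y
    have huu : 0 < (inner ℝ u u : ℝ) := by
      rw [real_inner_self_eq_norm_sq]; have := norm_pos_iff.2 hu; positivity
    refine ⟨q, s, (inner ℝ u y : ℝ) / inner ℝ u u, Or.inl (div_pos (huy ▸ hs) huu), ?_⟩
    -- Together with `u` the rows form an orthogonal basis, and the difference is orthogonal to each
    -- of its members.
    have key : z - ((inner ℝ u y : ℝ) / inner ℝ u u) • u = 0 := by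
      set b : Fin d → EuclideanSpace ℝ (Fin d) := fun l => if (l : ℕ) = 0 then u else r l with hb
      have hbne : ∀ l, b l ≠ 0 := by
        intro l
        simp only [hb]
        split_ifs with hl
        · exact hu
        · exact hr l (by omega) l.2
      have hbo : Pairwise fun l l' => (inner ℝ (b l) (b l') : ℝ) = 0 := by
        intro l l' hll
        have hll' : (l : ℕ) ≠ l' := fun hc => hll (Fin.ext hc)
        simp only [hb]
        split_ifs with h1 h2 h2
        · omega
        · exact hperp' _ (by omega) l'.2
        · exact h.perp _ (by omega) l.2
        · exact h.orth _ (by omega) l.2 _ (by omega) l'.2 hll'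
      have hli : LinearIndependent ℝ b := linearIndependent_of_ne_zero_of_inner_eq_zero hbne hbo
      have hspan := hli.span_eq_top_of_card_eq_finrank' (by simp)
      have hbz : ∀ l, (inner ℝ (b l) (z - ((inner ℝ u y : ℝ) / inner ℝ u u) • u) : ℝ) = 0 := by
        intro l
        simp only [hb]
        rw [inner_sub_right, inner_smul_right]
        split_ifs with h1
        · rw [huz]; field_simp; ring
        · rw [hzr _ (by omega) l.2, h.perp _ (by omega) l.2]; simp
      have hall : ∀ x ∈ Submodule.span ℝ (Set.range b),
          (inner ℝ x (z - ((inner ℝ u y : ℝ) / inner ℝ u u) • u) : ℝ) = 0 := by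
        intro x hx
        induction hx using Submodule.span_induction with
        | mem x hx => obtain ⟨l, rfl⟩ := hx; exact hbz l
        | zero => simp
        | add x y _ _ hx hy => rw [inner_add_left, hx, hy, add_zero]
        | smul a x _ hx => rw [inner_smul_left, hx, mul_zero]
      rw [← inner_self_eq_zero (𝕜 := ℝ)]
      exact hall _ (by rw [hspan]; trivial)
    intro x
    change inner ℝ z x = _
    rw [sub_eq_zero.1 key, inner_smul_left]
    rfl

theorem Descent.exists_candRows {u₀ : EuclideanSpace ℝ (Fin d)} (hn : 0 < n) {m : ℕ} (hm : m < d)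
    {r : ℕ → EuclideanSpace ℝ (Fin d)} {u : EuclideanSpace ℝ (Fin d)} (h : Descent v u₀ m r u) :
    ∃ r' ∈ candRows v m r, ∀ i j, Beats v u₀ i j → LexBeats v r' d i j := by
  induction m generalizing r u with
  | zero => exact h.exists_candRows_zero hm
  | succ m ih =>
    obtain ⟨i, j, u', h'⟩ : ∃ i j u', Descent v u₀ m (Function.update r (m + 1)
        (orthReduce r (m + 1) (d - 1 - (m + 1)) (v i - v j))) u' := by
      by_cases h0 : ∀ i j, (inner ℝ u (v i - v j) : ℝ) = 0
      · exact ⟨⟨0, hn⟩, ⟨0, hn⟩, u, h.step_zero h0 _⟩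
      · push Not at h0
        obtain ⟨i₀, j₀, h0⟩ := h0
        exact h.step_pos hm h0
    obtain ⟨r', hr', hb⟩ := ih (by omega) h'
    exact ⟨r', Set.mem_iUnion.2 ⟨i, Set.mem_iUnion.2 ⟨j, hr'⟩⟩, hb⟩

/-- The rows `d, …, 2d - 1` hold the standard basis. -/
def HasBasisRows (r : ℕ → EuclideanSpace ℝ (Fin d)) : Prop :=
  ∀ q : Fin d, r (d + q) = EuclideanSpace.single q 1

/-- Inner products with the standard basis are coordinates, so these rows break every remaining tie
between distinct points, whatever the other rows are. -/
theorem HasBasisRows.exists_inner_ne_zero {r : ℕ → EuclideanSpace ℝ (Fin d)} (hr : HasBasisRows r)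
    (hv : Function.Injective v) (i j : Fin n) (hij : i ≠ j) :
    ∃ l < 2 * d, (inner ℝ (r l) (v i - v j) : ℝ) ≠ 0 := by
  by_contra hc
  push Not at hc
  refine hij (hv (sub_eq_zero.1 ?_))
  ext q
  have := hc (d + q) (by omega)
  rw [hr q, EuclideanSpace.inner_single_left] at this
  simpa using this

/-- The vertices of `M` are exactly the points determined by the candidate directions. -/
theorem extremePoints_eq_candRows (hn : 0 < n) (hd : 0 < d) (hv : Function.Injective v)
    (hp : ∀ i, 0 < p i ∧ p i < 1) {r : ℕ → EuclideanSpace ℝ (Fin d)} (hr : HasBasisRows r) :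
    (minkowskiM v p).extremePoints ℝ =
      (fun r' => vertOf v p (LexBeats v r' (2 * d))) '' candRows v (d - 1) r := by
  ext x
  constructor
  · intro hx
    obtain ⟨u, hu, rfl⟩ := exists_generic_of_mem_extremePoints hv hp hx
    obtain ⟨r', hr', hb⟩ := (Descent.init hu r).exists_candRows hn (by omega)
    refine ⟨r', hr', (vertTop_eq_of_lexBeats hu fun i j hij => ?_).symm⟩
    -- The rows from `d` on come last, so they cannot overturn a decision of the first `d` rows.
    obtain ⟨l, hl, h⟩ := hb i j hij
    exact ⟨l, by omega, h⟩
  · rintro ⟨r', hr', rfl⟩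
    refine vertOf_lexBeats_mem_extremePoints hp (HasBasisRows.exists_inner_ne_zero ?_ hv)
    intro q
    rw [candRows_apply_of_gt hr' (by omega), hr q]

theorem ncard_extremePoints_le (hn : 0 < n) (hd : 0 < d) (hv : Function.Injective v)
    (hp : ∀ i, 0 < p i ∧ p i < 1) :
    ((minkowskiM v p).extremePoints ℝ).ncard ≤ n ^ (2 * d - 2) * (d * 3) := by
  have hr : HasBasisRows (d := d) fun l => if h : l - d < d then
      EuclideanSpace.single ⟨l - d, h⟩ 1 else 0 := by
    intro q
    simp
  rw [extremePoints_eq_candRows hn hd hv hp hr]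
  have := ncard_candRows_le (v := v) (d - 1) (fun l => if h : l - d < d then
      EuclideanSpace.single ⟨l - d, h⟩ 1 else 0)
  refine (Set.ncard_image_le this.1).trans (this.2.trans (le_of_eq ?_))
  rw [show 2 * (d - 1) = 2 * d - 2 by omega]

end Lexicographic

/-! ### A small imperative language compiled to the real RAM

Its states have integer and real variables and eight integer and eight real arrays; its only loops
are bounded, so that programs denote total functions. -/

/-- States of the imperative language. -/
@[ext] structure VState where
  /-- integer variables -/
  I : ℕ → ℕ
  /-- real variables -/
  R : ℕ → ℝ
  /-- integer arrays -/
  A : Fin 8 → ℕ → ℕ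
  /-- real arrays -/
  F : Fin 8 → ℕ → ℝ

namespace VState

/-- Assign to an integer variable. -/
def setI (σ : VState) (x a : ℕ) : VState := { σ with I := Function.update σ.I x a }
/-- Assign to a real variable. -/
def setR (σ : VState) (x : ℕ) (a : ℝ) : VState := { σ with R := Function.update σ.R x a }
/-- Assign to a cell of an integer array. -/
def setA (σ : VState) (k : Fin 8) (i a : ℕ) : VState :=
  { σ with A := fun k' i' => if k' = k ∧ i' = i then a else σ.A k' i' }
/-- Assign to a cell of a real array. -/
def setF (σ : VState) (k : Fin 8) (i : ℕ) (a : ℝ) : VState :=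
  { σ with F := fun k' i' => if k' = k ∧ i' = i then a else σ.F k' i' }
/-- The array to which an address of the flat real memory belongs. -/
def bank (a : ℕ) : Fin 8 := ⟨a % 8, Nat.mod_lt _ (by norm_num)⟩

variable (σ : VState) (x y a : ℕ) (k k' : Fin 8) (i i' : ℕ) (b : ℝ)

@[simp] theorem setI_I : (σ.setI x a).I y = if y = x then a else σ.I y := by
  simp [setI, Function.update_apply]
@[simp] theorem setI_R : (σ.setI x a).R = σ.R := rfl
@[simp] theorem setI_A : (σ.setI x a).A = σ.A := rfl
@[simp] theorem setI_F : (σ.setI x a).F = σ.F := rfl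
@[simp] theorem setR_R : (σ.setR x b).R y = if y = x then b else σ.R y := by
  simp [setR, Function.update_apply]
@[simp] theorem setR_I : (σ.setR x b).I = σ.I := rfl
@[simp] theorem setR_A : (σ.setR x b).A = σ.A := rfl
@[simp] theorem setR_F : (σ.setR x b).F = σ.F := rfl
@[simp] theorem setA_A : (σ.setA k i a).A k' i' = if k' = k ∧ i' = i then a else σ.A k' i' := rfl
@[simp] theorem setA_I : (σ.setA k i a).I = σ.I := rfl
@[simp] theorem setA_R : (σ.setA k i a).R = σ.R := rfl
@[simp] theorem setA_F : (σ.setA k i a).F = σ.F := rfl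
@[simp] theorem setF_F : (σ.setF k i b).F k' i' = if k' = k ∧ i' = i then b else σ.F k' i' := rfl
@[simp] theorem setF_I : (σ.setF k i b).I = σ.I := rfl
@[simp] theorem setF_R : (σ.setF k i b).R = σ.R := rfl
@[simp] theorem setF_A : (σ.setF k i b).A = σ.A := rfl

end VState

/-- Integer expressions. -/
inductive IExp where
  | v (x : ℕ)
  | c (a : ℕ)
  | add (e f : IExp)
  | sub (e f : IExp)
  | a (k : Fin 8) (e : IExp)

/-- Real expressions; `flat e` reads the flat real memory. -/
inductive RExp where
  | v (x : ℕ)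
  | c (z : ℤ)
  | add (e f : RExp)
  | sub (e f : RExp)
  | mul (e f : RExp)
  | div (e f : RExp)
  | a (k : Fin 8) (e : IExp)
  | flat (e : IExp)

/-- Tests. -/
inductive Tst where
  | ilt (e f : IExp)
  | rlt (e f : RExp)

/-- Commands. -/
inductive Cmd where
  | skip
  | iset (x : ℕ) (e : IExp)
  | rset (x : ℕ) (e : RExp)
  | aset (k : Fin 8) (i e : IExp)
  | fset (k : Fin 8) (i : IExp) (e : RExp)
  | flatset (i : IExp) (e : RExp)
  | seq (P Q : Cmd)
  | ite (b : Tst) (P Q : Cmd)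
  | loop (x : ℕ) (e : IExp) (P : Cmd)

namespace IExp

/-- Value of an integer expression. -/
@[simp] def eval (σ : VState) : IExp → ℕ
  | v x => σ.I x
  | c m => m
  | add e f => e.eval σ + f.eval σ
  | sub e f => e.eval σ - f.eval σ
  | a k e => σ.A k (e.eval σ)

/-- Evaluation time of an integer expression. -/
@[simp] def cost : IExp → ℕ
  -- The RAM has no move between registers: a register is copied by setting the target to zero and
  -- adding.
  | v _ => 2
  | c _ => 1
  | add e f => e.cost + f.cost + 1
  | sub e f => e.cost + f.cost + 1
  -- Five instructions form the address `8 * i + k`, and one loads the cell.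
  | a _ e => e.cost + 6

/-- Multiplication by a constant. -/
def mulc : ℕ → IExp → IExp
  | 0, _ => c 0
  | k + 1, e => add (mulc k e) e

@[simp] theorem eval_mulc (σ : VState) (k : ℕ) (e : IExp) : (mulc k e).eval σ = k * e.eval σ := by
  induction k with
  | zero => simp [mulc]
  | succ k ih => simp [mulc, ih, Nat.succ_mul]

end IExp

namespace RExp

/-- Value of a real expression. -/
@[simp] def eval (σ : VState) : RExp → ℝ
  | v x => σ.R x
  | c z => z
  | add e f => e.eval σ + f.eval σ
  | sub e f => e.eval σ - f.eval σ
  | mul e f => e.eval σ * f.eval σ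
  | div e f => e.eval σ / f.eval σ
  | a k e => σ.F k (e.eval σ)
  | flat e => σ.F (VState.bank (e.eval σ)) (e.eval σ / 8)

/-- Evaluation time of a real expression. -/
@[simp] def cost : RExp → ℕ
  | v _ => 2
  | c _ => 1
  | add e f => e.cost + f.cost + 1
  | sub e f => e.cost + f.cost + 1
  | mul e f => e.cost + f.cost + 1
  | div e f => e.cost + f.cost + 1
  | a _ e => e.cost + 6
  | flat e => e.cost + 1

end RExp

namespace Tst

/-- Truth value of a test. -/
def eval (σ : VState) : Tst → Prop
  | ilt e f => e.eval σ < f.eval σ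
  | rlt e f => e.eval σ < f.eval σ

/-- Evaluation time of a test. -/
def cost : Tst → ℕ
  | ilt e f => e.cost + f.cost
  | rlt e f => e.cost + f.cost

@[simp] theorem eval_ilt (σ : VState) (e f : IExp) : (ilt e f).eval σ ↔ e.eval σ < f.eval σ :=
  Iff.rfl
@[simp] theorem eval_rlt (σ : VState) (e f : RExp) : (rlt e f).eval σ ↔ e.eval σ < f.eval σ :=
  Iff.rfl
@[simp] theorem cost_ilt (e f : IExp) : (ilt e f).cost = e.cost + f.cost := rfl
@[simp] theorem cost_rlt (e f : RExp) : (rlt e f).cost = e.cost + f.cost := rfl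

end Tst

namespace Cmd

open Classical in
/-- The effect of a command. -/
def exec : Cmd → VState → VState
  | skip, σ => σ
  | iset x e, σ => σ.setI x (e.eval σ)
  | rset x e, σ => σ.setR x (e.eval σ)
  | aset k i e, σ => σ.setA k (i.eval σ) (e.eval σ)
  | fset k i e, σ => σ.setF k (i.eval σ) (e.eval σ)
  | flatset i e, σ => σ.setF (VState.bank (i.eval σ)) (i.eval σ / 8) (e.eval σ)
  | seq P Q, σ => Q.exec (P.exec σ)
  | ite b P Q, σ => if b.eval σ then P.exec σ else Q.exec σ
  -- The number of iterations is fixed on entry and the counter is rewritten before each one, so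
  -- nothing done by the body can prevent termination.
  | loop x e P, σ => Nat.rec σ (fun k τ => P.exec (τ.setI x k)) (e.eval σ)

/-- The state of a loop after `k` iterations. -/
def iter (x : ℕ) (P : Cmd) (σ : VState) (k : ℕ) : VState :=
  Nat.rec σ (fun k τ => P.exec (τ.setI x k)) k

open Classical in
/-- The running time of a command. -/
def cost : Cmd → VState → ℕ
  | skip, _ => 1
  | iset _ e, _ => e.cost + 2
  | rset _ e, _ => e.cost + 2
  | aset _ i e, _ => i.cost + e.cost + 6
  | fset _ i e, _ => i.cost + e.cost + 6
  | flatset i e, _ => i.cost + e.cost + 1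
  | seq P Q, σ => P.cost σ + Q.cost (P.exec σ)
  | ite b P Q, σ => b.cost + 1 + if b.eval σ then P.cost σ else Q.cost σ
  -- The `2` pays for the initialization of the hidden counter and the failing test; the `5` for
  -- copying the counter to `x`, increasing it, and the successful test.
  | loop x e P, σ => e.cost + 2 +
      ∑ k ∈ range (e.eval σ), (P.cost ((P.iter x σ k).setI x k) + 5)

@[simp] theorem iter_zero (x : ℕ) (P : Cmd) (σ : VState) : P.iter x σ 0 = σ := rfl

@[simp] theorem exec_skip (σ : VState) : skip.exec σ = σ := rfl
@[simp] theorem exec_iset (x : ℕ) (e : IExp) (σ : VState) :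
    (iset x e).exec σ = σ.setI x (e.eval σ) := rfl
@[simp] theorem exec_rset (x : ℕ) (e : RExp) (σ : VState) :
    (rset x e).exec σ = σ.setR x (e.eval σ) := rfl
@[simp] theorem exec_aset (k : Fin 8) (i e : IExp) (σ : VState) :
    (aset k i e).exec σ = σ.setA k (i.eval σ) (e.eval σ) := rfl
@[simp] theorem exec_fset (k : Fin 8) (i : IExp) (e : RExp) (σ : VState) :
    (fset k i e).exec σ = σ.setF k (i.eval σ) (e.eval σ) := rfl
@[simp] theorem exec_flatset (i : IExp) (e : RExp) (σ : VState) :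
    (flatset i e).exec σ = σ.setF (VState.bank (i.eval σ)) (i.eval σ / 8) (e.eval σ) := rfl
@[simp] theorem exec_seq (P Q : Cmd) (σ : VState) : (seq P Q).exec σ = Q.exec (P.exec σ) := rfl
open Classical in
@[simp] theorem exec_ite (b : Tst) (P Q : Cmd) (σ : VState) :
    (ite b P Q).exec σ = if b.eval σ then P.exec σ else Q.exec σ := rfl
theorem exec_loop (x : ℕ) (e : IExp) (P : Cmd) (σ : VState) :
    (loop x e P).exec σ = P.iter x σ (e.eval σ) := rfl

end Cmd

/-! ### The compiler -/

/-- A RAM state represents a state of the language: variables are held in the even registers, the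
arrays are interleaved in the memories, and the odd registers are scratch space. -/
structure Represents (s : RAMState) (σ : VState) : Prop where
  I : ∀ x, s.ireg (2 * x) = σ.I x
  R : ∀ x, s.rreg (2 * x) = σ.R x
  A : ∀ (k : Fin 8) i, s.imem (8 * i + k) = σ.A k i
  F : ∀ (k : Fin 8) i, s.rmem (8 * i + k) = σ.F k i

/-- The scratch registers below `t` are the same. -/
structure SameBelow (t : ℕ) (s s' : RAMState) : Prop where
  I : ∀ j < t, s'.ireg (2 * j + 1) = s.ireg (2 * j + 1)
  R : ∀ j < t, s'.rreg (2 * j + 1) = s.rreg (2 * j + 1)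

theorem SameBelow.refl (t : ℕ) (s : RAMState) : SameBelow t s s := ⟨fun _ _ => rfl, fun _ _ => rfl⟩

theorem SameBelow.trans {t : ℕ} {s s' s'' : RAMState} (h : SameBelow t s s')
    (h' : SameBelow t s' s'') : SameBelow t s s'' :=
  ⟨fun j hj => (h'.I j hj).trans (h.I j hj), fun j hj => (h'.R j hj).trans (h.R j hj)⟩

theorem SameBelow.mono {t t' : ℕ} {s s' : RAMState} (h : SameBelow t s s') (ht : t' ≤ t) :
    SameBelow t' s s' :=
  ⟨fun j hj => h.I j (by omega), fun j hj => h.R j (by omega)⟩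

theorem RAMRuns.of_eq {P : RAMProg} {s s' : RAMState} {t t' : ℕ} (h : RAMRuns P s t s')
    (ht : t = t') : RAMRuns P s t' s' := ht ▸ h

theorem RAMRuns.exec_seq {i : RAMInstr} {P : RAMProg} {s s' : RAMState} {t : ℕ}
    (h : RAMRuns P (i.run s) t s') : RAMRuns (.seq (.exec i) P) s (t + 1) s' :=
  (RAMRuns.seq (.exec i s) h).of_eq (by omega)

/-- Change of an odd integer register. -/
theorem Represents.update_odd {s : RAMState} {σ : VState} (h : Represents s σ) (t a : ℕ) :
    Represents { s with ireg := Function.update s.ireg (2 * t + 1) a } σ :=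
  ⟨fun x => by simp [show 2 * x ≠ 2 * t + 1 by omega, h.I], h.R, h.A, h.F⟩

/-- Change of an odd real register. -/
theorem Represents.update_rodd {s : RAMState} {σ : VState} (h : Represents s σ) (t : ℕ) (a : ℝ) :
    Represents { s with rreg := Function.update s.rreg (2 * t + 1) a } σ :=
  ⟨h.I, fun x => by simp [show 2 * x ≠ 2 * t + 1 by omega, h.R], h.A, h.F⟩

theorem SameBelow.update_odd (s : RAMState) {t t' : ℕ} (ht : t' ≤ t) (a : ℕ) :
    SameBelow t' s { s with ireg := Function.update s.ireg (2 * t + 1) a } :=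
  ⟨fun j hj => by simp [show j ≠ t by omega], fun _ _ => rfl⟩

theorem SameBelow.update_rodd (s : RAMState) {t t' : ℕ} (ht : t' ≤ t) (a : ℝ) :
    SameBelow t' s { s with rreg := Function.update s.rreg (2 * t + 1) a } :=
  ⟨fun _ _ => rfl, fun j hj => by simp [show j ≠ t by omega]⟩

/-- Turns the index in scratch register `t` into the address of a cell of array `k`. -/
def addrProg (t : ℕ) (k : Fin 8) (P : RAMProg) : RAMProg :=
  .seq (.exec (.iadd (2 * t + 1) (2 * t + 1) (2 * t + 1)))
    (.seq (.exec (.iadd (2 * t + 1) (2 * t + 1) (2 * t + 1)))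
      (.seq (.exec (.iadd (2 * t + 1) (2 * t + 1) (2 * t + 1)))
        (.seq (.exec (.iconst (2 * (t + 1) + 1) k))
          (.seq (.exec (.iadd (2 * t + 1) (2 * t + 1) (2 * (t + 1) + 1))) P))))

theorem addrProg_spec {s : RAMState} {σ : VState} (h : Represents s σ) (t : ℕ) (k : Fin 8) :
    ∃ s₁, Represents s₁ σ ∧ s₁.ireg (2 * t + 1) = 8 * s.ireg (2 * t + 1) + k ∧ SameBelow t s s₁ ∧
      s₁.rreg = s.rreg ∧
      ∀ {P : RAMProg} {c : ℕ} {s₂ : RAMState}, RAMRuns P s₁ c s₂ →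
        RAMRuns (addrProg t k P) s (c + 5) s₂ := by
  refine ⟨_, ?_, ?_, ?_, ?_, fun {P c s₂} hP => RAMRuns.exec_seq (RAMRuns.exec_seq
    (RAMRuns.exec_seq (RAMRuns.exec_seq (RAMRuns.exec_seq hP))))⟩
  · exact ((((h.update_odd _ _).update_odd _ _).update_odd _ _).update_odd _ _).update_odd _ _
  · simp [RAMInstr.run]
    omega
  · exact ((((SameBelow.update_odd _ le_rfl _).trans (SameBelow.update_odd _ le_rfl _)).trans
      (SameBelow.update_odd _ le_rfl _)).trans
      (SameBelow.update_odd _ (Nat.le_succ t) _)).trans (SameBelow.update_odd _ le_rfl _)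
  · rfl

namespace IExp

/-- Compilation of an integer expression; the value is left in scratch register `t`. -/
def compile : ℕ → IExp → RAMProg
  | t, v x => .seq (.exec (.iconst (2 * t + 1) 0))
      (.exec (.iadd (2 * t + 1) (2 * t + 1) (2 * x)))
  | t, c m => .exec (.iconst (2 * t + 1) m)
  | t, add e f => .seq (e.compile t) (.seq (f.compile (t + 1))
      (.exec (.iadd (2 * t + 1) (2 * t + 1) (2 * (t + 1) + 1))))
  | t, sub e f => .seq (e.compile t) (.seq (f.compile (t + 1))
      (.exec (.isub (2 * t + 1) (2 * t + 1) (2 * (t + 1) + 1))))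
  | t, a k e => .seq (e.compile t)
      (addrProg t k (.exec (.iload (2 * t + 1) (2 * t + 1))))

/-- The scratch registers are used as a stack: a second operand is evaluated into register `t + 1`,
and `SameBelow` says that the first one survives in register `t`. The running time is exact. -/
theorem compile_spec (e : IExp) (t : ℕ) {s : RAMState} {σ : VState} (h : Represents s σ) :
    ∃ s', RAMRuns (e.compile t) s e.cost s' ∧ Represents s' σ ∧ s'.ireg (2 * t + 1) = e.eval σ ∧
      SameBelow t s s' ∧ s'.rreg = s.rreg := by
  induction e generalizing t s with
  | v x =>
    refine ⟨_, RAMRuns.exec_seq (.exec _ _), (h.update_odd _ _).update_odd _ _, ?_,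
      (SameBelow.update_odd _ le_rfl _).trans (SameBelow.update_odd _ le_rfl _), rfl⟩
    simp [RAMInstr.run, show 2 * x ≠ 2 * t + 1 by omega, h.I]
  | c a =>
    exact ⟨_, .exec _ _, h.update_odd _ _, by simp [RAMInstr.run],
      SameBelow.update_odd _ le_rfl _, rfl⟩
  | add e f ihe ihf =>
    obtain ⟨s₁, r₁, h₁, e₁, b₁, q₁⟩ := ihe t h
    obtain ⟨s₂, r₂, h₂, e₂, b₂, q₂⟩ := ihf (t + 1) h₁
    refine ⟨_, (r₁.seq (r₂.seq (.exec _ _))).of_eq (by simp [add_assoc]), h₂.update_odd _ _, ?_,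
      (b₁.trans (b₂.mono (Nat.le_succ t))).trans (SameBelow.update_odd _ le_rfl _), q₂.trans q₁⟩
    simp [RAMInstr.run, b₂.I t (Nat.lt_succ_self t), e₁, e₂]
  | sub e f ihe ihf =>
    obtain ⟨s₁, r₁, h₁, e₁, b₁, q₁⟩ := ihe t h
    obtain ⟨s₂, r₂, h₂, e₂, b₂, q₂⟩ := ihf (t + 1) h₁
    refine ⟨_, (r₁.seq (r₂.seq (.exec _ _))).of_eq (by simp [add_assoc]), h₂.update_odd _ _, ?_,
      (b₁.trans (b₂.mono (Nat.le_succ t))).trans (SameBelow.update_odd _ le_rfl _), q₂.trans q₁⟩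
    simp [RAMInstr.run, b₂.I t (Nat.lt_succ_self t), e₁, e₂]
  | a k e ih =>
    obtain ⟨s₁, r₁, h₁, e₁, b₁, q₁⟩ := ih t h
    obtain ⟨s₂, h₂, e₂, b₂, q₂, r₂⟩ := addrProg_spec h₁ t k
    refine ⟨_, (r₁.seq (r₂ (.exec _ _))).of_eq (by simp), h₂.update_odd _ _, ?_,
      (b₁.trans b₂).trans (SameBelow.update_odd _ le_rfl _), q₂.trans q₁⟩
    simp [RAMInstr.run, e₂, e₁, h₂.A]

end IExp

theorem Represents.flat {s : RAMState} {σ : VState} (h : Represents s σ) (a : ℕ) :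
    s.rmem a = σ.F (VState.bank a) (a / 8) := by
  rw [← h.F, VState.bank, Nat.div_add_mod]

namespace RExp

/-- Compilation of a real expression; the value is left in scratch register `t`. -/
def compile : ℕ → RExp → RAMProg
  | t, v x => .seq (.exec (.rconst (2 * t + 1) 0))
      (.exec (.radd (2 * t + 1) (2 * t + 1) (2 * x)))
  | t, c z => .exec (.rconst (2 * t + 1) z)
  | t, add e f => .seq (e.compile t) (.seq (f.compile (t + 1))
      (.exec (.radd (2 * t + 1) (2 * t + 1) (2 * (t + 1) + 1))))
  | t, sub e f => .seq (e.compile t) (.seq (f.compile (t + 1))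
      (.exec (.rsub (2 * t + 1) (2 * t + 1) (2 * (t + 1) + 1))))
  | t, mul e f => .seq (e.compile t) (.seq (f.compile (t + 1))
      (.exec (.rmul (2 * t + 1) (2 * t + 1) (2 * (t + 1) + 1))))
  | t, div e f => .seq (e.compile t) (.seq (f.compile (t + 1))
      (.exec (.rdiv (2 * t + 1) (2 * t + 1) (2 * (t + 1) + 1))))
  | t, a k e => .seq (e.compile t)
      (addrProg t k (.exec (.rload (2 * t + 1) (2 * t + 1))))
  | t, flat e => .seq (e.compile t) (.exec (.rload (2 * t + 1) (2 * t + 1)))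

theorem compile_spec (e : RExp) (t : ℕ) {s : RAMState} {σ : VState} (h : Represents s σ) :
    ∃ s', RAMRuns (e.compile t) s e.cost s' ∧ Represents s' σ ∧ s'.rreg (2 * t + 1) = e.eval σ ∧
      SameBelow t s s' := by
  induction e generalizing t s with
  | v x =>
    refine ⟨_, RAMRuns.exec_seq (.exec _ _), (h.update_rodd _ _).update_rodd _ _, ?_,
      (SameBelow.update_rodd _ le_rfl _).trans (SameBelow.update_rodd _ le_rfl _)⟩
    simp [RAMInstr.run, show 2 * x ≠ 2 * t + 1 by omega, h.R]
  | c a =>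
    exact ⟨_, .exec _ _, h.update_rodd _ _, by simp [RAMInstr.run],
      SameBelow.update_rodd _ le_rfl _⟩
  | add e f ihe ihf | sub e f ihe ihf | mul e f ihe ihf | div e f ihe ihf =>
    obtain ⟨s₁, r₁, h₁, e₁, b₁⟩ := ihe t h
    obtain ⟨s₂, r₂, h₂, e₂, b₂⟩ := ihf (t + 1) h₁
    refine ⟨_, (r₁.seq (r₂.seq (.exec _ _))).of_eq (by simp [add_assoc]), h₂.update_rodd _ _, ?_,
      (b₁.trans (b₂.mono (Nat.le_succ t))).trans (SameBelow.update_rodd _ le_rfl _)⟩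
    simp [RAMInstr.run, b₂.R t (Nat.lt_succ_self t), e₁, e₂]
  | a k e =>
    obtain ⟨s₁, r₁, h₁, e₁, b₁, q₁⟩ := e.compile_spec t h
    obtain ⟨s₂, h₂, e₂, b₂, q₂, r₂⟩ := addrProg_spec h₁ t k
    refine ⟨_, (r₁.seq (r₂ (.exec _ _))).of_eq (by simp), h₂.update_rodd _ _, ?_,
      (b₁.trans b₂).trans (SameBelow.update_rodd _ le_rfl _)⟩
    simp [RAMInstr.run, e₂, e₁, h₂.F]
  | flat e =>
    obtain ⟨s₁, r₁, h₁, e₁, b₁, q₁⟩ := e.compile_spec t h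
    refine ⟨_, (r₁.seq (.exec _ _)).of_eq (by simp), h₁.update_rodd _ _, ?_,
      b₁.trans (SameBelow.update_rodd _ le_rfl _)⟩
    simp [RAMInstr.run, e₁, h₁.flat]

end RExp

namespace Tst

/-- The code evaluating the two sides of a test. -/
def code (t : ℕ) : Tst → RAMProg
  | ilt e f => .seq (e.compile t) (f.compile (t + 1))
  | rlt e f => .seq (e.compile t) (f.compile (t + 1))

/-- The comparison of the two sides of a test. -/
def test (t : ℕ) : Tst → RAMTest
  | ilt _ _ => .ilt (2 * t + 1) (2 * (t + 1) + 1)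
  | rlt _ _ => .rlt (2 * t + 1) (2 * (t + 1) + 1)

theorem compile_spec (b : Tst) (t : ℕ) {s : RAMState} {σ : VState} (h : Represents s σ) :
    ∃ s', RAMRuns (b.code t) s b.cost s' ∧ Represents s' σ ∧ ((b.test t).holds s' ↔ b.eval σ) ∧
      SameBelow t s s' := by
  cases b with
  | ilt e f =>
    obtain ⟨s₁, r₁, h₁, e₁, b₁, q₁⟩ := e.compile_spec t h
    obtain ⟨s₂, r₂, h₂, e₂, b₂, q₂⟩ := f.compile_spec (t + 1) h₁
    refine ⟨s₂, r₁.seq r₂, h₂, ?_, b₁.trans (b₂.mono (Nat.le_succ t))⟩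
    simp [test, RAMTest.holds, e₂, b₂.I t (Nat.lt_succ_self t), e₁]
  | rlt e f =>
    obtain ⟨s₁, r₁, h₁, e₁, b₁⟩ := e.compile_spec t h
    obtain ⟨s₂, r₂, h₂, e₂, b₂⟩ := f.compile_spec (t + 1) h₁
    refine ⟨s₂, r₁.seq r₂, h₂, ?_, b₁.trans (b₂.mono (Nat.le_succ t))⟩
    simp [test, RAMTest.holds, e₂, b₂.R t (Nat.lt_succ_self t), e₁]

end Tst

namespace Cmd

/-- Compilation of a command, using the scratch registers from `t` on. -/
def compile : ℕ → Cmd → RAMProg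
  | _, skip => .skip
  | t, iset x e => .seq (e.compile t) (.seq (.exec (.iconst (2 * x) 0))
      (.exec (.iadd (2 * x) (2 * x) (2 * t + 1))))
  | t, rset x e => .seq (e.compile t) (.seq (.exec (.rconst (2 * x) 0))
      (.exec (.radd (2 * x) (2 * x) (2 * t + 1))))
  | t, aset k i e => .seq (e.compile t) (.seq (i.compile (t + 1)) (addrProg (t + 1) k
      (.exec (.istore (2 * (t + 1) + 1) (2 * t + 1)))))
  | t, fset k i e => .seq (e.compile t) (.seq (i.compile (t + 1)) (addrProg (t + 1) k
      (.exec (.rstore (2 * (t + 1) + 1) (2 * t + 1)))))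
  | t, flatset i e => .seq (e.compile t) (.seq (i.compile (t + 1))
      (.exec (.rstore (2 * (t + 1) + 1) (2 * t + 1))))
  | t, seq P Q => .seq (P.compile t) (Q.compile t)
  | t, ite b P Q => .seq (b.code t) (.ite (b.test t) (P.compile t) (Q.compile t))
  | t, loop x e P => .seq (e.compile t) (.seq (.exec (.iconst (2 * (t + 1) + 1) 0))
      (.loop (.ilt (2 * (t + 1) + 1) (2 * t + 1))
        (.seq (.exec (.iconst (2 * x) 0)) (.seq (.exec (.iadd (2 * x) (2 * x) (2 * (t + 1) + 1)))
          (.seq (P.compile (t + 2)) (.seq (.exec (.iconst (2 * (t + 2) + 1) 1))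
            (.exec (.iadd (2 * (t + 1) + 1) (2 * (t + 1) + 1) (2 * (t + 2) + 1)))))))))

/-- In a loop the scratch registers `t` and `t + 1` hold the bound and the true counter. The body is
compiled from `t + 2` on and keeps both; the variable `x` receives only a copy. -/
theorem compile_spec (P : Cmd) (t : ℕ) {s : RAMState} {σ : VState} (h : Represents s σ) :
    ∃ s', RAMRuns (P.compile t) s (P.cost σ) s' ∧ Represents s' (P.exec σ) ∧ SameBelow t s s' := by
  induction P generalizing t s σ with
  | skip => exact ⟨s, .skip s, h, .refl t s⟩
  | iset x e =>
    obtain ⟨s₁, r₁, h₁, e₁, b₁, q₁⟩ := e.compile_spec t h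
    refine ⟨_, (r₁.seq (RAMRuns.exec_seq (.exec _ _))).of_eq (by simp [cost]), ?_, ?_⟩
    · refine ⟨fun y => ?_, h₁.R, h₁.A, h₁.F⟩
      by_cases hy : y = x
      · subst hy; simp [RAMInstr.run, e₁, exec,
          show 2 * t + 1 ≠ 2 * y by omega]
      · simp [RAMInstr.run, Function.update_apply, hy, exec, h₁.I]
    · refine b₁.trans ⟨fun j _ => ?_, fun _ _ => rfl⟩
      simp [RAMInstr.run, Function.update_apply, show 2 * j + 1 ≠ 2 * x by omega]
  | rset x e =>
    obtain ⟨s₁, r₁, h₁, e₁, b₁⟩ := e.compile_spec t h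
    refine ⟨_, (r₁.seq (RAMRuns.exec_seq (.exec _ _))).of_eq (by simp [cost]), ?_, ?_⟩
    · refine ⟨h₁.I, fun y => ?_, h₁.A, h₁.F⟩
      by_cases hy : y = x
      · subst hy; simp [RAMInstr.run, e₁, exec,
          show 2 * t + 1 ≠ 2 * y by omega]
      · simp [RAMInstr.run, Function.update_apply, hy, exec, h₁.R]
    · refine b₁.trans ⟨fun _ _ => rfl, fun j _ => ?_⟩
      simp [RAMInstr.run, Function.update_apply, show 2 * j + 1 ≠ 2 * x by omega]
  | aset k i e =>
    obtain ⟨s₁, r₁, h₁, e₁, b₁, q₁⟩ := e.compile_spec t h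
    obtain ⟨s₂, r₂, h₂, e₂, b₂, q₂⟩ := i.compile_spec (t + 1) h₁
    obtain ⟨s₃, h₃, e₃, b₃, q₃, r₃⟩ := addrProg_spec h₂ (t + 1) k
    refine ⟨_, (r₁.seq (r₂.seq (r₃ (.exec _ _)))).of_eq (by simp [cost]; omega),
      ⟨h₃.I, h₃.R, fun k' i' => ?_, h₃.F⟩,
      (b₁.trans ((b₂.trans b₃).mono (Nat.le_succ t))).trans ⟨fun _ _ => rfl, fun _ _ => rfl⟩⟩
    have e₄ : s₃.ireg (2 * t + 1) = e.eval σ := by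
      rw [b₃.I t (Nat.lt_succ_self t), b₂.I t (Nat.lt_succ_self t), e₁]
    have : (8 * i' + (k' : ℕ) = 8 * i.eval σ + k) ↔ (k' = k ∧ i' = i.eval σ) := by
      rw [Fin.ext_iff]; omega
    simp [RAMInstr.run, Function.update_apply, e₃, e₂, e₄, exec, this, h₃.A]
  | fset k i e =>
    obtain ⟨s₁, r₁, h₁, e₁, b₁⟩ := e.compile_spec t h
    obtain ⟨s₂, r₂, h₂, e₂, b₂, q₂⟩ := i.compile_spec (t + 1) h₁
    obtain ⟨s₃, h₃, e₃, b₃, q₃, r₃⟩ := addrProg_spec h₂ (t + 1) k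
    refine ⟨_, (r₁.seq (r₂.seq (r₃ (.exec _ _)))).of_eq (by simp [cost]; omega),
      ⟨h₃.I, h₃.R, h₃.A, fun k' i' => ?_⟩,
      (b₁.trans ((b₂.trans b₃).mono (Nat.le_succ t))).trans ⟨fun _ _ => rfl, fun _ _ => rfl⟩⟩
    have e₄ : s₃.rreg (2 * t + 1) = e.eval σ := by
      rw [b₃.R t (Nat.lt_succ_self t), b₂.R t (Nat.lt_succ_self t), e₁]
    have : (8 * i' + (k' : ℕ) = 8 * i.eval σ + k) ↔ (k' = k ∧ i' = i.eval σ) := by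
      rw [Fin.ext_iff]; omega
    simp [RAMInstr.run, Function.update_apply, e₃, e₂, e₄, exec, this, h₃.F]
  | flatset i e =>
    obtain ⟨s₁, r₁, h₁, e₁, b₁⟩ := e.compile_spec t h
    obtain ⟨s₂, r₂, h₂, e₂, b₂, q₂⟩ := i.compile_spec (t + 1) h₁
    refine ⟨_, (r₁.seq (r₂.seq (.exec _ _))).of_eq (by simp [cost]; omega),
      ⟨h₂.I, h₂.R, h₂.A, fun k' i' => ?_⟩,
      (b₁.trans (b₂.mono (Nat.le_succ t))).trans ⟨fun _ _ => rfl, fun _ _ => rfl⟩⟩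
    have e₄ : s₂.rreg (2 * t + 1) = e.eval σ := by rw [b₂.R t (Nat.lt_succ_self t), e₁]
    have : (8 * i' + (k' : ℕ) = i.eval σ) ↔
        (k' = VState.bank (i.eval σ) ∧ i' = i.eval σ / 8) := by
      rw [Fin.ext_iff, VState.bank]
      have := k'.2
      simp only
      omega
    simp [RAMInstr.run, Function.update_apply, e₂, e₄, exec, this, h₂.F]
  | seq P Q ihP ihQ =>
    obtain ⟨s₁, r₁, h₁, b₁⟩ := ihP t h
    obtain ⟨s₂, r₂, h₂, b₂⟩ := ihQ t h₁
    exact ⟨s₂, r₁.seq r₂, h₂, b₁.trans b₂⟩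
  | ite b P Q ihP ihQ =>
    obtain ⟨s₁, r₁, h₁, e₁, b₁⟩ := b.compile_spec t h
    by_cases hb : b.eval σ
    · obtain ⟨s₂, r₂, h₂, b₂⟩ := ihP t h₁
      refine ⟨s₂, (r₁.seq (.ite_true (e₁.2 hb) r₂)).of_eq (by simp [cost, hb]; omega), ?_,
        b₁.trans b₂⟩
      simpa [hb] using h₂
    · obtain ⟨s₂, r₂, h₂, b₂⟩ := ihQ t h₁
      refine ⟨s₂, (r₁.seq (.ite_false (fun h' => hb (e₁.1 h')) r₂)).of_eq
        (by simp [cost, hb]; omega), ?_, b₁.trans b₂⟩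
      simpa [hb] using h₂
  | loop x e P ih =>
    obtain ⟨s₁, r₁, h₁, e₁, b₁, q₁⟩ := e.compile_spec t h
    set N := e.eval σ with hN
    -- Induction on the number `m` of iterations still to be made, after `k` of them.
    suffices hs : ∀ m k (s : RAMState), m + k = N → Represents s (P.iter x σ k) →
        s.ireg (2 * t + 1) = N → s.ireg (2 * (t + 1) + 1) = k →
        ∃ s', RAMRuns (.loop (.ilt (2 * (t + 1) + 1) (2 * t + 1))
          (.seq (.exec (.iconst (2 * x) 0)) (.seq (.exec (.iadd (2 * x) (2 * x) (2 * (t + 1) + 1)))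
          (.seq (P.compile (t + 2)) (.seq (.exec (.iconst (2 * (t + 2) + 1) 1))
            (.exec (.iadd (2 * (t + 1) + 1) (2 * (t + 1) + 1) (2 * (t + 2) + 1)))))))) s
          (1 + ∑ j ∈ range m, (P.cost ((P.iter x σ (k + j)).setI x (k + j)) + 5)) s' ∧
          Represents s' (P.iter x σ N) ∧ SameBelow t s s' by
      obtain ⟨s₂, r₂, h₂, b₂⟩ := hs N 0 { s₁ with
        ireg := Function.update s₁.ireg (2 * (t + 1) + 1) 0 } (by omega) (h₁.update_odd (t + 1) 0)
        (by simp [e₁]) (by simp)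
      refine ⟨s₂, (r₁.seq (RAMRuns.exec_seq r₂)).of_eq ?_, h₂,
        (b₁.trans (SameBelow.update_odd s₁ (Nat.le_succ t) 0)).trans b₂⟩
      simp only [cost, zero_add, ← hN]
      omega
    intro m
    induction m with
    | zero =>
      intro k s hk hs h1 h2
      refine ⟨s, (RAMRuns.loop_false ?_).of_eq (by simp), ?_, .refl t s⟩
      · simp [RAMTest.holds, h1, h2]; omega
      · rwa [← hk, zero_add]
    | succ m ihm =>
      intro k s hk hs h1 h2
      set s₁ : RAMState := (RAMInstr.iadd (2 * x) (2 * x) (2 * (t + 1) + 1)).run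
        ((RAMInstr.iconst (2 * x) 0).run s) with hs₁
      have hr₁ : Represents s₁ ((P.iter x σ k).setI x k) := by
        refine ⟨fun y => ?_, hs.R, hs.A, hs.F⟩
        by_cases hy : y = x
        · subst hy; simp [s₁, RAMInstr.run, h2,
            show 2 * (t + 1) + 1 ≠ 2 * y by omega]
        · simp [s₁, RAMInstr.run, Function.update_apply, hy, hs.I]
      have ho : ∀ j, s₁.ireg (2 * j + 1) = s.ireg (2 * j + 1) := fun j => by
        simp [s₁, RAMInstr.run, Function.update_apply, show 2 * j + 1 ≠ 2 * x by omega]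
      obtain ⟨s₂, r₂, hr₂, b₂⟩ := ih (t + 2) hr₁
      set s₃ : RAMState := (RAMInstr.iadd (2 * (t + 1) + 1) (2 * (t + 1) + 1)
        (2 * (t + 2) + 1)).run ((RAMInstr.iconst (2 * (t + 2) + 1) 1).run s₂) with hs₃
      have hr₃ : Represents s₃ (P.iter x σ (k + 1)) := (hr₂.update_odd _ _).update_odd _ _
      have b₃ : SameBelow (t + 1) s₂ s₃ := (SameBelow.update_odd _ (by omega) _).trans
        (SameBelow.update_odd _ (by omega) _)
      obtain ⟨s₄, r₄, hr₄, b₄⟩ := ihm (k + 1) s₃ (by omega) hr₃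
        (by rw [b₃.I t (by omega), b₂.I t (by omega), ho, h1]) (by
          have : s₃.ireg (2 * (t + 1) + 1) = s₂.ireg (2 * (t + 1) + 1) + 1 := by
            simp [hs₃, RAMInstr.run]
          rw [this, b₂.I (t + 1) (by omega), ho, h2])
      have b₀ : SameBelow t s s₁ := ⟨fun j _ => ho j, fun _ _ => rfl⟩
      refine ⟨s₄, (RAMRuns.loop_true ?_ (RAMRuns.exec_seq (RAMRuns.exec_seq (r₂.seq
        (RAMRuns.exec_seq (.exec _ _))))) r₄).of_eq ?_, hr₄,
        ((b₀.trans (b₂.mono (by omega))).trans (b₃.mono (by omega))).trans b₄⟩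
      · simp [RAMTest.holds, h1, h2]; omega
      · rw [sum_range_succ' _ m]
        have hsum : ∑ j ∈ range m, (P.cost ((P.iter x σ (k + (j + 1))).setI x (k + (j + 1))) + 5) =
            ∑ j ∈ range m, (P.cost ((P.iter x σ (k + 1 + j)).setI x (k + 1 + j)) + 5) :=
          sum_congr rfl fun j _ => by rw [show k + (j + 1) = k + 1 + j by omega]
        rw [hsum, add_zero]
        omega

end Cmd

/-! ### Reasoning about commands -/

namespace Cmd

/-- The integer variable `y` is not assigned. -/
def keepsI (y : ℕ) : Cmd → Bool
  | iset x _ => x != y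
  | seq P Q => P.keepsI y && Q.keepsI y
  | ite _ P Q => P.keepsI y && Q.keepsI y
  | loop x _ P => x != y && P.keepsI y
  | _ => true

/-- The real variable `y` is not assigned. -/
def keepsR (y : ℕ) : Cmd → Bool
  | rset x _ => x != y
  | seq P Q => P.keepsR y && Q.keepsR y
  | ite _ P Q => P.keepsR y && Q.keepsR y
  | loop _ _ P => P.keepsR y
  | _ => true

/-- The integer array `y` is not changed. -/
def keepsA (y : Fin 8) : Cmd → Bool
  | aset x _ _ => x != y
  | seq P Q => P.keepsA y && Q.keepsA y
  | ite _ P Q => P.keepsA y && Q.keepsA y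
  | loop _ _ P => P.keepsA y
  | _ => true

/-- The real array `y` is not changed. -/
def keepsF (y : Fin 8) : Cmd → Bool
  | fset x _ _ => x != y
  | flatset _ _ => false
  | seq P Q => P.keepsF y && Q.keepsF y
  | ite _ P Q => P.keepsF y && Q.keepsF y
  | loop _ _ P => P.keepsF y
  | _ => true

/-- `τ` agrees with `σ` on everything that `P` does not assign. -/
structure Frame (P : Cmd) (σ τ : VState) : Prop where
  I : ∀ y, P.keepsI y = true → τ.I y = σ.I y
  R : ∀ y, P.keepsR y = true → τ.R y = σ.R y
  A : ∀ y, P.keepsA y = true → τ.A y = σ.A y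
  F : ∀ y, P.keepsF y = true → τ.F y = σ.F y

theorem Frame.refl (P : Cmd) (σ : VState) : Frame P σ σ :=
  ⟨fun _ _ => rfl, fun _ _ => rfl, fun _ _ => rfl, fun _ _ => rfl⟩

theorem iter_induction {x : ℕ} {P : Cmd} {σ : VState} (p : ℕ → VState → Prop) (h0 : p 0 σ)
    (N : ℕ) (h : ∀ k < N, ∀ τ, p k τ → p (k + 1) (P.exec (τ.setI x k))) : p N (P.iter x σ N) := by
  induction N with
  | zero => exact h0
  | succ N ih => exact h N (by omega) _ (ih fun k hk => h k (by omega))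

/-- What a command may assign is a Boolean function of its syntax. For concrete commands the side
conditions hold by computation, even with a symbolic dimension, because expressions are not
inspected. -/
theorem frame_exec (P : Cmd) (σ : VState) : Frame P σ (P.exec σ) := by
  induction P generalizing σ with
  | skip => exact .refl _ _
  | iset x e =>
    refine ⟨fun y hy => ?_, fun _ _ => rfl, fun _ _ => rfl, fun _ _ => rfl⟩
    have : ¬ x = y := by simpa [keepsI] using hy
    simp [Ne.symm this]
  | rset x e =>
    refine ⟨fun _ _ => rfl, fun y hy => ?_, fun _ _ => rfl, fun _ _ => rfl⟩
    have : ¬ x = y := by simpa [keepsR] using hy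
    simp [Ne.symm this]
  | aset k i e =>
    refine ⟨fun _ _ => rfl, fun _ _ => rfl, fun y hy => ?_, fun _ _ => rfl⟩
    have : ¬ k = y := by simpa [keepsA] using hy
    funext j
    simp [Ne.symm this]
  | fset k i e =>
    refine ⟨fun _ _ => rfl, fun _ _ => rfl, fun _ _ => rfl, fun y hy => ?_⟩
    have : ¬ k = y := by simpa [keepsF] using hy
    funext j
    simp [Ne.symm this]
  | flatset i e =>
    exact ⟨fun _ _ => rfl, fun _ _ => rfl, fun _ _ => rfl, fun y hy => by simp [keepsF] at hy⟩
  | seq P Q ihP ihQ =>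
    constructor
    · intro y hy
      rw [keepsI, Bool.and_eq_true] at hy
      exact ((ihQ _).I y hy.2).trans ((ihP σ).I y hy.1)
    · intro y hy
      rw [keepsR, Bool.and_eq_true] at hy
      exact ((ihQ _).R y hy.2).trans ((ihP σ).R y hy.1)
    · intro y hy
      rw [keepsA, Bool.and_eq_true] at hy
      exact ((ihQ _).A y hy.2).trans ((ihP σ).A y hy.1)
    · intro y hy
      rw [keepsF, Bool.and_eq_true] at hy
      exact ((ihQ _).F y hy.2).trans ((ihP σ).F y hy.1)
  | ite b P Q ihP ihQ =>
    rw [exec_ite]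
    constructor <;> intro y hy <;>
      simp only [keepsI, keepsR, keepsA, keepsF, Bool.and_eq_true] at hy <;> split_ifs
    · exact (ihP σ).I y hy.1
    · exact (ihQ σ).I y hy.2
    · exact (ihP σ).R y hy.1
    · exact (ihQ σ).R y hy.2
    · exact (ihP σ).A y hy.1
    · exact (ihQ σ).A y hy.2
    · exact (ihP σ).F y hy.1
    · exact (ihQ σ).F y hy.2
  | loop x e P ih =>
    rw [exec_loop]
    refine iter_induction (fun _ τ => Frame (loop x e P) σ τ) (.refl _ _) _ fun k _ τ hτ => ?_
    constructor
    · intro y hy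
      have hy' := hy
      rw [keepsI, Bool.and_eq_true] at hy
      have : ¬ x = y := by simpa using hy.1
      rw [(ih _).I y hy.2, ← hτ.I y hy']
      simp [Ne.symm this]
    · intro y hy
      exact ((ih _).R y hy).trans (hτ.R y hy)
    · intro y hy
      exact ((ih _).A y hy).trans (hτ.A y hy)
    · intro y hy
      exact ((ih _).F y hy).trans (hτ.F y hy)

theorem frame_iter (x : ℕ) (e : IExp) (P : Cmd) (σ : VState) (k : ℕ) :
    Frame (loop x e P) σ (P.iter x σ k) := by
  -- The state after `k` iterations is the final state of the loop with constant bound `k`, and the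
  -- frame conditions ignore the bound.
  have h := frame_exec (loop x (.c k) P) σ
  exact ⟨h.I, h.R, h.A, h.F⟩

/-- The invariant rule for loops. -/
theorem loop_induction {x : ℕ} {e : IExp} {P : Cmd} {σ : VState} {N : ℕ} (hN : e.eval σ = N)
    (p : ℕ → VState → Prop) (h0 : p 0 σ)
    (h : ∀ k < N, ∀ τ, Frame (loop x e P) σ τ → p k τ → p (k + 1) (P.exec (τ.setI x k))) :
    p N ((loop x e P).exec σ) := by
  rw [exec_loop, hN]
  have key : ∀ K, K ≤ N → p K (P.iter x σ K) := by
    intro K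
    induction K with
    | zero => exact fun _ => h0
    | succ K ih => exact fun hK => h K hK _ (frame_iter x e P σ K) (ih (by omega))
  exact key _ le_rfl

theorem cost_loop_le {x : ℕ} {e : IExp} {P : Cmd} {σ : VState} (B : ℕ)
    (h : ∀ k < e.eval σ, ∀ τ, Frame (loop x e P) σ τ → P.cost (τ.setI x k) ≤ B) :
    (loop x e P).cost σ ≤ e.cost + 2 + e.eval σ * (B + 5) := by
  rw [cost]
  have := sum_le_card_nsmul (range (e.eval σ))
    (fun k => P.cost ((P.iter x σ k).setI x k) + 5) (B + 5) fun k hk => by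
      have := h k (mem_range.1 hk) _ (frame_iter x e P σ k)
      omega
  rw [card_range, smul_eq_mul] at this
  omega

theorem cost_seq (P Q : Cmd) (σ : VState) :
    (seq P Q).cost σ = P.cost σ + Q.cost (P.exec σ) := rfl

/-- All loops of the command have a constant number of iterations. -/
def isStatic : Cmd → Bool
  | seq P Q => P.isStatic && Q.isStatic
  | ite _ P Q => P.isStatic && Q.isStatic
  | loop _ (.c _) P => P.isStatic
  | loop _ _ _ => false
  | _ => true

/-- A bound for the running time of a static command. -/
def bound : Cmd → ℕ
  | skip => 1
  | iset _ e => e.cost + 2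
  | rset _ e => e.cost + 2
  | aset _ i e => i.cost + e.cost + 6
  | fset _ i e => i.cost + e.cost + 6
  | flatset i e => i.cost + e.cost + 1
  | seq P Q => P.bound + Q.bound
  | ite b P Q => b.cost + 1 + (P.bound + Q.bound)
  | loop _ (.c N) P => 3 + N * (P.bound + 5)
  | loop _ _ _ => 0

theorem cost_le_bound (P : Cmd) (hP : P.isStatic = true) (σ : VState) : P.cost σ ≤ P.bound := by
  induction P generalizing σ with
  | seq P Q ihP ihQ =>
    rw [isStatic, Bool.and_eq_true] at hP
    exact add_le_add (ihP hP.1 _) (ihQ hP.2 _)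
  | ite b P Q ihP ihQ =>
    rw [isStatic, Bool.and_eq_true] at hP
    have h1 := ihP hP.1 σ
    have h2 := ihQ hP.2 σ
    rw [cost, bound]
    split_ifs <;> omega
  | loop x e P ih =>
    cases e with
    | c N =>
      refine (cost_loop_le P.bound fun k _ τ _ => ih hP _).trans (le_of_eq ?_)
      simp [bound]
    | _ => simp [isStatic] at hP
  | _ => exact le_rfl

theorem cost_loop_le_bound {x : ℕ} {e : IExp} {P : Cmd} {σ : VState} {N : ℕ} (hN : e.eval σ = N)
    (hP : P.isStatic = true) : (loop x e P).cost σ ≤ e.cost + 2 + N * (P.bound + 5) :=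
  hN ▸ cost_loop_le _ fun _ _ _ _ => cost_le_bound P hP _

@[simp] theorem cost_iset (x : ℕ) (e : IExp) (σ : VState) : (iset x e).cost σ = e.cost + 2 := rfl
@[simp] theorem cost_rset (x : ℕ) (e : RExp) (σ : VState) : (rset x e).cost σ = e.cost + 2 := rfl
@[simp] theorem cost_aset (k : Fin 8) (i e : IExp) (σ : VState) :
    (aset k i e).cost σ = i.cost + e.cost + 6 := rfl
@[simp] theorem cost_fset (k : Fin 8) (i : IExp) (e : RExp) (σ : VState) :
    (fset k i e).cost σ = i.cost + e.cost + 6 := rfl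

end Cmd

/-! ### Merging blocks -/

/-- `A` is sorted by `K` on each of the blocks of length `w` into which `{0, …, m - 1}` is cut. -/
def BlockSorted {α : Type*} [LinearOrder α] (K : ℕ → α) (A : ℕ → ℕ) (w m : ℕ) : Prop :=
  ∀ q x y, q * w ≤ x → x < y → y < (q + 1) * w → y < m → K (A x) ≤ K (A y)

/-- The invariant of merging the blocks of length `w` of `A` in pairs into `B`, when `k` elements
have been merged. The current pair of blocks is `[q * (2 * w), ea)` and `[ea, eb)`, of which the
parts `[a, ea)` and `[b, eb)` are left. -/
structure MergeInv {α : Type*} [LinearOrder α] (K : ℕ → α) (A : ℕ → ℕ) (w m k a ea b eb : ℕ)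
    (B : ℕ → ℕ) (q : ℕ) : Prop where
  hsa : q * (2 * w) ≤ a
  hea : ea = min (q * (2 * w) + w) m
  heb : eb = min (q * (2 * w) + 2 * w) m
  haea : a ≤ ea
  heab : ea ≤ b
  hbeb : b ≤ eb
  hk : k + ea = a + b
  sorted : ∀ x y, q * (2 * w) ≤ x → x < y → y < k → K (B x) ≤ K (B y)
  le : ∀ x y, q * (2 * w) ≤ x → x < k → (a ≤ y ∧ y < ea ∨ b ≤ y ∧ y < eb) → K (B x) ≤ K (A y)
  prev : ∀ q' x y, q' * (2 * w) ≤ x → x < y → y < (q' + 1) * (2 * w) → y < q * (2 * w) →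
    K (B x) ≤ K (B y)
  -- This says, without subtraction of multisets, that the first `k` cells of `B` hold the cells
  -- `[0, a)` and `[ea, b)` of `A`.
  perm : (Multiset.range k).map B + (Multiset.range ea).map A =
    (Multiset.range a).map A + (Multiset.range b).map A

section

variable {α : Type*} [LinearOrder α] {K : ℕ → α} {A B : ℕ → ℕ} {w m k a ea b eb q : ℕ}

theorem map_range_congr {B' : ℕ → ℕ} (h : ∀ i < k, B' i = B i) :
    (Multiset.range k).map B' = (Multiset.range k).map B :=
  Multiset.map_congr rfl fun i hi => h i (Multiset.mem_range.1 hi)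

theorem MergeInv.init (w m : ℕ) (K : ℕ → α) (A B : ℕ → ℕ) :
    MergeInv K A w m 0 0 (min w m) (min w m) (min (min w m + w) m) B 0 where
  hsa := by omega
  hea := by simp
  heb := by omega
  haea := by omega
  heab := le_rfl
  hbeb := by omega
  hk := rfl
  sorted := by intro x y _ _ h; omega
  le := by intro x y _ h; omega
  prev := by intro q' x y _ _ _ h; omega
  perm := by simp

theorem MergeInv.newBlock (h : MergeInv K A w m k a ea b eb B q) (hkm : k < m) (ha : ¬ a < ea)
    (hb : ¬ b < eb) : MergeInv K A w m k k (min (k + w) m) (min (k + w) m)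
      (min (min (k + w) m + w) m) B (q + 1) := by
  obtain ⟨h1, h2, h3, h4, h5, h6, h7, h8, h9, h10, h11⟩ := h
  have e : (q + 1) * (2 * w) = q * (2 * w) + 2 * w := by ring
  -- Since `k < m`, the exhausted pair of blocks was not cut off by the end of the array.
  have hk : k = q * (2 * w) + 2 * w := by omega
  have hab : a = ea := by omega
  have hbk : b = k := by omega
  refine ⟨by omega, by omega, by omega, by omega, le_rfl, by omega, rfl, fun x y hx hxy hy => ?_,
    fun x y hx hxk => ?_, fun q' x y hx hxy hy hyq => ?_, ?_⟩
  · omega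
  · omega
  · rcases lt_trichotomy q' q with hq | rfl | hq
    · refine h10 q' x y hx hxy hy (lt_of_lt_of_le hy ?_)
      exact Nat.mul_le_mul_right _ hq
    · exact h8 x y hx hxy (by omega)
    · have := Nat.mul_le_mul_right (2 * w) (show q + 1 ≤ q' from hq)
      omega
  · rw [hab, hbk, add_comm] at h11
    rw [add_left_cancel h11]

theorem MergeInv.takeLeft (h : MergeInv K A w m k a ea b eb B q) (hA : BlockSorted K A w m)
    (ha : a < ea) (hab : b < eb → K (A a) ≤ K (A b)) :
    MergeInv K A w m (k + 1) (a + 1) ea b eb (fun i => if i = k then A a else B i) q := by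
  obtain ⟨h1, h2, h3, h4, h5, h6, h7, h8, h9, h10, h11⟩ := h
  have e1 : 2 * q * w = q * (2 * w) := by ring
  have e2 : (2 * q + 1) * w = q * (2 * w) + w := by ring
  have e3 : (2 * q + 1 + 1) * w = q * (2 * w) + 2 * w := by ring
  have hmin : ∀ y, (a + 1 ≤ y ∧ y < ea ∨ b ≤ y ∧ y < eb) → K (A a) ≤ K (A y) := by
    rintro y (⟨hy1, hy2⟩ | ⟨hy1, hy2⟩)
    · exact hA (2 * q) a y (by omega) (by omega) (by omega) (by omega)
    · refine (hab (by omega)).trans ?_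
      rcases hy1.eq_or_lt with rfl | hy1
      · exact le_rfl
      · exact hA (2 * q + 1) b y (by omega) hy1 (by omega) (by omega)
  refine ⟨by omega, h2, h3, by omega, h5, h6, by omega, fun x y hx hxy hy => ?_,
    fun x y hx hxk hy => ?_, fun q' x y hx hxy hy hyq => ?_, ?_⟩
  · rw [if_neg (by omega)]
    split_ifs with hyk
    · exact h9 x a hx (by omega) (Or.inl ⟨le_rfl, ha⟩)
    · exact h8 x y hx hxy (by omega)
  · split_ifs with hx'
    · exact hmin y hy
    · exact h9 x y hx (by omega) (hy.imp (fun h => ⟨by omega, h.2⟩) id)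
  · rw [if_neg (by omega), if_neg (by omega)]
    exact h10 q' x y hx hxy hy hyq
  · rw [Multiset.range_succ, Multiset.range_succ, Multiset.map_cons, Multiset.map_cons, if_pos rfl,
      map_range_congr (B := B) (fun i hi => if_neg (by omega)), Multiset.cons_add, Multiset.cons_add,
      h11]

theorem MergeInv.takeRight (h : MergeInv K A w m k a ea b eb B q) (hA : BlockSorted K A w m)
    (hb : b < eb) (hab : a < ea → K (A b) ≤ K (A a)) :
    MergeInv K A w m (k + 1) a ea (b + 1) eb (fun i => if i = k then A b else B i) q := by
  obtain ⟨h1, h2, h3, h4, h5, h6, h7, h8, h9, h10, h11⟩ := h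
  have e1 : 2 * q * w = q * (2 * w) := by ring
  have e2 : (2 * q + 1) * w = q * (2 * w) + w := by ring
  have e3 : (2 * q + 1 + 1) * w = q * (2 * w) + 2 * w := by ring
  have hmin : ∀ y, (a ≤ y ∧ y < ea ∨ b + 1 ≤ y ∧ y < eb) → K (A b) ≤ K (A y) := by
    rintro y (⟨hy1, hy2⟩ | ⟨hy1, hy2⟩)
    · refine (hab (by omega)).trans ?_
      rcases hy1.eq_or_lt with rfl | hy1
      · exact le_rfl
      · exact hA (2 * q) a y (by omega) (by omega) (by omega) (by omega)
    · exact hA (2 * q + 1) b y (by omega) (by omega) (by omega) (by omega)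
  refine ⟨by omega, h2, h3, by omega, by omega, by omega, by omega, fun x y hx hxy hy => ?_,
    fun x y hx hxk hy => ?_, fun q' x y hx hxy hy hyq => ?_, ?_⟩
  · rw [if_neg (by omega)]
    split_ifs with hyk
    · exact h9 x b hx (by omega) (Or.inr ⟨le_rfl, hb⟩)
    · exact h8 x y hx hxy (by omega)
  · split_ifs with hx'
    · exact hmin y hy
    · exact h9 x y hx (by omega) (hy.imp id fun h => ⟨by omega, h.2⟩)
  · rw [if_neg (by omega), if_neg (by omega)]
    exact h10 q' x y hx hxy hy hyq
  · rw [Multiset.range_succ, Multiset.range_succ, Multiset.map_cons, Multiset.map_cons, if_pos rfl,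
      map_range_congr (B := B) (fun i hi => if_neg (by omega)), Multiset.cons_add, Multiset.add_cons,
      h11]

theorem MergeInv.blockSorted (h : MergeInv K A w m m a ea b eb B q) :
    BlockSorted K B (2 * w) m ∧ (Multiset.range m).map B = (Multiset.range m).map A := by
  obtain ⟨h1, h2, h3, h4, h5, h6, h7, h8, h9, h10, h11⟩ := h
  have hb : b = m := by omega
  have ha : a = ea := by omega
  constructor
  · intro q' x y hx hxy hy hym
    rcases lt_trichotomy q' q with hq | rfl | hq
    · refine h10 q' x y hx hxy hy (lt_of_lt_of_le hy ?_)
      exact Nat.mul_le_mul_right _ hq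
    · exact h8 x y hx hxy hym
    · have := Nat.mul_le_mul_right (2 * w) (show q ≤ q' from hq.le)
      exact h8 x y (by omega) hxy hym
  · subst hb ha
    rw [add_comm] at h11
    exact add_left_cancel h11

end

/-! ### Sorting

Integer variables: `1` number of items, `2` number of passes, `3` block length, `4` pass, `5` loop
counter, `6`–`9` bounds of the blocks being merged, `10` result of a comparison, `11` loop counter,
`12`, `13` compared items. Integer arrays: `0` permutation, `1` auxiliary. Real array `0` holds the
keys, `D` consecutive cells for every item. -/

open Cmd

/-- The key of an item. -/
def itemKey (D : ℕ) (σ : VState) (x : ℕ) : Lex (Fin D → ℝ) := toLex fun l => σ.F 0 (D * x + l)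

/-- Lexicographic comparison of the keys of the items in the variables `12` and `13`. -/
def lexCmp (D : ℕ) : Cmd :=
  .seq (.iset 10 (.c 0)) (.loop 11 (.c D) (.ite (.ilt (.v 10) (.c 1))
    (.ite (.rlt (.a 0 (.add (.mulc D (.v 12)) (.v 11))) (.a 0 (.add (.mulc D (.v 13)) (.v 11))))
      (.iset 10 (.c 1))
      (.ite (.rlt (.a 0 (.add (.mulc D (.v 13)) (.v 11))) (.a 0 (.add (.mulc D (.v 12)) (.v 11))))
        (.iset 10 (.c 2)) .skip)) .skip))

/-- The flag is `0` as long as the keys agree. The first difference sets it to `1` or `2`, after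
which the rest of the key is ignored; this is exactly the lexicographic comparison. -/
theorem lexCmp_spec (D : ℕ) (σ : VState) :
    ((lexCmp D).exec σ).I 10 < 3 ∧
    (((lexCmp D).exec σ).I 10 = 0 ↔ itemKey D σ (σ.I 12) = itemKey D σ (σ.I 13)) ∧
    (((lexCmp D).exec σ).I 10 = 1 ↔ itemKey D σ (σ.I 12) < itemKey D σ (σ.I 13)) := by
  set f : ℕ → ℝ := fun l => σ.F 0 (D * σ.I 12 + l) with hf
  set g : ℕ → ℝ := fun l => σ.F 0 (D * σ.I 13 + l) with hg
  have key : (fun k (τ : VState) => (τ.I 10 = 0 ∧ ∀ l < k, f l = g l) ∨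
      (τ.I 10 = 1 ∧ ∃ l < k, (∀ l' < l, f l' = g l') ∧ f l < g l) ∨
      (τ.I 10 = 2 ∧ ∃ l < k, (∀ l' < l, f l' = g l') ∧ g l < f l)) D ((lexCmp D).exec σ) := by
    rw [lexCmp, exec_seq]
    refine loop_induction rfl (fun k (τ : VState) => (τ.I 10 = 0 ∧ ∀ l < k, f l = g l) ∨
      (τ.I 10 = 1 ∧ ∃ l < k, (∀ l' < l, f l' = g l') ∧ f l < g l) ∨
      (τ.I 10 = 2 ∧ ∃ l < k, (∀ l' < l, f l' = g l') ∧ g l < f l))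
      (Or.inl ⟨by simp, fun l hl => by omega⟩) ?_
    intro k hk τ hτ hp
    have e12 : τ.I 12 = σ.I 12 := by rw [hτ.I 12 rfl]; simp
    have e13 : τ.I 13 = σ.I 13 := by rw [hτ.I 13 rfl]; simp
    have eF : τ.F 0 = σ.F 0 := by rw [hτ.F 0 rfl]; simp
    simp only [exec_ite, Tst.eval_ilt, Tst.eval_rlt, IExp.eval, RExp.eval, IExp.eval_mulc,
      VState.setI_I, VState.setI_F, eF, exec_iset, exec_skip]
    simp only [show (12 : ℕ) ≠ 11 by decide, show (13 : ℕ) ≠ 11 by decide,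
      show (10 : ℕ) ≠ 11 by decide, if_false, if_true, e12, e13]
    rcases hp with ⟨h0, hp⟩ | ⟨h0, l, hl, hp⟩ | ⟨h0, l, hl, hp⟩
    · rw [if_pos (by omega)]
      split_ifs with h1 h2
      · exact Or.inr (Or.inl ⟨by simp, k, by omega, hp, h1⟩)
      · exact Or.inr (Or.inr ⟨by simp, k, by omega, hp, h2⟩)
      · refine Or.inl ⟨by simpa using h0, fun l hl => ?_⟩
        rcases Nat.lt_succ_iff_lt_or_eq.1 hl with h | rfl
        · exact hp l h
        · exact le_antisymm (not_lt.1 h2) (not_lt.1 h1)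
    · rw [if_neg (by omega)]
      exact Or.inr (Or.inl ⟨by simpa using h0, l, by omega, hp⟩)
    · rw [if_neg (by omega)]
      exact Or.inr (Or.inr ⟨by simpa using h0, l, by omega, hp⟩)
  have hlt : ∀ {x y : ℕ}, (∃ l < D, (∀ l' < l, σ.F 0 (D * x + l') = σ.F 0 (D * y + l')) ∧
      σ.F 0 (D * x + l) < σ.F 0 (D * y + l)) → itemKey D σ x < itemKey D σ y := by
    rintro x y ⟨l, hl, h1, h2⟩
    exact ⟨⟨l, hl⟩, fun l' hl' => h1 l' hl', h2⟩
  rcases key with ⟨h0, hp⟩ | ⟨h0, hp⟩ | ⟨h0, hp⟩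
  · have : itemKey D σ (σ.I 12) = itemKey D σ (σ.I 13) := by
      rw [itemKey, itemKey]
      congr 1
      funext l
      exact hp l l.2
    simp only [h0, this, zero_ne_one, false_iff]
    exact ⟨by omega, trivial, lt_irrefl _⟩
  · have := hlt hp
    simp [h0, this, this.ne]
  · have := hlt (x := σ.I 13) (y := σ.I 12) (by
      obtain ⟨l, hl, h1, h2⟩ := hp
      exact ⟨l, hl, fun l' hl' => (h1 l' hl').symm, h2⟩)
    simp only [h0, this.ne']
    exact ⟨by omega, by simp, fun h => by omega, fun h => absurd h this.le.not_gt⟩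

/-- `min e m`, where `m` is the number of items. -/
def minItems (e : IExp) : IExp := .sub e (.sub e (.v 1))

@[simp] theorem eval_minItems (σ : VState) (e : IExp) :
    (minItems e).eval σ = min (e.eval σ) (σ.I 1) := by
  simp only [minItems, IExp.eval]; omega

/-- Begin with the next pair of blocks if the current one is exhausted. -/
def mergeBlock : Cmd :=
  .ite (.ilt (.v 6) (.v 7)) .skip (.ite (.ilt (.v 8) (.v 9)) .skip
    (.seq (.iset 6 (.v 5)) (.seq (.iset 7 (minItems (.add (.v 5) (.v 3))))
      (.seq (.iset 8 (.v 7)) (.iset 9 (minItems (.add (.v 7) (.v 3))))))))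

/-- Decide from which block the next element is taken: from the second one if the result is
greater than `1`. -/
def mergeSelect (D : ℕ) : Cmd :=
  .ite (.ilt (.v 6) (.v 7))
    (.ite (.ilt (.v 8) (.v 9))
      (.seq (.iset 12 (.a 0 (.v 6))) (.seq (.iset 13 (.a 0 (.v 8))) (lexCmp D)))
      (.iset 10 (.c 0)))
    (.iset 10 (.c 2))

/-- Move the next element. -/
def mergeMove : Cmd :=
  .ite (.ilt (.c 1) (.v 10))
    (.seq (.aset 1 (.v 5) (.a 0 (.v 8))) (.iset 8 (.add (.v 8) (.c 1))))
    (.seq (.aset 1 (.v 5) (.a 0 (.v 6))) (.iset 6 (.add (.v 6) (.c 1))))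

/-- Merge the blocks of array `0` in pairs into array `1`. -/
def mergePass (D : ℕ) : Cmd :=
  .seq (.iset 6 (.c 0)) (.seq (.iset 7 (minItems (.v 3))) (.seq (.iset 8 (.v 7))
    (.seq (.iset 9 (minItems (.add (.v 7) (.v 3))))
      (.loop 5 (.v 1) (.seq mergeBlock (.seq (mergeSelect D) mergeMove))))))

/-- Copy array `1` to array `0`. -/
def copyBack : Cmd := .loop 5 (.v 1) (.aset 0 (.v 5) (.a 1 (.v 5)))

/-- Compute the binary logarithm of the number of items. -/
def logItems : Cmd :=
  .seq (.iset 2 (.c 0)) (.seq (.iset 3 (.c 1)) (.loop 5 (.v 1) (.ite (.ilt (.v 3) (.v 1))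
    (.seq (.iset 2 (.add (.v 2) (.c 1))) (.iset 3 (.add (.v 3) (.v 3)))) .skip)))

/-- Merge sort: array `0` becomes a permutation of the items that sorts their keys. -/
def sortItems (D : ℕ) : Cmd :=
  .seq logItems (.seq (.iset 3 (.c 1)) (.seq (.loop 5 (.v 1) (.aset 0 (.v 5) (.v 5)))
    (.loop 4 (.v 2) (.seq (mergePass D) (.seq copyBack (.iset 3 (.add (.v 3) (.v 3))))))))

theorem mergeBlock_spec {D : ℕ} {K : ℕ → Lex (Fin D → ℝ)} {A : ℕ → ℕ} {w m k q : ℕ} {τ : VState}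
    (hw : 0 < w) (h3 : τ.I 3 = w) (h1 : τ.I 1 = m) (h5 : τ.I 5 = k) (hk : k < m)
    (h : MergeInv K A w m k (τ.I 6) (τ.I 7) (τ.I 8) (τ.I 9) (τ.A 1) q) (τ' : VState)
    (hτ' : τ' = mergeBlock.exec τ) :
    (∃ q', MergeInv K A w m k (τ'.I 6) (τ'.I 7) (τ'.I 8) (τ'.I 9) (τ'.A 1) q') ∧
      (τ'.I 6 < τ'.I 7 ∨ τ'.I 8 < τ'.I 9) := by
  rw [hτ', mergeBlock]
  simp only [exec_ite, Tst.eval_ilt, IExp.eval]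
  split_ifs with ha hb
  · exact ⟨⟨q, h⟩, Or.inl ha⟩
  · exact ⟨⟨q, h⟩, Or.inr hb⟩
  · have := h.newBlock hk ha hb
    simp only [exec_seq, exec_iset, IExp.eval, eval_minItems, VState.setI_I, VState.setI_A]
    norm_num
    rw [h1, h3, h5]
    refine ⟨⟨q + 1, this⟩, ?_⟩
    have e : (q + 1) * (2 * w) = q * (2 * w) + 2 * w := by ring
    have h2 := this.hea
    have h4 := this.heb
    have h5 := this.hk
    have h6 := h.heb
    have h7 := h.hk
    have h8 := h.hea
    have h9 := h.hbeb
    have h10 := h.haea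
    omega

theorem mergeSelect_spec {D : ℕ} {τ : VState} (h : τ.I 6 < τ.I 7 ∨ τ.I 8 < τ.I 9) (τ' : VState)
    (hτ' : τ' = (mergeSelect D).exec τ) :
    (1 < τ'.I 10 → τ.I 8 < τ.I 9 ∧ (τ.I 6 < τ.I 7 →
      itemKey D τ (τ.A 0 (τ.I 8)) ≤ itemKey D τ (τ.A 0 (τ.I 6)))) ∧
    (¬ 1 < τ'.I 10 → τ.I 6 < τ.I 7 ∧ (τ.I 8 < τ.I 9 →
      itemKey D τ (τ.A 0 (τ.I 6)) ≤ itemKey D τ (τ.A 0 (τ.I 8)))) := by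
  rw [hτ', mergeSelect]
  simp only [exec_ite, Tst.eval_ilt, IExp.eval]
  split_ifs with ha hb
  · obtain ⟨s1, s2, s3⟩ := lexCmp_spec D (((Cmd.iset 13 (.a 0 (.v 8))).exec
      ((Cmd.iset 12 (.a 0 (.v 6))).exec τ)))
    simp only [exec_iset, IExp.eval, VState.setI_I, VState.setI_A] at s1 s2 s3
    norm_num at s1 s2 s3
    have e : ∀ x, itemKey D ((τ.setI 12 (τ.A 0 (τ.I 6))).setI 13 (τ.A 0 (τ.I 8))) x =
      itemKey D τ x := fun x => rfl
    rw [e, e] at s2 s3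
    simp only [exec_seq, exec_iset, IExp.eval, VState.setI_I, VState.setI_A]
    norm_num
    refine ⟨fun h1 => ⟨hb, fun _ => ?_⟩, fun h1 => ⟨ha, fun _ => ?_⟩⟩
    · refine le_of_not_gt fun hc => ?_
      have := s3.2 hc
      omega
    · have : ∀ i, i ≤ 1 → i = 0 ∨ i = 1 := by omega
      rcases this _ h1 with h2 | h2
      · exact (s2.1 h2).le
      · exact (s3.1 h2).le
  · simp [ha, hb]
  · simp only [exec_iset, IExp.eval, VState.setI_I]
    norm_num
    exact ⟨h.resolve_left ha, fun h => by omega⟩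

theorem mergePass_spec {D : ℕ} {σ : VState} {w m : ℕ} (hw : 0 < w) (h3 : σ.I 3 = w)
    (h1 : σ.I 1 = m) (hA : BlockSorted (itemKey D σ) (σ.A 0) w m) :
    BlockSorted (itemKey D σ) (((mergePass D).exec σ).A 1) (2 * w) m ∧
      (Multiset.range m).map (((mergePass D).exec σ).A 1) = (Multiset.range m).map (σ.A 0) := by
  suffices hs : (fun k (τ : VState) => ∃ q, MergeInv (itemKey D σ) (σ.A 0) w m k (τ.I 6) (τ.I 7)
      (τ.I 8) (τ.I 9) (τ.A 1) q) m ((mergePass D).exec σ) by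
    obtain ⟨q, hq⟩ := hs
    exact hq.blockSorted
  rw [mergePass]
  simp only [exec_seq]
  refine loop_induction (N := m) (by simpa using h1) (fun k (τ : VState) => ∃ q,
    MergeInv (itemKey D σ) (σ.A 0) w m k (τ.I 6) (τ.I 7) (τ.I 8) (τ.I 9) (τ.A 1) q) ⟨0, ?_⟩ ?_
  · have := MergeInv.init w m (itemKey D σ) (σ.A 0) (σ.A 1)
    simpa [h3, h1] using this
  · intro k hk' τ hτ hp
    have e1 : τ.I 1 = m := by rw [hτ.I 1 rfl]; simpa using h1
    have e3 : τ.I 3 = w := by rw [hτ.I 3 rfl]; simpa using h3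
    have eA : τ.A 0 = σ.A 0 := by rw [hτ.A 0 rfl]; simp
    have eF : τ.F 0 = σ.F 0 := by rw [hτ.F 0 rfl]; simp
    obtain ⟨q, hq⟩ := hp
    rw [exec_seq, exec_seq]
    set τ₀ := τ.setI 5 k with hτ₀
    set τ₁ := mergeBlock.exec τ₀ with hτ₁
    set τ₂ := (mergeSelect D).exec τ₁ with hτ₂
    have f₁ := frame_exec mergeBlock τ₀
    have f₂ := frame_exec (mergeSelect D) τ₁
    obtain ⟨⟨q', hq'⟩, hne⟩ := mergeBlock_spec (D := D) (τ := τ₀) hw (by simpa [hτ₀] using e3)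
      (by simpa [hτ₀] using e1) (k := k) (q := q) (by simp [hτ₀]) hk'
      (by simpa [hτ₀] using hq) τ₁ rfl
    have hsel := mergeSelect_spec (D := D) hne τ₂ rfl
    have eK : itemKey D τ₁ = itemKey D σ := by
      funext x; simp only [itemKey]; rw [f₁.F 0 rfl, hτ₀, VState.setI_F, eF]
    have eA₁ : τ₁.A 0 = σ.A 0 := by rw [f₁.A 0 rfl, hτ₀, VState.setI_A, eA]
    have eA₂ : τ₂.A 0 = σ.A 0 := by rw [f₂.A 0 rfl, eA₁]
    have g6 : τ₂.I 6 = τ₁.I 6 := f₂.I 6 rfl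
    have g7 : τ₂.I 7 = τ₁.I 7 := f₂.I 7 rfl
    have g8 : τ₂.I 8 = τ₁.I 8 := f₂.I 8 rfl
    have g9 : τ₂.I 9 = τ₁.I 9 := f₂.I 9 rfl
    have g5 : τ₂.I 5 = k := by rw [f₂.I 5 rfl, f₁.I 5 rfl]; simp [hτ₀]
    have gA : τ₂.A 1 = τ₁.A 1 := f₂.A 1 rfl
    rw [eK, eA₁] at hsel
    rw [mergeMove, exec_ite]
    split_ifs with ht
    · simp only [Tst.eval_ilt, IExp.eval] at ht
      refine ⟨q', ?_⟩
      have := hq'.takeRight hA (hsel.1 ht).1 (hsel.1 ht).2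
      simp only [exec_seq, exec_aset, exec_iset, IExp.eval, VState.setI_I, VState.setI_A,
        VState.setA_I, g5, g6, g7, g8, g9, eA₂]
      norm_num
      convert this using 2
      simp [gA]
    · simp only [Tst.eval_ilt, IExp.eval] at ht
      refine ⟨q', ?_⟩
      have := hq'.takeLeft hA (hsel.2 ht).1 (hsel.2 ht).2
      simp only [exec_seq, exec_aset, exec_iset, IExp.eval, VState.setI_I, VState.setI_A,
        VState.setA_I, g5, g6, g7, g8, g9, eA₂]
      norm_num
      convert this using 2
      simp [gA]

theorem copyBack_spec {σ : VState} {i : ℕ} (hi : i < σ.I 1) :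
    (copyBack.exec σ).A 0 i = σ.A 1 i := by
  suffices hs : (fun k (τ : VState) => ∀ i < k, τ.A 0 i = σ.A 1 i) (σ.I 1) (copyBack.exec σ) from
    hs i hi
  rw [copyBack]
  refine loop_induction (N := σ.I 1) (by simp) (fun k (τ : VState) => ∀ i < k, τ.A 0 i = σ.A 1 i)
    (fun i hi => by omega) fun k _ τ hτ hp i hi => ?_
  have eA : τ.A 1 = σ.A 1 := hτ.A 1 rfl
  simp only [exec_aset, IExp.eval, VState.setI_I, VState.setI_A, VState.setA_A, eA]
  norm_num
  split_ifs with h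
  · rw [h]
  · exact hp i (by omega)

/-- Only bounded loops are available, so the number of passes is found by a loop of as many rounds
as there are items, with doubling while the block is too short. If the block doubled in every round,
it is long enough because `m < 2 ^ m`. -/
theorem logItems_spec (σ : VState) : σ.I 1 ≤ 2 ^ (logItems.exec σ).I 2 ∧
    (logItems.exec σ).I 2 ≤ Nat.clog 2 (σ.I 1) := by
  suffices hs : (fun k (τ : VState) => τ.I 3 = 2 ^ τ.I 2 ∧ τ.I 2 ≤ Nat.clog 2 (σ.I 1) ∧
      (σ.I 1 ≤ τ.I 3 ∨ τ.I 2 = k)) (σ.I 1) (logItems.exec σ) by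
    obtain ⟨h1, h2, h3⟩ := hs
    refine ⟨?_, h2⟩
    rcases h3 with h3 | h3
    · omega
    · rw [h3]; exact Nat.lt_two_pow_self.le
  rw [logItems, exec_seq, exec_seq]
  refine loop_induction rfl (fun k (τ : VState) => τ.I 3 = 2 ^ τ.I 2 ∧
    τ.I 2 ≤ Nat.clog 2 (σ.I 1) ∧ (σ.I 1 ≤ τ.I 3 ∨ τ.I 2 = k)) (by simp) fun k hk τ hτ hp => ?_
  have e1 : τ.I 1 = σ.I 1 := by rw [hτ.I 1 rfl]; simp
  obtain ⟨p1, p2, p3⟩ := hp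
  simp only [exec_ite, Tst.eval_ilt, IExp.eval, VState.setI_I, exec_seq, exec_iset, exec_skip]
  norm_num
  split_ifs with h
  · simp only [VState.setI_I]
    norm_num
    have h' : τ.I 2 < Nat.clog 2 (σ.I 1) :=
      (Nat.lt_clog_iff_pow_lt (by norm_num)).2 (by rw [← p1, ← e1]; exact h)
    refine ⟨by rw [p1, pow_succ]; ring, h', ?_⟩
    rcases p3 with p3 | p3
    · omega
    · exact Or.inr p3
  · simp only [VState.setI_I]
    norm_num
    exact ⟨p1, p2, Or.inl (by omega)⟩

/-- Array `0` holds a permutation of the items `0, …, m - 1` that sorts their keys. -/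
structure Sorted (D : ℕ) (σ : VState) (m : ℕ) : Prop where
  perm : (Multiset.range m).map (σ.A 0) = Multiset.range m
  le : ∀ x y, x < y → y < m → itemKey D σ (σ.A 0 x) ≤ itemKey D σ (σ.A 0 y)

theorem sortItems_spec (D : ℕ) (σ : VState) : Sorted D ((sortItems D).exec σ) (σ.I 1) := by
  set m := σ.I 1 with hm
  have hF : ((sortItems D).exec σ).F 0 = σ.F 0 := (frame_exec (sortItems D) σ).F 0 rfl
  have hK : itemKey D ((sortItems D).exec σ) = itemKey D σ := by
    funext x; simp only [itemKey, hF]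
  obtain ⟨hl, -⟩ := logItems_spec σ
  set L := (logItems.exec σ).I 2 with hL
  -- After `k` passes the blocks of length `2 ^ k` are sorted; after `L` passes a single block
  -- contains all items.
  suffices hs : (fun k (τ : VState) => τ.I 3 = 2 ^ k ∧ BlockSorted (itemKey D σ) (τ.A 0) (2 ^ k) m ∧
      (Multiset.range m).map (τ.A 0) = Multiset.range m) L ((sortItems D).exec σ) by
    obtain ⟨-, h2, h3⟩ := hs
    refine ⟨h3, fun x y hxy hy => ?_⟩
    rw [hK]
    exact h2 0 x y (by omega) hxy (by omega) hy
  rw [sortItems, exec_seq, exec_seq, exec_seq]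
  set σ₁ := logItems.exec σ with hσ₁
  have e1 : σ₁.I 1 = m := (frame_exec logItems σ).I 1 rfl
  have eF1 : σ₁.F 0 = σ.F 0 := (frame_exec logItems σ).F 0 rfl
  set σ₂ := (Cmd.iset 3 (.c 1)).exec σ₁ with hσ₂
  set σ₃ := (Cmd.loop 5 (.v 1) (.aset 0 (.v 5) (.v 5))).exec σ₂ with hσ₃
  have f₃ := frame_exec (Cmd.loop 5 (.v 1) (.aset 0 (.v 5) (.v 5))) σ₂
  have h3L : σ₃.I 2 = L := by rw [f₃.I 2 rfl, hσ₂]; simp [hL]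
  have h31 : σ₃.I 1 = m := by rw [f₃.I 1 rfl, hσ₂]; simp [e1]
  have h33 : σ₃.I 3 = 1 := by rw [f₃.I 3 rfl, hσ₂]; simp
  have h3F : σ₃.F 0 = σ.F 0 := by rw [f₃.F 0 rfl, hσ₂]; simp [eF1]
  have hid : ∀ i < m, σ₃.A 0 i = i := by
    have : (fun k (τ : VState) => ∀ i < k, τ.A 0 i = i) (IExp.eval σ₂ (.v 1)) σ₃ := by
      refine loop_induction rfl (fun k (τ : VState) => ∀ i < k, τ.A 0 i = i)
        (fun i hi => by omega) fun k _ τ hτ hp i hi => ?_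
      simp only [exec_aset, IExp.eval, VState.setI_I, VState.setI_A, VState.setA_A]
      norm_num
      split_ifs with h
      · exact h.symm
      · exact hp i (by omega)
    have h21 : IExp.eval σ₂ (.v 1) = m := by simp [hσ₂, e1]
    rwa [h21] at this
  refine loop_induction (by simpa using h3L) (fun k (τ : VState) => τ.I 3 = 2 ^ k ∧
    BlockSorted (itemKey D σ) (τ.A 0) (2 ^ k) m ∧
      (Multiset.range m).map (τ.A 0) = Multiset.range m) ⟨by simpa using h33, ?_, ?_⟩ ?_
  · intro q x y h1 h2 h3 h4
    simp only [pow_zero, mul_one] at h1 h3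
    omega
  · rw [map_range_congr (B := id) (fun i hi => hid i hi), Multiset.map_id]
  · intro k hk τ hτ ⟨p1, p2, p3⟩
    have e1 : τ.I 1 = m := by rw [hτ.I 1 rfl, h31]
    have eF : τ.F 0 = σ.F 0 := by rw [hτ.F 0 rfl, h3F]
    set τ₀ := τ.setI 4 k with hτ₀
    have hK' : itemKey D τ₀ = itemKey D σ := by
      funext x; simp only [itemKey, hτ₀, VState.setI_F, eF]
    have key := mergePass_spec (D := D) (σ := τ₀) (w := 2 ^ k) (m := m) (by positivity)
      (by simpa [hτ₀] using p1) (by simpa [hτ₀] using e1) (by rw [hK']; exact p2)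
    rw [exec_seq, exec_seq]
    have f₁ := frame_exec (mergePass D) τ₀
    set τ₁ := (mergePass D).exec τ₀ with hτ₁
    have f₂ := frame_exec copyBack τ₁
    have g1 : τ₁.I 1 = m := by rw [f₁.I 1 rfl]; simpa [hτ₀] using e1
    have hcopy : ∀ i < m, (copyBack.exec τ₁).A 0 i = τ₁.A 1 i := fun i hi =>
      copyBack_spec (by rw [g1]; exact hi)
    have h3 : (copyBack.exec τ₁).I 3 = 2 ^ k := by
      rw [f₂.I 3 rfl, f₁.I 3 rfl]; simpa [hτ₀] using p1
    rw [hK'] at key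
    refine ⟨?_, ?_, ?_⟩
    · simp only [exec_iset, IExp.eval, VState.setI_I, if_true, h3]
      rw [pow_succ]; ring
    · intro q x y hx hxy hy hym
      simp only [exec_iset, VState.setI_A]
      rw [hcopy x (by omega), hcopy y hym]
      rw [pow_succ, mul_comm _ 2] at hx hy
      exact key.1 q x y hx hxy hy hym
    · simp only [exec_iset, VState.setI_A]
      rw [map_range_congr hcopy, key.2]
      simpa [hτ₀] using p3

theorem cost_sortItems_le (D : ℕ) : ∃ C, ∀ σ : VState,
    (sortItems D).cost σ ≤ C * (σ.I 1 + 1) * (Nat.clog 2 (σ.I 1) + 1) := by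
  set B₁ := (Cmd.seq mergeBlock (.seq (mergeSelect D) mergeMove)).bound with hB₁
  have hpass : ∃ C, ∀ τ : VState, (mergePass D).cost τ ≤ C * (τ.I 1 + 1) := by
    refine ⟨200 + B₁, fun τ => ?_⟩
    rw [mergePass, cost_seq, cost_seq, cost_seq, cost_seq]
    have h := cost_loop_le_bound (x := 5) (e := .v 1) (P := .seq mergeBlock (.seq (mergeSelect D)
      mergeMove)) (σ := (Cmd.iset 9 (minItems (.add (.v 7) (.v 3)))).exec ((Cmd.iset 8 (.v 7)).exec
      ((Cmd.iset 7 (minItems (.v 3))).exec ((Cmd.iset 6 (.c 0)).exec τ)))) (N := τ.I 1)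
      (by simp) rfl
    rw [← hB₁] at h
    simp only [cost_iset, minItems, IExp.cost] at h ⊢
    nlinarith
  obtain ⟨C₁, hC₁⟩ := hpass
  refine ⟨300 + C₁, fun σ => ?_⟩
  obtain ⟨-, hl⟩ := logItems_spec σ
  rw [sortItems, cost_seq, cost_seq, cost_seq]
  set σ₁ := logItems.exec σ with hσ₁
  have e1 : σ₁.I 1 = σ.I 1 := (frame_exec logItems σ).I 1 rfl
  have h1 : logItems.cost σ ≤ 100 * (σ.I 1 + 1) := by
    rw [logItems, cost_seq, cost_seq]
    have h := cost_loop_le_bound (x := 5) (e := .v 1) (P := .ite (.ilt (.v 3) (.v 1))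
      (.seq (.iset 2 (.add (.v 2) (.c 1))) (.iset 3 (.add (.v 3) (.v 3)))) .skip)
      (σ := (Cmd.iset 3 (.c 1)).exec ((Cmd.iset 2 (.c 0)).exec σ)) (N := σ.I 1) (by simp) rfl
    simp only [bound, Tst.cost, IExp.cost] at h
    simp only [cost_iset, IExp.cost]
    omega
  set σ₂ := (Cmd.iset 3 (.c 1)).exec σ₁ with hσ₂
  have e2 : σ₂.I 1 = σ.I 1 := by simp [hσ₂, e1]
  have h2 := cost_loop_le_bound (x := 5) (e := .v 1) (P := .aset 0 (.v 5) (.v 5)) e2 rfl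
  set σ₃ := (Cmd.loop 5 (.v 1) (.aset 0 (.v 5) (.v 5))).exec σ₂ with hσ₃
  have f₃ := frame_exec (Cmd.loop 5 (.v 1) (.aset 0 (.v 5) (.v 5))) σ₂
  have e3 : σ₃.I 1 = σ.I 1 := by rw [f₃.I 1 rfl, e2]
  have hL3 : σ₃.I 2 = σ₁.I 2 := by rw [f₃.I 2 rfl, hσ₂]; simp
  have h3 := cost_loop_le (x := 4) (e := .v 2) (P := .seq (mergePass D) (.seq copyBack
    (.iset 3 (.add (.v 3) (.v 3))))) (σ := σ₃) (C₁ * (σ.I 1 + 1) + (40 * (σ.I 1 + 1)))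
    (fun k _ τ hτ => by
      have g0 : (τ.setI 4 k).I 1 = σ.I 1 := by
        have := hτ.I 1 rfl
        simp [this, e3]
      rw [cost_seq, cost_seq]
      have g1 := hC₁ (τ.setI 4 k)
      rw [g0] at g1
      have f₁ := frame_exec (mergePass D) (τ.setI 4 k)
      have g2 := cost_loop_le_bound (x := 5) (e := .v 1) (P := .aset 0 (.v 5) (.a 1 (.v 5)))
        (σ := (mergePass D).exec (τ.setI 4 k)) (N := σ.I 1) (by
          rw [IExp.eval, f₁.I 1 rfl, g0]) rfl
      rw [copyBack]
      simp only [cost_iset, bound, IExp.cost] at g2 ⊢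
      omega)
  simp only [IExp.eval, IExp.cost, bound, hL3] at h2 h3
  have h4 : σ₁.I 2 * (C₁ * (σ.I 1 + 1) + 40 * (σ.I 1 + 1) + 5) ≤
      Nat.clog 2 (σ.I 1) * ((C₁ + 45) * (σ.I 1 + 1)) := by
    refine Nat.mul_le_mul hl ?_
    nlinarith
  have h5 : (Cmd.iset 3 (.c 1)).cost σ₁ = 3 := rfl
  have h6 : 0 ≤ Nat.clog 2 (σ.I 1) * (σ.I 1 + 1) := Nat.zero_le _
  have h7 : 0 ≤ C₁ * (σ.I 1 + 1) := Nat.zero_le _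
  have h8 : (300 + C₁) * (σ.I 1 + 1) * (Nat.clog 2 (σ.I 1) + 1) =
      Nat.clog 2 (σ.I 1) * ((C₁ + 45) * (σ.I 1 + 1)) +
      (255 * (Nat.clog 2 (σ.I 1) * (σ.I 1 + 1)) + C₁ * (σ.I 1 + 1) + 300 * (σ.I 1 + 1)) := by ring
  rw [h8]
  omega

/-! ### Input and output

Integer variables: `0` number of points, `14` number of computed points, `15` loop counter, `16`
number of distinct computed points. Real arrays: `1` input, `3` computed points, `4` distinct
computed points. -/

open Cmd

theorem flat_eq_iff (k : Fin 8) (i a : ℕ) :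
    (k = VState.bank a ∧ i = a / 8) ↔ 8 * i + k = a := by
  rw [Fin.ext_iff, VState.bank]
  have := k.2
  simp only
  omega

/-- The content of a cell of the flat real memory. -/
def flatCell (σ : VState) (a : ℕ) : ℝ := σ.F (VState.bank a) (a / 8)

theorem flatCell_setF (σ : VState) (k : Fin 8) (i : ℕ) (x : ℝ) (a : ℕ) :
    flatCell (σ.setF k i x) a = if a = 8 * i + k then x else flatCell σ a := by
  rw [flatCell, VState.setF_F]
  have : (VState.bank a = k ∧ a / 8 = i) ↔ a = 8 * i + k := by
    rw [eq_comm (b := k), eq_comm (b := i), flat_eq_iff, eq_comm]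
  simp only [this, flatCell]

theorem bank_val_add (a : ℕ) : 8 * (a / 8) + (VState.bank a : ℕ) = a := by
  simp only [VState.bank]; omega

/-- The state represented by a RAM state. -/
def RAMState.toVState (s : RAMState) : VState where
  I x := s.ireg (2 * x)
  R x := s.rreg (2 * x)
  A k i := s.imem (8 * i + k)
  F k i := s.rmem (8 * i + k)

theorem RAMState.represents_toVState (s : RAMState) : Represents s s.toVState :=
  ⟨fun _ => rfl, fun _ => rfl, fun _ _ => rfl, fun _ _ => rfl⟩

theorem flatCell_toVState (s : RAMState) (a : ℕ) : flatCell s.toVState a = s.rmem a := by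
  change s.rmem (8 * (a / 8) + VState.bank a) = _
  rw [bank_val_add]

variable {d n : ℕ} {v : Fin n → EuclideanSpace ℝ (Fin d)} {p : Fin n → ℝ}

/-- The input is held in array `1`. -/
structure HasInput (v : Fin n → EuclideanSpace ℝ (Fin d)) (p : Fin n → ℝ) (σ : VState) : Prop where
  size : σ.I 0 = n
  coord : ∀ (i : Fin n) (c : Fin d), σ.F 1 ((d + 1) * i + c) = v i c
  prob : ∀ i : Fin n, σ.F 1 ((d + 1) * i + d) = p i

theorem HasInput.of_eq {σ τ : VState} (h : HasInput v p σ) (h0 : τ.I 0 = σ.I 0)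
    (h1 : τ.F 1 = σ.F 1) : HasInput v p τ :=
  ⟨h0.trans h.size, fun i c => by rw [h1, h.coord], fun i => by rw [h1, h.prob]⟩

/-- Move the input to array `1`. -/
def loadInput (d : ℕ) : Cmd :=
  .loop 15 (.mulc (d + 1) (.v 0))
    (.fset 1 (.sub (.sub (.mulc (d + 1) (.v 0)) (.c 1)) (.v 15))
      (.flat (.sub (.sub (.mulc (d + 1) (.v 0)) (.c 1)) (.v 15))))

/-- Array `1` is interleaved with the flat memory that holds the input. Cells are moved from the
highest address down: cell `j` goes to address `8 * j + 1`, above all the input that is still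
unread. -/
theorem loadInput_spec (v : Fin n → EuclideanSpace ℝ (Fin d)) (p : Fin n → ℝ) :
    HasInput v p ((loadInput d).exec (ramInput v p).toVState) := by
  set σ := (ramInput v p).toVState with hσ
  have h0 : σ.I 0 = n := by simp [hσ, RAMState.toVState, ramInput]
  set len := (d + 1) * n with hlen
  have key : (fun k (τ : VState) => (∀ j < len - k, flatCell τ j = flatCell σ j) ∧
      ∀ j, len - k ≤ j → j < len → τ.F 1 j = flatCell σ j) len ((loadInput d).exec σ) := by
    rw [loadInput]
    refine loop_induction (N := len) (by simp [h0, hlen]) (fun k (τ : VState) =>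
      (∀ j < len - k, flatCell τ j = flatCell σ j) ∧
      ∀ j, len - k ≤ j → j < len → τ.F 1 j = flatCell σ j) ⟨fun _ _ => rfl, fun j hj => by omega⟩
      fun k hk τ hτ hp => ?_
    have e0 : τ.I 0 = n := by rw [hτ.I 0 rfl, h0]
    simp only [exec_fset, RExp.eval, IExp.eval, IExp.eval_mulc, VState.setI_I, VState.setI_F]
    norm_num
    rw [e0, ← hlen]
    set j₀ := len - 1 - k with hj₀
    refine ⟨fun j hj => ?_, fun j hj hjl => ?_⟩
    · rw [flatCell_setF, if_neg (by simp; omega)]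
      exact hp.1 j (by omega)
    · split_ifs with h
      · rw [h]; exact hp.1 j₀ (by omega)
      · exact hp.2 j (by omega) hjl
  have hcell : ∀ j < len, ((loadInput d).exec σ).F 1 j = (ramInput v p).rmem j := fun j hj => by
    rw [key.2 j (by omega) hj, hσ, flatCell_toVState]
  have hbound : ∀ (i : Fin n) c, c < d + 1 → (d + 1) * (i : ℕ) + c < len := fun i c hc => by
    have := Nat.mul_le_mul_left (d + 1) (show (i : ℕ) + 1 ≤ n from i.2)
    rw [hlen]
    linarith
  refine ⟨?_, fun i c => ?_, fun i => ?_⟩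
  · rw [(frame_exec (loadInput d) σ).I 0 rfl, h0]
  · rw [hcell _ (hbound i c (by omega))]
    have h1 : ((d + 1) * (i : ℕ) + c) / (d + 1) = i := by
      rw [Nat.mul_add_div (by omega), Nat.div_eq_of_lt (by omega), add_zero]
    have h2 : ((d + 1) * (i : ℕ) + c) % (d + 1) = c := by
      rw [Nat.mul_add_mod, Nat.mod_eq_of_lt (by omega)]
    simp [ramInput, h1, h2]
  · rw [hcell _ (hbound i d (by omega))]
    have h1 : ((d + 1) * (i : ℕ) + d) / (d + 1) = i := by
      rw [Nat.mul_add_div (by omega), Nat.div_eq_of_lt (by omega), add_zero]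
    have h2 : ((d + 1) * (i : ℕ) + d) % (d + 1) = d := by
      rw [Nat.mul_add_mod, Nat.mod_eq_of_lt (by omega)]
    simp [ramInput, h1, h2]

theorem cost_loadInput_le (d : ℕ) : ∃ C, ∀ σ : VState, (loadInput d).cost σ ≤ C * (σ.I 0 + 1) := by
  refine ⟨(IExp.mulc (d + 1) (.v 0)).cost + 2 + (d + 1) * ((Cmd.fset 1 (.sub (.sub (.mulc (d + 1)
    (.v 0)) (.c 1)) (.v 15)) (.flat (.sub (.sub (.mulc (d + 1) (.v 0)) (.c 1)) (.v 15)))).bound + 5),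
    fun σ => ?_⟩
  refine (cost_loop_le_bound (N := (d + 1) * σ.I 0) (by simp) rfl).trans ?_
  nlinarith

/-- The `x`-th row of length `D` of an array. -/
def rowOf (D : ℕ) (f : ℕ → ℝ) (x : ℕ) : Fin D → ℝ := fun c => f (D * x + c)

theorem row_index {D c : ℕ} (hc : c < D) (x y : ℕ) :
    (D * x ≤ D * y + c ∧ D * y + c < D * x + D) ↔ y = x := by
  constructor
  · rintro ⟨h1, h2⟩
    rcases lt_trichotomy x y with h | h | h
    · have := Nat.mul_le_mul_left D (show x + 1 ≤ y from h)
      linarith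
    · exact h.symm
    · have := Nat.mul_le_mul_left D (show y + 1 ≤ x from h)
      linarith
  · rintro rfl; omega

theorem rowOf_update {D : ℕ} {f g : ℕ → ℝ} {x : ℕ} {r : Fin D → ℝ}
    (h1 : ∀ c : Fin D, g (D * x + c) = r c)
    (h2 : ∀ j, ¬ (D * x ≤ j ∧ j < D * x + D) → g j = f j) (y : ℕ) :
    rowOf D g y = if y = x then r else rowOf D f y := by
  funext c
  split_ifs with h
  · rw [h]; exact h1 c
  · exact h2 _ fun hc => h ((row_index c.2 x y).1 hc)

/-- Assign row `y` of array `k` cell by cell. -/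
theorem fillRow_spec {D : ℕ} {x : ℕ} {k : Fin 8} {i : IExp} {e : RExp} {σ : VState} {b : ℕ}
    {r : ℕ → ℝ} (hi : ∀ c < D, ∀ τ, Frame (.loop x (.c D) (.fset k i e)) σ τ →
      i.eval (τ.setI x c) = b + c)
    (he : ∀ c < D, ∀ τ, Frame (.loop x (.c D) (.fset k i e)) σ τ →
      (∀ j, ¬ (b ≤ j ∧ j < b + c) → τ.F k j = σ.F k j) → e.eval (τ.setI x c) = r c) :
    (∀ c < D, ((Cmd.loop x (.c D) (.fset k i e)).exec σ).F k (b + c) = r c) ∧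
      ∀ j, ¬ (b ≤ j ∧ j < b + D) →
        ((Cmd.loop x (.c D) (.fset k i e)).exec σ).F k j = σ.F k j := by
  refine loop_induction (N := D) rfl (fun K τ => (∀ c < K, τ.F k (b + c) = r c) ∧
    ∀ j, ¬ (b ≤ j ∧ j < b + K) → τ.F k j = σ.F k j) ⟨fun c hc => by omega, fun _ _ => rfl⟩
    fun K hK τ hτ hp => ?_
  rw [exec_fset, hi K hK τ hτ, he K hK τ hτ hp.2]
  simp only [VState.setF_F, VState.setI_F, true_and]
  refine ⟨fun c hc => ?_, fun j hj => ?_⟩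
  · by_cases h : c = K
    · simp [h]
    · rw [if_neg (by omega)]; exact hp.1 c (by omega)
  · rw [if_neg (by omega)]; exact hp.2 j (by omega)

/-- Copy the computed points, sort them, and remove duplicates. -/
def dedupStep (d : ℕ) : Cmd :=
  .seq (.ite (.ilt (.c 0) (.v 15))
      (.seq (.iset 12 (.a 0 (.v 15))) (.seq (.iset 13 (.a 0 (.sub (.v 15) (.c 1)))) (lexCmp d)))
      (.iset 10 (.c 1)))
    (.ite (.ilt (.c 0) (.v 10))
      (.seq (.iset 12 (.a 0 (.v 15)))
        (.seq (.loop 11 (.c d) (.fset 4 (.add (.mulc d (.v 16)) (.v 11))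
            (.a 0 (.add (.mulc d (.v 12)) (.v 11)))))
          (.iset 16 (.add (.v 16) (.c 1)))))
      .skip)

/-- Copy the computed points to the keys. -/
def copyKeys (d : ℕ) : Cmd := .loop 15 (.mulc d (.v 14)) (.fset 0 (.v 15) (.a 3 (.v 15)))

/-- Write the distinct computed points to the flat memory. -/
def writeOutput (d : ℕ) : Cmd := .loop 15 (.mulc d (.v 16)) (.flatset (.v 15) (.a 4 (.v 15)))

/-- Output the distinct computed points. -/
def finish (d : ℕ) : Cmd :=
  .seq (copyKeys d) (.seq (.iset 1 (.v 14)) (.seq (sortItems d) (.seq (.iset 16 (.c 0))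
    (.seq (.loop 15 (.v 14) (dedupStep d)) (.seq (writeOutput d) (.iset 0 (.v 16)))))))

theorem copyKeys_spec (d : ℕ) (σ : VState) {j : ℕ} (hj : j < d * σ.I 14) :
    ((copyKeys d).exec σ).F 0 j = σ.F 3 j := by
  have key : (fun k (τ : VState) => ∀ j < k, τ.F 0 j = σ.F 3 j) (d * σ.I 14)
      ((copyKeys d).exec σ) := by
    rw [copyKeys]
    refine loop_induction (N := d * σ.I 14) (by simp) (fun k (τ : VState) =>
      ∀ j < k, τ.F 0 j = σ.F 3 j) (fun j hj => by omega) fun k _ τ hτ hp j hj => ?_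
    have e3 : τ.F 3 = σ.F 3 := hτ.F 3 rfl
    simp only [exec_fset, RExp.eval, IExp.eval, VState.setI_I, VState.setI_F, VState.setF_F, e3]
    norm_num
    split_ifs with h
    · rw [h]
    · exact hp j (by omega)
  exact key j hj

/-- Here the order is upward: writing flat address `k` can destroy only a cell `i` of array `4` with
`8 * i + 4 = k`, and then `i < k`, so that cell has already been copied. -/
theorem writeOutput_spec (d : ℕ) (σ : VState) {j : ℕ} (hj : j < d * σ.I 16) :
    flatCell ((writeOutput d).exec σ) j = σ.F 4 j := by
  have key : (fun k (τ : VState) => (∀ j < k, flatCell τ j = σ.F 4 j) ∧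
      ∀ j, k ≤ j → τ.F 4 j = σ.F 4 j) (d * σ.I 16) ((writeOutput d).exec σ) := by
    rw [writeOutput]
    refine loop_induction (N := d * σ.I 16) (by simp) (fun k (τ : VState) =>
      (∀ j < k, flatCell τ j = σ.F 4 j) ∧ ∀ j, k ≤ j → τ.F 4 j = σ.F 4 j)
      ⟨fun j hj => by omega, fun _ _ => rfl⟩ fun k _ τ hτ hp => ?_
    simp only [exec_flatset, RExp.eval, IExp.eval, VState.setI_I, VState.setI_F, if_true]
    refine ⟨fun j hj => ?_, fun j hj => ?_⟩
    · rw [flatCell_setF, bank_val_add]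
      split_ifs with h
      · rw [h]; exact hp.2 k le_rfl
      · exact hp.1 j (by omega)
    · rw [VState.setF_F, if_neg (by rw [flat_eq_iff]; simp; omega)]
      exact hp.2 j (by omega)
  exact key.1 j hj

theorem itemKey_eq (D : ℕ) (σ : VState) (x : ℕ) : itemKey D σ x = toLex (rowOf D (σ.F 0) x) := rfl

/-- The invariant of the removal of duplicates. -/
structure DedupInv (D : ℕ) (K : ℕ → Lex (Fin D → ℝ)) (k : ℕ) (out : ℕ → ℝ) (cnt : ℕ) : Prop where
  lt : ∀ x y, x < y → y < cnt → toLex (rowOf D out x) < toLex (rowOf D out y)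
  mem : ∀ z : Fin D → ℝ, (∃ x < cnt, rowOf D out x = z) ↔ ∃ t < k, K t = toLex z
  last : 0 < k → 0 < cnt ∧ toLex (rowOf D out (cnt - 1)) = K (k - 1)

theorem DedupInv.skip {D : ℕ} {K : ℕ → Lex (Fin D → ℝ)} {k : ℕ} {out : ℕ → ℝ} {cnt : ℕ}
    (h : DedupInv D K k out cnt) (hk : 0 < k) (he : K k = K (k - 1)) :
    DedupInv D K (k + 1) out cnt := by
  refine ⟨h.lt, fun z => ?_, fun _ => ?_⟩
  · rw [h.mem]
    constructor
    · rintro ⟨t, ht, e⟩; exact ⟨t, by omega, e⟩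
    · rintro ⟨t, ht, e⟩
      rcases Nat.lt_succ_iff_lt_or_eq.1 ht with h' | rfl
      · exact ⟨t, h', e⟩
      · exact ⟨t - 1, by omega, by rw [← he, e]⟩
  · rw [Nat.add_sub_cancel, he]; exact h.last hk

theorem DedupInv.push {D : ℕ} {K : ℕ → Lex (Fin D → ℝ)} {k : ℕ} {out out' : ℕ → ℝ} {cnt : ℕ}
    (h : DedupInv D K k out cnt) (hlt : 0 < k → K (k - 1) < K k)
    (hout : ∀ x, rowOf D out' x = if x = cnt then ofLex (K k) else rowOf D out x) :
    DedupInv D K (k + 1) out' (cnt + 1) := by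
  refine ⟨fun x y hxy hy => ?_, fun z => ?_, fun _ => ?_⟩
  · rw [hout, hout, if_neg (by omega)]
    split_ifs with hyc
    · have hk : 0 < k := by
        rcases Nat.eq_zero_or_pos k with rfl | hk
        · obtain ⟨t, ht, -⟩ := (h.mem (rowOf D out x)).1 ⟨x, by omega, rfl⟩
          omega
        · exact hk
      obtain ⟨h1, h2⟩ := h.last hk
      refine lt_of_le_of_lt ?_ (hlt hk)
      rw [← h2]
      rcases Nat.lt_or_ge x (cnt - 1) with h3 | h3
      · exact (h.lt x (cnt - 1) h3 (by omega)).le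
      · rw [show x = cnt - 1 by omega]
    · exact h.lt x y hxy (by omega)
  · constructor
    · rintro ⟨x, hx, e⟩
      rw [hout] at e
      split_ifs at e with hxc
      · exact ⟨k, by omega, by rw [← e]; rfl⟩
      · obtain ⟨t, ht, e'⟩ := (h.mem z).1 ⟨x, by omega, e⟩
        exact ⟨t, by omega, e'⟩
    · rintro ⟨t, ht, e⟩
      rcases Nat.lt_succ_iff_lt_or_eq.1 ht with h' | rfl
      · obtain ⟨x, hx, e'⟩ := (h.mem z).2 ⟨t, h', e⟩
        exact ⟨x, by omega, by rw [hout, if_neg (by omega), e']⟩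
      · exact ⟨cnt, by omega, by rw [hout, if_pos rfl, e]; rfl⟩
  · refine ⟨by omega, ?_⟩
    rw [Nat.add_sub_cancel, Nat.add_sub_cancel, hout, if_pos rfl]
    rfl

theorem dedupStep_spec {D : ℕ} {τ : VState} {k : ℕ} (h15 : τ.I 15 = k)
    (hle : 0 < k → itemKey D τ (τ.A 0 (k - 1)) ≤ itemKey D τ (τ.A 0 k))
    (h : DedupInv D (fun t => itemKey D τ (τ.A 0 t)) k (τ.F 4) (τ.I 16)) :
    DedupInv D (fun t => itemKey D τ (τ.A 0 t)) (k + 1) (((dedupStep D).exec τ).F 4)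
      (((dedupStep D).exec τ).I 16) := by
  rw [dedupStep, exec_seq]
  set P : Cmd := .ite (.ilt (.c 0) (.v 15))
      (.seq (.iset 12 (.a 0 (.v 15))) (.seq (.iset 13 (.a 0 (.sub (.v 15) (.c 1)))) (lexCmp D)))
      (.iset 10 (.c 1)) with hP
  set τ₁ := P.exec τ with hτ₁
  have f₁ := frame_exec P τ
  -- The first item has no predecessor; the preset flag `1` makes it be kept.
  have hflag : (τ₁.I 10 = 0 → 0 < k ∧ itemKey D τ (τ.A 0 k) = itemKey D τ (τ.A 0 (k - 1))) ∧
      (0 < τ₁.I 10 → 0 < k → itemKey D τ (τ.A 0 (k - 1)) < itemKey D τ (τ.A 0 k)) := by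
    rw [hτ₁, hP, exec_ite]
    split_ifs with hk
    · simp only [Tst.eval_ilt, IExp.eval, h15] at hk
      obtain ⟨-, s2, -⟩ := lexCmp_spec D ((Cmd.iset 13 (.a 0 (.sub (.v 15) (.c 1)))).exec
        ((Cmd.iset 12 (.a 0 (.v 15))).exec τ))
      have e : ∀ x, itemKey D ((Cmd.iset 13 (.a 0 (.sub (.v 15) (.c 1)))).exec
        ((Cmd.iset 12 (.a 0 (.v 15))).exec τ)) x = itemKey D τ x := fun x => rfl
      rw [e, e] at s2
      simp only [exec_iset, IExp.eval, VState.setI_I, VState.setI_A] at s2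
      norm_num at s2
      rw [h15] at s2
      simp only [exec_seq, exec_iset, IExp.eval, VState.setI_I, VState.setI_A]
      norm_num
      rw [h15]
      refine ⟨fun h0 => ⟨hk, s2.1 h0⟩, fun h0 _ => lt_of_le_of_ne (hle hk) fun he => ?_⟩
      have := s2.2 he.symm
      omega
    · simp only [Tst.eval_ilt, IExp.eval, h15] at hk
      simp [hk]
  have g15 : τ₁.I 15 = k := by rw [f₁.I 15 rfl, h15]
  have g16 : τ₁.I 16 = τ.I 16 := f₁.I 16 rfl
  have gA : τ₁.A 0 = τ.A 0 := f₁.A 0 rfl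
  have gF : τ₁.F 0 = τ.F 0 := f₁.F 0 rfl
  have gF4 : τ₁.F 4 = τ.F 4 := f₁.F 4 rfl
  rw [exec_ite]
  split_ifs with ht
  · simp only [Tst.eval_ilt, IExp.eval] at ht
    rw [exec_seq, exec_seq]
    set τ₂ := (Cmd.iset 12 (.a 0 (.v 15))).exec τ₁ with hτ₂
    have g2 : τ₂.I 12 = τ.A 0 k := by simp [hτ₂, g15, gA]
    have g216 : τ₂.I 16 = τ.I 16 := by simp [hτ₂, g16]
    have hfill := fillRow_spec (D := D) (x := 11) (k := 4)
      (i := .add (.mulc D (.v 16)) (.v 11)) (e := .a 0 (.add (.mulc D (.v 12)) (.v 11)))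
      (σ := τ₂) (b := D * τ.I 16) (r := fun c => τ.F 0 (D * τ.A 0 k + c))
      (fun c _ ρ hρ => by
        have := hρ.I 16 rfl
        simp [this, g216])
      (fun c _ ρ hρ _ => by
        have h1 := hρ.I 12 rfl
        have h2 := hρ.F 0 rfl
        rw [RExp.eval, IExp.eval, IExp.eval_mulc]
        have h3 : τ₂.F 0 = τ.F 0 := by simp [hτ₂, gF]
        simp [h1, g2, h2, h3])
    have hf := frame_exec (Cmd.loop 11 (.c D) (.fset 4 (.add (.mulc D (.v 16)) (.v 11))
      (.a 0 (.add (.mulc D (.v 12)) (.v 11))))) τ₂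
    simp only [exec_iset, IExp.eval, VState.setI_I, VState.setI_F, if_true, hf.I 16 rfl, g216]
    refine h.push (hflag.2 ht) (rowOf_update (fun c => hfill.1 c c.2) fun j hj => ?_)
    rw [hfill.2 j hj, hτ₂, exec_iset, VState.setI_F, gF4]
  · simp only [Tst.eval_ilt, IExp.eval] at ht
    have := hflag.1 (by omega)
    rw [exec_skip, gF4, g16]
    exact h.skip this.1 this.2

/-- The set of the computed points. -/
def computed (d : ℕ) (σ : VState) : Set (EuclideanSpace ℝ (Fin d)) :=
  {x | ∃ j < σ.I 14, x = WithLp.toLp 2 (rowOf d (σ.F 3) j)}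

/-- Sorting puts equal points next to each other, and a point is kept only if it differs from its
predecessor. The kept rows are strictly increasing, which gives injectivity, while the set of points
is unchanged. -/
theorem finish_spec (d : ℕ) (σ : VState) {s : RAMState}
    (hs : Represents s ((finish d).exec σ)) : Function.Injective (ramOutput d s) ∧
      Set.range (ramOutput d s) = computed d σ := by
  set N := σ.I 14 with hN
  set σ₁ := (copyKeys d).exec σ with hσ₁
  have f₁ := frame_exec (copyKeys d) σ
  set σ₂ := (Cmd.iset 1 (.v 14)).exec σ₁ with hσ₂
  set σ₃ := (sortItems d).exec σ₂ with hσ₃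
  have f₃ := frame_exec (sortItems d) σ₂
  set σ₄ := (Cmd.iset 16 (.c 0)).exec σ₃ with hσ₄
  set σ₅ := (Cmd.loop 15 (.v 14) (dedupStep d)).exec σ₄ with hσ₅
  set σ₆ := (writeOutput d).exec σ₅ with hσ₆
  have hfin : (finish d).exec σ = (Cmd.iset 0 (.v 16)).exec σ₆ := rfl
  have n1 : σ₁.I 14 = N := f₁.I 14 rfl
  have n2 : σ₂.I 14 = N := by simp [hσ₂, n1]
  have n21 : σ₂.I 1 = N := by simp [hσ₂, n1]
  have n3 : σ₃.I 14 = N := by rw [f₃.I 14 rfl, n2]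
  have n4 : σ₄.I 14 = N := by simp [hσ₄, n3]
  have hsort := sortItems_spec d σ₂
  rw [n21, ← hσ₃] at hsort
  have k3 : σ₃.F 0 = σ₁.F 0 := by rw [f₃.F 0 rfl, hσ₂]; simp
  have hrow : ∀ t < N, rowOf d (σ₁.F 0) t = rowOf d (σ.F 3) t := fun t ht => by
    funext c
    refine copyKeys_spec d σ ?_
    have := Nat.mul_le_mul_left d (show t + 1 ≤ N from ht)
    rw [← hN]
    have := c.2
    linarith
  have hAlt : ∀ t < N, σ₃.A 0 t < N := fun t ht => by
    have : σ₃.A 0 t ∈ (Multiset.range N).map (σ₃.A 0) :=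
      Multiset.mem_map_of_mem _ (Multiset.mem_range.2 ht)
    rw [hsort.perm] at this
    exact Multiset.mem_range.1 this
  have hAsurj : ∀ j < N, ∃ t < N, σ₃.A 0 t = j := fun j hj => by
    have : j ∈ (Multiset.range N).map (σ₃.A 0) := by
      rw [hsort.perm]; exact Multiset.mem_range.2 hj
    obtain ⟨t, ht, e⟩ := Multiset.mem_map.1 this
    exact ⟨t, Multiset.mem_range.1 ht, e⟩
  set K : ℕ → Lex (Fin d → ℝ) := fun t => itemKey d σ₃ (σ₃.A 0 t) with hK
  have key : (fun k (τ : VState) => DedupInv d K k (τ.F 4) (τ.I 16)) N σ₅ := by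
    refine loop_induction (N := N) (by simpa using n4) (fun k (τ : VState) =>
      DedupInv d K k (τ.F 4) (τ.I 16)) ?_ fun k hk τ hτ hp => ?_
    · have : σ₄.I 16 = 0 := by simp [hσ₄]
      rw [this]
      exact ⟨fun x y _ hy => by omega, fun z => by simp, fun h => by omega⟩
    · set τ₀ := τ.setI 15 k with hτ₀
      have eA : τ₀.A 0 = σ₃.A 0 := hτ.A 0 rfl
      have eF : τ₀.F 0 = σ₃.F 0 := hτ.F 0 rfl
      have eK : (fun t => itemKey d τ₀ (τ₀.A 0 t)) = K := by
        funext t; rw [eA, itemKey_eq, eF]; rfl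
      have := dedupStep_spec (D := d) (τ := τ₀) (k := k) (by simp [hτ₀]) (fun hk0 => by
        have h1 := congrFun eK (k - 1)
        have h2 := congrFun eK k
        change _ = K (k - 1) at h1
        change _ = K k at h2
        change itemKey d τ₀ (τ₀.A 0 (k - 1)) ≤ itemKey d τ₀ (τ₀.A 0 k)
        rw [h1, h2]
        exact hsort.le (k - 1) k (by omega) hk) (by rw [eK]; simpa [hτ₀] using hp)
      rwa [eK] at this
  set cnt := σ₅.I 16 with hcnt
  have hI0 : s.ireg 0 = cnt := by
    have := hs.I 0
    rw [hfin] at this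
    have f₆ := frame_exec (writeOutput d) σ₅
    have h6 : σ₆.I 16 = cnt := f₆.I 16 rfl
    simpa [h6] using this
  have hcell : ∀ j < d * cnt, s.rmem j = σ₅.F 4 j := fun j hj => by
    rw [hs.flat, hfin]
    exact writeOutput_spec d σ₅ hj
  have hout : ∀ i : Fin (s.ireg 0), ramOutput d s i = WithLp.toLp 2 (rowOf d (σ₅.F 4) i) := by
    intro i
    rw [ramOutput]
    congr 1
    funext c
    rw [hcell, rowOf, mul_comm]
    have := Nat.mul_le_mul_left d (show (i : ℕ) + 1 ≤ cnt from hI0 ▸ i.2)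
    have := c.2
    linarith
  constructor
  · intro i i' h
    rw [hout, hout] at h
    have h' : rowOf d (σ₅.F 4) i = rowOf d (σ₅.F 4) i' := by
      have := congrArg WithLp.ofLp h
      simpa using this
    have hi := i.2
    have hi' := i'.2
    rcases lt_trichotomy (i : ℕ) i' with hlt | heq | hlt
    · have := key.lt _ _ hlt (by omega)
      rw [h'] at this
      exact absurd this (lt_irrefl _)
    · exact Fin.ext heq
    · have := key.lt _ _ hlt (by omega)
      rw [h'] at this
      exact absurd this (lt_irrefl _)
  · have hKrow : ∀ t < N, ofLex (K t) = rowOf d (σ.F 3) (σ₃.A 0 t) := fun t ht => by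
      rw [← hrow _ (hAlt t ht), ← k3]
      rfl
    ext x
    constructor
    · rintro ⟨i, rfl⟩
      obtain ⟨t, ht, e⟩ := (key.mem (rowOf d (σ₅.F 4) i)).1 ⟨i, by have := i.2; omega, rfl⟩
      refine ⟨σ₃.A 0 t, hAlt t ht, ?_⟩
      rw [hout, ← hKrow t ht, e]
      rfl
    · rintro ⟨j, hj, rfl⟩
      obtain ⟨t, ht, hAt⟩ := hAsurj j hj
      rw [← hAt]
      obtain ⟨i, hi, e⟩ := (key.mem (rowOf d (σ.F 3) (σ₃.A 0 t))).2 ⟨t, ht, by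
        rw [← hKrow t ht]; rfl⟩
      exact ⟨⟨i, by omega⟩, by rw [hout, ← e]⟩

/-- Used for the running time only: it bounds the length of the loop that writes the output. -/
theorem dedupStep_count (d : ℕ) (τ : VState) : ((dedupStep d).exec τ).I 16 ≤ τ.I 16 + 1 := by
  rw [dedupStep, exec_seq]
  set P : Cmd := .ite (.ilt (.c 0) (.v 15))
      (.seq (.iset 12 (.a 0 (.v 15))) (.seq (.iset 13 (.a 0 (.sub (.v 15) (.c 1)))) (lexCmp d)))
      (.iset 10 (.c 1)) with hP
  have h1 : (P.exec τ).I 16 = τ.I 16 := (frame_exec P τ).I 16 rfl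
  rw [exec_ite]
  split_ifs
  · rw [exec_seq, exec_seq]
    have h2 := (frame_exec (Cmd.loop 11 (.c d) (.fset 4 (.add (.mulc d (.v 16)) (.v 11))
      (.a 0 (.add (.mulc d (.v 12)) (.v 11))))) ((Cmd.iset 12 (.a 0 (.v 15))).exec (P.exec τ))).I 16
      rfl
    simp only [exec_iset, IExp.eval, VState.setI_I, if_true] at h2 ⊢
    rw [h2]
    simp [h1]
  · simp [h1]

theorem cost_finish_le (d : ℕ) : ∃ C, ∀ σ : VState,
    (finish d).cost σ ≤ C * (σ.I 14 + 1) * (Nat.clog 2 (σ.I 14) + 1) := by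
  obtain ⟨C₁, hC₁⟩ := cost_sortItems_le d
  set b₁ := (Cmd.fset 0 (.v 15) (.a 3 (.v 15))).bound
  set b₂ := (Cmd.flatset (.v 15) (.a 4 (.v 15))).bound
  set b₃ := (dedupStep d).bound
  set e₁ := (IExp.mulc d (.v 14)).cost
  set e₂ := (IExp.mulc d (.v 16)).cost
  refine ⟨C₁ + (e₁ + e₂ + 20 + d * (b₁ + 5) + d * (b₂ + 5) + (b₃ + 5)), fun σ => ?_⟩
  set N := σ.I 14 with hN
  rw [finish]
  simp only [cost_seq]
  set σ₁ := (copyKeys d).exec σ with hσ₁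
  have n1 : σ₁.I 14 = N := (frame_exec (copyKeys d) σ).I 14 rfl
  set σ₂ := (Cmd.iset 1 (.v 14)).exec σ₁ with hσ₂
  have n2 : σ₂.I 14 = N := by simp [hσ₂, n1]
  have n21 : σ₂.I 1 = N := by simp [hσ₂, n1]
  set σ₃ := (sortItems d).exec σ₂ with hσ₃
  have n3 : σ₃.I 14 = N := by rw [(frame_exec (sortItems d) σ₂).I 14 rfl, n2]
  set σ₄ := (Cmd.iset 16 (.c 0)).exec σ₃ with hσ₄
  have n4 : σ₄.I 14 = N := by simp [hσ₄, n3]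
  set σ₅ := (Cmd.loop 15 (.v 14) (dedupStep d)).exec σ₄ with hσ₅
  have hcnt : (fun k (τ : VState) => τ.I 16 ≤ k) N σ₅ := by
    refine loop_induction (N := N) (by simpa using n4) (fun k (τ : VState) => τ.I 16 ≤ k)
      (by simp [hσ₄]) fun k _ τ _ hp => ?_
    have h1 := dedupStep_count d (τ.setI 15 k)
    have h2 : (τ.setI 15 k).I 16 = τ.I 16 := by simp
    omega
  have t1 : (copyKeys d).cost σ ≤ e₁ + 2 + d * N * (b₁ + 5) :=
    cost_loop_le_bound (by simp [hN]) rfl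
  have t3 := hC₁ σ₂
  rw [n21] at t3
  have t5 : (Cmd.loop 15 (.v 14) (dedupStep d)).cost σ₄ ≤ 2 + 2 + N * (b₃ + 5) :=
    cost_loop_le_bound (by simpa using n4) rfl
  have t6 : (writeOutput d).cost σ₅ ≤ e₂ + 2 + d * σ₅.I 16 * (b₂ + 5) :=
    cost_loop_le_bound (by simp) rfl
  have t6' : d * σ₅.I 16 * (b₂ + 5) ≤ d * N * (b₂ + 5) :=
    Nat.mul_le_mul_right _ (Nat.mul_le_mul_left _ hcnt)
  simp only [cost_iset, IExp.cost]
  have hXb : (e₁ + 2 + d * N * (b₁ + 5)) + (2 + 2 + N * (b₃ + 5)) + (e₂ + 2 + d * N * (b₂ + 5)) + 12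
      ≤ (e₁ + e₂ + 20 + d * (b₁ + 5) + d * (b₂ + 5) + (b₃ + 5)) * (N + 1) := by
    have : (e₁ + e₂ + 20 + d * (b₁ + 5) + d * (b₂ + 5) + (b₃ + 5)) * (N + 1) =
      (e₁ + 2 + d * N * (b₁ + 5)) + (2 + 2 + N * (b₃ + 5)) + (e₂ + 2 + d * N * (b₂ + 5)) + 12 +
      (e₁ * N + e₂ * N + 20 * N + d * (b₁ + 5) + d * (b₂ + 5) + (b₃ + 5)) := by ring
    omega
  generalize e₁ + e₂ + 20 + d * (b₁ + 5) + d * (b₂ + 5) + (b₃ + 5) = X at *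
  have hX : X * (N + 1) ≤ X * (N + 1) * (Nat.clog 2 N + 1) :=
    Nat.le_mul_of_pos_right _ (Nat.succ_pos _)
  have hsplit : (C₁ + X) * (N + 1) * (Nat.clog 2 N + 1) =
    C₁ * (N + 1) * (Nat.clog 2 N + 1) + X * (N + 1) * (Nat.clog 2 N + 1) := by ring
  rw [hsplit]
  omega

/-- A program of the language that computes the vertices of `M` yields a program of the RAM. -/
theorem computesMInTime_of_cmd {d : ℕ} {T : ℕ → ℝ} (P : Cmd) (K : ℝ)
    (hP : ∀ (n : ℕ) (v : Fin n → EuclideanSpace ℝ (Fin d)) (p : Fin n → ℝ),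
      1 ≤ n → Function.Injective v → (∀ i, 0 < p i ∧ p i < 1) → ∀ σ, HasInput v p σ →
        computed d (P.exec σ) = (minkowskiM v p).extremePoints ℝ ∧
        (((loadInput d).seq (P.seq (finish d))).cost (ramInput v p).toVState : ℝ) ≤ K * T n) :
    ComputesMInTime d T := by
  refine ⟨((loadInput d).seq (P.seq (finish d))).compile 0, K, fun n v p hn hv hp => ?_⟩
  have hin := loadInput_spec v p
  obtain ⟨h1, h2⟩ := hP n v p hn hv hp _ hin
  obtain ⟨s, hrun, hrep, -⟩ := ((loadInput d).seq (P.seq (finish d))).compile_spec 0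
    (ramInput v p).represents_toVState
  obtain ⟨h3, h4⟩ := finish_spec d _ hrep
  exact ⟨_, s, hrun, h3, h4.trans h1, h2⟩

/-! ### Orthogonalization of rows

Real array `2` holds the rows. Integer variables: `20` coordinate counter. -/

section

variable {d : ℕ}

/-- The rows held in array `2`. -/
def rows (d : ℕ) (σ : VState) (l : ℕ) : EuclideanSpace ℝ (Fin d) :=
  WithLp.toLp 2 (rowOf d (σ.F 2) l)

theorem rows_apply (σ : VState) (l : ℕ) (c : Fin d) : rows d σ l c = σ.F 2 (d * l + c) := rfl

theorem rows_congr {σ τ : VState} (h : τ.F 2 = σ.F 2) : rows d τ = rows d σ := by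
  funext l
  rw [rows, h, rows]

theorem inner_rows (σ : VState) (l : ℕ) (y : EuclideanSpace ℝ (Fin d)) :
    (inner ℝ (rows d σ l) y : ℝ) = ∑ c : Fin d, σ.F 2 (d * l + c) * y c := by
  simp only [PiLp.inner_apply, rows_apply, RCLike.inner_apply, conj_trivial]
  exact sum_congr rfl fun c _ => mul_comm _ _

theorem rows_update {σ τ : VState} {m : ℕ} {y : EuclideanSpace ℝ (Fin d)}
    (h1 : ∀ c : Fin d, τ.F 2 (d * m + c) = y c)
    (h2 : ∀ j, ¬ (d * m ≤ j ∧ j < d * m + d) → τ.F 2 j = σ.F 2 j) :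
    rows d τ = Function.update (rows d σ) m y := by
  funext l
  rw [rows, rowOf_update (r := y.ofLp) h1 h2, Function.update_apply]
  split_ifs <;> rfl

/-- Sum up the values of an expression. -/
def sumCmd (d a : ℕ) (e : RExp) : Cmd :=
  .seq (.rset a (.c 0)) (.loop 20 (.c d) (.rset a (.add (.v a) e)))

theorem sumCmd_spec {a : ℕ} {e : RExp} {σ : VState} {r : Fin d → ℝ}
    (he : ∀ c : Fin d, ∀ τ, Frame (sumCmd d a e) σ τ → e.eval (τ.setI 20 c) = r c) :
    ((sumCmd d a e).exec σ).R a = ∑ c, r c := by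
  have key : (fun k (τ : VState) => τ.R a = ∑ c ∈ range k, if h : c < d then r ⟨c, h⟩ else 0) d
      ((sumCmd d a e).exec σ) := by
    rw [sumCmd, exec_seq]
    refine loop_induction (N := d) rfl (fun k (τ : VState) =>
      τ.R a = ∑ c ∈ range k, if h : c < d then r ⟨c, h⟩ else 0) (by simp) fun k hk τ hτ hp => ?_
    have hτ' : Frame (sumCmd d a e) σ τ := by
      refine ⟨fun y hy => hτ.I y ?_, fun y hy => ?_, fun y hy => hτ.A y rfl, fun y hy => hτ.F y rfl⟩
      · simpa [sumCmd, keepsI] using hy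
      · have hy' : a ≠ y := by simpa [sumCmd, keepsR] using hy
        rw [hτ.R y (by simpa [keepsR] using hy')]
        simp [hy'.symm]
    rw [sum_range_succ, exec_rset, VState.setR_R, if_pos rfl, RExp.eval, RExp.eval, VState.setI_R,
      hp, he ⟨k, hk⟩ τ hτ', dif_pos hk]
  refine key.trans ?_
  rw [sum_range]
  exact sum_congr rfl fun c _ => by rw [dif_pos c.2]

/-- Orthogonalize row `m` against row `l`. -/
def orthRow (d l m : ℕ) : Cmd :=
  .seq (sumCmd d 1 (.mul (.a 2 (.add (.c (d * l)) (.v 20))) (.a 2 (.add (.c (d * m)) (.v 20)))))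
    (.seq (sumCmd d 2 (.mul (.a 2 (.add (.c (d * l)) (.v 20))) (.a 2 (.add (.c (d * l)) (.v 20)))))
      (.loop 20 (.c d) (.fset 2 (.add (.c (d * m)) (.v 20))
        (.sub (.a 2 (.add (.c (d * m)) (.v 20)))
          (.mul (.div (.v 1) (.v 2)) (.a 2 (.add (.c (d * l)) (.v 20))))))))

theorem rows_orthRow {l m : ℕ} (hlm : l ≠ m) (σ : VState) :
    rows d ((orthRow d l m).exec σ) =
      Function.update (rows d σ) m (orthStep (rows d σ l) (rows d σ m)) := by
  rw [orthRow, exec_seq, exec_seq]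
  set P₁ := sumCmd d 1 (.mul (.a 2 (.add (.c (d * l)) (.v 20))) (.a 2 (.add (.c (d * m)) (.v 20))))
  set P₂ := sumCmd d 2 (.mul (.a 2 (.add (.c (d * l)) (.v 20))) (.a 2 (.add (.c (d * l)) (.v 20))))
  set σ₁ := P₁.exec σ with hσ₁
  set σ₂ := P₂.exec σ₁ with hσ₂
  have f₁ := frame_exec P₁ σ
  have f₂ := frame_exec P₂ σ₁
  have h1 : σ₁.R 1 = inner ℝ (rows d σ l) (rows d σ m) := by
    rw [inner_rows]
    refine sumCmd_spec fun c τ hτ => ?_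
    have := hτ.F 2 rfl
    simp [this, rows_apply]
  have h2 : σ₂.R 2 = inner ℝ (rows d σ l) (rows d σ l) := by
    rw [inner_rows]
    refine sumCmd_spec fun c τ hτ => ?_
    have h3 := hτ.F 2 rfl
    have h4 : σ₁.F 2 = σ.F 2 := f₁.F 2 rfl
    simp [h3, h4, rows_apply]
  have h21 : σ₂.R 1 = σ₁.R 1 := f₂.R 1 rfl
  have hF : σ₂.F 2 = σ.F 2 := (f₂.F 2 rfl).trans (f₁.F 2 rfl)
  have h3 := fillRow_spec (D := d) (x := 20) (k := 2) (i := .add (.c (d * m)) (.v 20))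
    (e := .sub (.a 2 (.add (.c (d * m)) (.v 20)))
          (.mul (.div (.v 1) (.v 2)) (.a 2 (.add (.c (d * l)) (.v 20)))))
    (σ := σ₂) (b := d * m) (r := fun c => σ.F 2 (d * m + c) - (inner ℝ (rows d σ l) (rows d σ m) /
      inner ℝ (rows d σ l) (rows d σ l)) * σ.F 2 (d * l + c)) (fun c _ τ _ => by simp)
    (fun c hc τ hτ hF' => by
      have g1 := hτ.R 1 rfl
      have g2 := hτ.R 2 rfl
      simp only [RExp.eval, IExp.eval, VState.setI_I, VState.setI_F, VState.setI_R, g1, g2, h2,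
        h21, h1, if_true]
      -- The cell about to be assigned has not been overwritten yet, and row `l` is disjoint from
      -- row `m`, so both are read with their old values.
      rw [hF' _ (by omega), hF' _ fun h => hlm ((row_index hc m l).1 ⟨h.1, by omega⟩).symm.symm,
        hF])
  refine rows_update (fun c => ?_) fun j hj => ?_
  · rw [h3.1 c c.2]
    simp [orthStep, rows_apply]
  · rw [h3.2 j hj, hF]

/-- Orthogonalize row `m` against the rows `m + 1, …, m + k`. -/
def orthRows (d m : ℕ) : ℕ → Cmd
  | 0 => .skip
  | k + 1 => .seq (orthRows d m k) (orthRow d (m + 1 + k) m)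

theorem orthReduce_congr {r r' : ℕ → EuclideanSpace ℝ (Fin d)} {m : ℕ}
    (h : ∀ l, m < l → r l = r' l) (k : ℕ) (y : EuclideanSpace ℝ (Fin d)) :
    orthReduce r m k y = orthReduce r' m k y := by
  induction k with
  | zero => rfl
  | succ k ih => rw [orthReduce, orthReduce, ih, h _ (by omega)]

theorem rows_orthRows (m k : ℕ) (σ : VState) :
    rows d ((orthRows d m k).exec σ) =
      Function.update (rows d σ) m (orthReduce (rows d σ) m k (rows d σ m)) := by
  induction k with
  | zero => simp [orthRows, orthReduce]
  | succ k ih =>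
    rw [orthRows, exec_seq, rows_orthRow (by omega), ih, orthReduce, Function.update_idem,
      Function.update_self, Function.update_of_ne (by omega)]

/-- This command is built by recursion on `k`, so its frame conditions do not reduce by computation
and need an induction. -/
theorem frame_orthRows (m k : ℕ) (σ : VState) :
    (∀ y, y ≠ 20 → ((orthRows d m k).exec σ).I y = σ.I y) ∧
    (∀ y, 3 ≤ y → ((orthRows d m k).exec σ).R y = σ.R y) ∧
    (∀ y, y ≠ 2 → ((orthRows d m k).exec σ).F y = σ.F y) := by
  induction k with
  | zero => exact ⟨fun _ _ => rfl, fun _ _ => rfl, fun _ _ => rfl⟩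
  | succ k ih =>
    have f := frame_exec (orthRow d (m + 1 + k) m) ((orthRows d m k).exec σ)
    refine ⟨fun y hy => (f.I y ?_).trans (ih.1 y hy), fun y hy => (f.R y ?_).trans (ih.2.1 y hy),
      fun y hy => (f.F y ?_).trans (ih.2.2 y hy)⟩
    · simp [orthRow, sumCmd, keepsI, hy.symm]
    · simp [orthRow, sumCmd, keepsR]; omega
    · simp [orthRow, sumCmd, keepsF, hy.symm]

theorem orthRows_isStatic (d m k : ℕ) : (orthRows d m k).isStatic = true := by
  induction k with
  | zero => rfl
  | succ k ih => rw [orthRows, isStatic, ih]; rfl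

/-- Set row `m` to the difference of the points whose indices are held in `x` and `y`. -/
def diffRow (d m x y : ℕ) : Cmd :=
  .loop 20 (.c d) (.fset 2 (.add (.c (d * m)) (.v 20))
    (.sub (.a 1 (.add (.mulc (d + 1) (.v x)) (.v 20)))
      (.a 1 (.add (.mulc (d + 1) (.v y)) (.v 20)))))

variable {n : ℕ} {v : Fin n → EuclideanSpace ℝ (Fin d)} {p : Fin n → ℝ}

theorem rows_diffRow {σ : VState} (h : HasInput v p σ) {x y : ℕ} (hx : x ≠ 20) (hy : y ≠ 20)
    {i j : Fin n} (hi : σ.I x = i) (hj : σ.I y = j) (m : ℕ) :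
    rows d ((diffRow d m x y).exec σ) = Function.update (rows d σ) m (v i - v j) := by
  have h3 := fillRow_spec (D := d) (x := 20) (k := 2) (i := .add (.c (d * m)) (.v 20))
    (e := .sub (.a 1 (.add (.mulc (d + 1) (.v x)) (.v 20)))
      (.a 1 (.add (.mulc (d + 1) (.v y)) (.v 20))))
    (σ := σ) (b := d * m) (r := fun c => if hc : c < d then v i ⟨c, hc⟩ - v j ⟨c, hc⟩ else 0)
    (fun c _ τ _ => by simp)
    (fun c hc τ hτ _ => by
      have g1 := hτ.F 1 rfl
      have gx := hτ.I x (by simp [keepsI, hx.symm])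
      have gy := hτ.I y (by simp [keepsI, hy.symm])
      have e1 := h.coord i ⟨c, hc⟩
      have e2 := h.coord j ⟨c, hc⟩
      simp [hx, hy, gx, gy, hi, hj, g1, hc] at e1 e2 ⊢
      rw [e1, e2])
  exact rows_update (fun c => by rw [diffRow, h3.1 c c.2]; simp) h3.2

/-- Set row `0` to a multiple of the unit vector whose index is held in variable `21`. -/
def unitRow (d : ℕ) (z : ℤ) : Cmd :=
  .seq (.loop 20 (.c d) (.fset 2 (.v 20) (.c 0))) (.fset 2 (.v 21) (.c z))

theorem rows_unitRow {σ : VState} {q : Fin d} (hq : σ.I 21 = q) (z : ℤ) :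
    rows d ((unitRow d z).exec σ) =
      Function.update (rows d σ) 0 (EuclideanSpace.single q (z : ℝ)) := by
  have h3 := fillRow_spec (D := d) (x := 20) (k := 2) (i := .v 20) (e := .c 0)
    (σ := σ) (b := 0) (r := fun _ => 0) (fun c _ τ _ => by simp) (fun c hc τ hτ _ => by simp)
  rw [unitRow, exec_seq, exec_fset]
  have hq' : ((Cmd.loop 20 (.c d) (.fset 2 (.v 20) (.c 0))).exec σ).I 21 = q := by
    rw [(frame_exec _ σ).I 21 rfl, hq]
  refine rows_update (fun c => ?_) fun j hj => ?_
  · have := h3.1 c c.2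
    rw [zero_add] at this
    simp [hq', this, Fin.ext_iff]
  · rw [VState.setF_F, if_neg, h3.2 j (by simpa using hj)]
    simp only [IExp.eval, hq', true_and]
    have := q.2
    simp at hj
    omega

/-- Set the rows `d, …, 2 * d - 1` to the standard basis. -/
def basisRows (d : ℕ) : Cmd :=
  .loop 21 (.c d) (.seq (.loop 20 (.c d) (.fset 2 (.add (.mulc d (.add (.c d) (.v 21))) (.v 20))
    (.c 0))) (.fset 2 (.add (.mulc d (.add (.c d) (.v 21))) (.v 21)) (.c 1)))

theorem basisRows_spec (σ : VState) : HasBasisRows (rows d ((basisRows d).exec σ)) := by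
  have key : (fun k (τ : VState) => ∀ q : Fin d, (q : ℕ) < k →
      rows d τ (d + q) = EuclideanSpace.single q 1) d ((basisRows d).exec σ) := by
    refine loop_induction (N := d) rfl (fun k (τ : VState) => ∀ q : Fin d, (q : ℕ) < k →
      rows d τ (d + q) = EuclideanSpace.single q 1) (fun q hq => by omega) fun k hk τ _ hp => ?_
    have h3 := fillRow_spec (D := d) (x := 20) (k := 2)
      (i := .add (.mulc d (.add (.c d) (.v 21))) (.v 20)) (e := .c 0)
      (σ := τ.setI 21 k) (b := d * (d + k)) (r := fun _ => 0) (fun c _ ρ hρ => by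
        have := hρ.I 21 rfl
        simp [this]) (fun c hc τ hτ _ => by simp)
    have hk' := (frame_exec (Cmd.loop 20 (.c d) (.fset 2 (.add (.mulc d (.add (.c d) (.v 21)))
      (.v 20)) (.c 0))) (τ.setI 21 k)).I 21 rfl
    simp only [VState.setI_I, if_true] at hk'
    have hr : rows d ((Cmd.seq (.loop 20 (.c d) (.fset 2 (.add (.mulc d (.add (.c d) (.v 21)))
        (.v 20)) (.c 0))) (.fset 2 (.add (.mulc d (.add (.c d) (.v 21))) (.v 21)) (.c 1))).exec
        (τ.setI 21 k)) = Function.update (rows d τ) (d + k)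
          (EuclideanSpace.single ⟨k, hk⟩ 1) := by
      rw [exec_seq, exec_fset]
      refine rows_update (fun c => ?_) fun j hj => ?_
      · simp [hk', h3.1 c c.2, Fin.ext_iff]
      · rw [VState.setF_F, if_neg, h3.2 j hj]
        · rfl
        · simp only [IExp.eval, IExp.eval_mulc, hk', true_and]
          omega
    intro q hq
    rw [hr, Function.update_apply]
    split_ifs with h
    · congr 1
      exact Fin.ext (by simp; omega)
    · exact hp q (by omega)
  exact fun q => key q q.2

end

/-! ### The vertex determined by a table of rows

Integer variables: `23`, `24`, `25` loop counters, `26` current point. Real variable `3` holds the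
probability that none of the points treated so far is present. -/

section

variable {d n : ℕ} {v : Fin n → EuclideanSpace ℝ (Fin d)} {p : Fin n → ℝ}

theorem exists_perm_of_map_range {A : ℕ → ℕ} (hA : (Multiset.range n).map A = Multiset.range n) :
    ∃ e : Equiv.Perm (Fin n), ∀ t, (e t : ℕ) = A t := by
  have hlt : ∀ t : Fin n, A t < n := fun t => by
    have : A t ∈ (Multiset.range n).map A :=
      Multiset.mem_map_of_mem _ (Multiset.mem_range.2 t.2)
    rw [hA] at this
    exact Multiset.mem_range.1 this
  have hs : Function.Surjective fun t : Fin n => (⟨A t, hlt t⟩ : Fin n) := fun j => by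
    have : (j : ℕ) ∈ (Multiset.range n).map A := by
      rw [hA]; exact Multiset.mem_range.2 j.2
    obtain ⟨t, ht, e⟩ := Multiset.mem_map.1 this
    exact ⟨⟨t, Multiset.mem_range.1 ht⟩, Fin.ext e⟩
  exact ⟨Equiv.ofBijective _ ⟨Finite.injective_iff_surjective.2 hs, hs⟩, fun t => rfl⟩

/-- If the points are listed with the last one in the order first, the points that beat the `t`-th
are precisely the `t` preceding ones. The coefficients thus become running products. -/
theorem vertOf_eq_sum_range {e : Equiv.Perm (Fin n)} {B : Fin n → Fin n → Prop}
    (hB : ∀ s t, B (e s) (e t) ↔ s < t) {A : ℕ → ℕ} (he : ∀ t, (e t : ℕ) = A t) {P V : ℕ → ℝ}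
    (hP : ∀ i : Fin n, P i = p i) {c : Fin d} (hV : ∀ i : Fin n, V i = v i c) :
    vertOf v p B c =
      ∑ t ∈ range n, (∏ s ∈ range t, (1 - P (A s))) * P (A t) * V (A t) := by
  classical
  rw [vertOf, sum_range]
  simp only [WithLp.ofLp_sum, WithLp.ofLp_smul, Finset.sum_apply, Pi.smul_apply, smul_eq_mul]
  rw [← Equiv.sum_comp e]
  refine sum_congr rfl fun t _ => ?_
  have h1 : ∏ j with B j (e t), (1 - p j) = ∏ s ∈ range t, (1 - P (A s)) := by
    rw [prod_filter, ← Equiv.prod_comp e]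
    simp only [hB]
    have : ∀ s : Fin n, (if s < t then 1 - p (e s) else 1) =
        (fun s : ℕ => if s < t then 1 - P (A s) else 1) s := fun s => by
      simp only [← he, hP, Fin.lt_def]
    rw [prod_congr rfl fun s _ => this s,
      ← prod_range (fun s : ℕ => if s < t then 1 - P (A s) else 1), ← prod_filter]
    congr 1
    ext s
    simp only [mem_filter, mem_range]
    have := t.2
    omega
  rw [← he, hP, hV, ← h1]
  simp only [mul_comm]

/-- Compute the sorting keys of the points. -/
def rowKeys (d : ℕ) : Cmd :=
  .loop 23 (.v 0) (.loop 24 (.c (2 * d)) (.seq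
    (sumCmd d 1 (.mul (.a 2 (.add (.mulc d (.v 24)) (.v 20)))
      (.a 1 (.add (.mulc (d + 1) (.v 23)) (.v 20)))))
    (.fset 0 (.add (.mulc (2 * d) (.v 23)) (.v 24)) (.sub (.c 0) (.v 1)))))

theorem rowKeys_spec {σ : VState} (h : HasInput v p σ) (a : Fin n) :
    rowOf (2 * d) (((rowKeys d).exec σ).F 0) a =
      fun l : Fin (2 * d) => -inner ℝ (rows d σ l) (v a) := by
  set Q : Cmd := .seq
    (sumCmd d 1 (.mul (.a 2 (.add (.mulc d (.v 24)) (.v 20)))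
      (.a 1 (.add (.mulc (d + 1) (.v 23)) (.v 20)))))
    (.fset 0 (.add (.mulc (2 * d) (.v 23)) (.v 24)) (.sub (.c 0) (.v 1))) with hQ
  have key : (fun k (τ : VState) => ∀ a : Fin n, (a : ℕ) < k → ∀ l < 2 * d,
      τ.F 0 (2 * d * a + l) = -inner ℝ (rows d σ l) (v a)) n ((rowKeys d).exec σ) := by
    refine loop_induction (N := n) (by simpa using h.size) (fun k (τ : VState) =>
      ∀ a : Fin n, (a : ℕ) < k → ∀ l < 2 * d,
        τ.F 0 (2 * d * a + l) = -inner ℝ (rows d σ l) (v a)) (fun a ha => by omega)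
      fun k hk τ hτ hp => ?_
    have key2 : (fun m (τ : VState) => (∀ a : Fin n, (a : ℕ) < k → ∀ l < 2 * d,
        τ.F 0 (2 * d * a + l) = -inner ℝ (rows d σ l) (v a)) ∧
        ∀ l < m, τ.F 0 (2 * d * k + l) = -inner ℝ (rows d σ l) (v ⟨k, hk⟩)) (2 * d)
        ((Cmd.loop 24 (.c (2 * d)) Q).exec (τ.setI 23 k)) := by
      refine loop_induction (N := 2 * d) rfl (fun m (τ : VState) =>
        (∀ a : Fin n, (a : ℕ) < k → ∀ l < 2 * d,
          τ.F 0 (2 * d * a + l) = -inner ℝ (rows d σ l) (v a)) ∧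
        ∀ l < m, τ.F 0 (2 * d * k + l) = -inner ℝ (rows d σ l) (v ⟨k, hk⟩))
        ⟨hp, fun l hl => by omega⟩ fun m hm ρ hρ hq => ?_
      have gF1 : ρ.F 1 = σ.F 1 := (hρ.F 1 rfl).trans (hτ.F 1 rfl)
      have gF2 : ρ.F 2 = σ.F 2 := (hρ.F 2 rfl).trans (hτ.F 2 rfl)
      have g23 : ρ.I 23 = k := by rw [hρ.I 23 rfl]; simp
      rw [hQ, exec_seq, exec_fset]
      set S := sumCmd d 1 (.mul (.a 2 (.add (.mulc d (.v 24)) (.v 20)))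
        (.a 1 (.add (.mulc (d + 1) (.v 23)) (.v 20)))) with hS
      have f := frame_exec S (ρ.setI 24 m)
      have e23 : (S.exec (ρ.setI 24 m)).I 23 = k := by rw [f.I 23 rfl]; simpa using g23
      have e24 : (S.exec (ρ.setI 24 m)).I 24 = m := by rw [f.I 24 rfl]; simp
      have eF : (S.exec (ρ.setI 24 m)).F 0 = ρ.F 0 := f.F 0 rfl
      have eR : (S.exec (ρ.setI 24 m)).R 1 = inner ℝ (rows d σ m) (v ⟨k, hk⟩) := by
        rw [inner_rows]
        refine sumCmd_spec fun c τ' hτ' => ?_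
        have a1 := hτ'.F 1 rfl
        have a2 := hτ'.F 2 rfl
        have a3 := hτ'.I 23 rfl
        have a4 := hτ'.I 24 rfl
        have a5 := h.coord ⟨k, hk⟩ c
        simp at a3 a4 a5
        simp [a1, a2, a3, a4, g23, gF1, gF2, a5]
      simp only [VState.setF_F, IExp.eval, IExp.eval_mulc, RExp.eval, e23, e24, eF, eR, true_and]
      refine ⟨fun a ha l hl => ?_, fun l hl => ?_⟩
      · rw [if_neg, hq.1 a ha l hl]
        intro he
        have := (row_index hl k a).1 (by omega)
        omega
      · by_cases hlm : l = m
        · simp [hlm]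
        · rw [if_neg (by omega), hq.2 l (by omega)]
    intro a ha l hl
    by_cases hak : (a : ℕ) = k
    · have := key2.2 l hl
      subst hak
      exact this
    · exact key2.1 a (by omega) l hl
  funext l
  exact key a a.2 l l.2

/-- Add the contribution of a point to the vertex. -/
def sumStep (d : ℕ) : Cmd :=
  .seq (.iset 26 (.a 0 (.v 25))) (.seq
    (.loop 20 (.c d) (.fset 3 (.add (.mulc d (.v 14)) (.v 20))
      (.add (.a 3 (.add (.mulc d (.v 14)) (.v 20)))
        (.mul (.mul (.v 3) (.a 1 (.add (.mulc (d + 1) (.v 26)) (.c d))))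
          (.a 1 (.add (.mulc (d + 1) (.v 26)) (.v 20)))))))
    (.rset 3 (.mul (.v 3) (.sub (.c 1) (.a 1 (.add (.mulc (d + 1) (.v 26)) (.c d)))))))

/-- Compute the vertex from the sorted list of points. -/
def sumSorted (d : ℕ) : Cmd :=
  .seq (.loop 20 (.c d) (.fset 3 (.add (.mulc d (.v 14)) (.v 20)) (.c 0))) (.seq (.rset 3 (.c 1))
    (.loop 25 (.v 0) (sumStep d)))

theorem sumSorted_spec {σ : VState} {N : ℕ} (hN : σ.I 14 = N) :
    (∀ c < d, ((sumSorted d).exec σ).F 3 (d * N + c) = ∑ t ∈ range (σ.I 0),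
      (∏ s ∈ range t, (1 - σ.F 1 ((d + 1) * σ.A 0 s + d))) * σ.F 1 ((d + 1) * σ.A 0 t + d) *
        σ.F 1 ((d + 1) * σ.A 0 t + c)) ∧
    ∀ j, ¬ (d * N ≤ j ∧ j < d * N + d) → ((sumSorted d).exec σ).F 3 j = σ.F 3 j := by
  rw [sumSorted, exec_seq, exec_seq, exec_rset]
  set L : Cmd := .loop 20 (.c d) (.fset 3 (.add (.mulc d (.v 14)) (.v 20))
        (.add (.a 3 (.add (.mulc d (.v 14)) (.v 20)))
          (.mul (.mul (.v 3) (.a 1 (.add (.mulc (d + 1) (.v 26)) (.c d))))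
            (.a 1 (.add (.mulc (d + 1) (.v 26)) (.v 20)))))) with hL
  have h0 := fillRow_spec (D := d) (x := 20) (k := 3) (i := .add (.mulc d (.v 14)) (.v 20))
    (e := .c 0) (σ := σ) (b := d * N) (r := fun _ => 0) (fun c _ τ hτ => by
      have := hτ.I 14 rfl
      simp [this, hN]) (fun c _ τ _ _ => by simp)
  have f₀ := frame_exec (Cmd.loop 20 (.c d) (.fset 3 (.add (.mulc d (.v 14)) (.v 20)) (.c 0))) σ
  set σ₀ := (Cmd.loop 20 (.c d) (.fset 3 (.add (.mulc d (.v 14)) (.v 20)) (.c 0))).exec σ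
  -- The invariant also records that real variable `3` holds the running product; only the part
  -- about the sums is kept at the end.
  refine (?_ : (fun k (τ : VState) => ((∀ c < d, τ.F 3 (d * N + c) = ∑ t ∈ range k,
      (∏ s ∈ range t, (1 - σ.F 1 ((d + 1) * σ.A 0 s + d))) * σ.F 1 ((d + 1) * σ.A 0 t + d) *
        σ.F 1 ((d + 1) * σ.A 0 t + c)) ∧
      ∀ j, ¬ (d * N ≤ j ∧ j < d * N + d) → τ.F 3 j = σ.F 3 j) ∧
      τ.R 3 = ∏ s ∈ range k, (1 - σ.F 1 ((d + 1) * σ.A 0 s + d))) (σ.I 0) _).1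
  refine loop_induction (N := σ.I 0) (by simpa using f₀.I 0 rfl) (fun k (τ : VState) =>
      ((∀ c < d, τ.F 3 (d * N + c) = ∑ t ∈ range k,
      (∏ s ∈ range t, (1 - σ.F 1 ((d + 1) * σ.A 0 s + d))) * σ.F 1 ((d + 1) * σ.A 0 t + d) *
        σ.F 1 ((d + 1) * σ.A 0 t + c)) ∧
      ∀ j, ¬ (d * N ≤ j ∧ j < d * N + d) → τ.F 3 j = σ.F 3 j) ∧
      τ.R 3 = ∏ s ∈ range k, (1 - σ.F 1 ((d + 1) * σ.A 0 s + d))) ⟨⟨?_, ?_⟩, ?_⟩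
      fun k hk τ hτ hp => ?_
  · intro c hc
    simpa using h0.1 c hc
  · exact h0.2
  · simp [RExp.eval]
  · have gF1 : τ.F 1 = σ.F 1 := (hτ.F 1 rfl).trans (f₀.F 1 rfl)
    have gA : τ.A 0 = σ.A 0 := (hτ.A 0 rfl).trans (f₀.A 0 rfl)
    have g14 : τ.I 14 = N := ((hτ.I 14 rfl).trans (f₀.I 14 rfl)).trans hN
    rw [sumStep, exec_seq, exec_seq]
    set ρ := (Cmd.iset 26 (.a 0 (.v 25))).exec (τ.setI 25 k) with hρ
    have r26 : ρ.I 26 = σ.A 0 k := by simp [hρ, gA]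
    have r14 : ρ.I 14 = N := by simp [hρ, g14]
    have rF1 : ρ.F 1 = σ.F 1 := by simp [hρ, gF1]
    have rR : ρ.R 3 = τ.R 3 := rfl
    have rF3 : ρ.F 3 = τ.F 3 := rfl
    have h1 := fillRow_spec (D := d) (x := 20) (k := 3) (i := .add (.mulc d (.v 14)) (.v 20))
      (e := .add (.a 3 (.add (.mulc d (.v 14)) (.v 20)))
          (.mul (.mul (.v 3) (.a 1 (.add (.mulc (d + 1) (.v 26)) (.c d))))
            (.a 1 (.add (.mulc (d + 1) (.v 26)) (.v 20))))) (σ := ρ) (b := d * N)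
      (r := fun c => τ.F 3 (d * N + c) + τ.R 3 * σ.F 1 ((d + 1) * σ.A 0 k + d) *
        σ.F 1 ((d + 1) * σ.A 0 k + c)) (fun c _ τ hτ => by
        have := hτ.I 14 rfl
        simp [this, r14]) (fun c hc μ hμ hF => by
        have a1 := hμ.I 14 rfl
        have a2 := hμ.I 26 rfl
        have a3 := hμ.F 1 rfl
        have a4 := hμ.R 3 rfl
        have a5 := hF (d * N + c) (by omega)
        simp [a1, a2, a3, a4, a5, r14, r26, rF1, rR, rF3])
    have f₁ := frame_exec L ρ
    rw [← hL] at h1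
    have l26 : (L.exec ρ).I 26 = σ.A 0 k := (f₁.I 26 rfl).trans r26
    have lR : (L.exec ρ).R 3 = τ.R 3 := f₁.R 3 rfl
    have lF1 : (L.exec ρ).F 1 = σ.F 1 := (f₁.F 1 rfl).trans rF1
    refine ⟨⟨fun c hc => ?_, fun j hj => ?_⟩, ?_⟩
    · rw [exec_rset, VState.setR_F, h1.1 c hc, hp.1.1 c hc, sum_range_succ, hp.2]
    · rw [exec_rset, VState.setR_F, h1.2 j hj, rF3, hp.1.2 j hj]
    · rw [← hL]
      simp [l26, lR, lF1, hp.2, prod_range_succ]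

/-- Compute the vertex determined by the rows. -/
def emitVertex (d : ℕ) : Cmd :=
  .seq (rowKeys d) (.seq (.iset 1 (.v 0)) (.seq (sortItems (2 * d)) (.seq (sumSorted d)
    (.iset 14 (.add (.v 14) (.c 1))))))

theorem computed_push {σ τ : VState} {y : EuclideanSpace ℝ (Fin d)} (h14 : τ.I 14 = σ.I 14 + 1)
    (h1 : ∀ c : Fin d, τ.F 3 (d * σ.I 14 + c) = y c)
    (h2 : ∀ j, ¬ (d * σ.I 14 ≤ j ∧ j < d * σ.I 14 + d) → τ.F 3 j = σ.F 3 j) :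
    computed d τ = computed d σ ∪ {y} := by
  have hr := rowOf_update (r := y.ofLp) h1 h2
  ext x
  simp only [computed, h14, hr, Set.mem_ofPred_eq, Set.mem_union, Set.mem_singleton_iff]
  constructor
  · rintro ⟨j, hj, rfl⟩
    split_ifs with hjN
    · exact Or.inr rfl
    · exact Or.inl ⟨j, by omega, rfl⟩
  · rintro (⟨j, hj, rfl⟩ | rfl)
    · exact ⟨j, by omega, by rw [if_neg (by omega)]⟩
    · exact ⟨_, Nat.lt_succ_self _, by rw [if_pos rfl]⟩

/-- The keys are negated because the sort is increasing while the points that beat all others have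
to come first. -/
theorem lexBeats_iff_lt (r : ℕ → EuclideanSpace ℝ (Fin d)) (D : ℕ) (i j : Fin n) :
    LexBeats v r D i j ↔ toLex (fun l : Fin D => -(inner ℝ (r l) (v i) : ℝ)) <
      toLex (fun l : Fin D => -(inner ℝ (r l) (v j) : ℝ)) := by
  simp only [LexBeats, inner_sub_right]
  constructor
  · rintro ⟨l, hl, h0, h⟩
    refine ⟨⟨l, hl⟩, fun l' hl' => ?_, ?_⟩
    · exact congrArg Neg.neg (sub_eq_zero.1 (h0 l' hl'))
    · exact neg_lt_neg (sub_pos.1 h)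
  · rintro ⟨l, h0, h⟩
    exact ⟨l, l.2, fun l' hl' => sub_eq_zero.2 (neg_injective (h0 ⟨l', by omega⟩ hl')),
      sub_pos.2 (neg_lt_neg_iff.1 h)⟩

theorem emitVertex_spec {σ : VState} (h : HasInput v p σ)
    (htot : ∀ i j, i ≠ j → ∃ l < 2 * d, (inner ℝ (rows d σ l) (v i - v j) : ℝ) ≠ 0) :
    computed d ((emitVertex d).exec σ) =
      computed d σ ∪ {vertOf v p (LexBeats v (rows d σ) (2 * d))} := by
  set σ₁ := (rowKeys d).exec σ with hσ₁
  have f₁ := frame_exec (rowKeys d) σ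
  set σ₂ := (Cmd.iset 1 (.v 0)).exec σ₁ with hσ₂
  set σ₃ := (sortItems (2 * d)).exec σ₂ with hσ₃
  have f₃ := frame_exec (sortItems (2 * d)) σ₂
  set σ₄ := (sumSorted d).exec σ₃ with hσ₄
  have f₄ := frame_exec (sumSorted d) σ₃
  have hfin : (emitVertex d).exec σ = (Cmd.iset 14 (.add (.v 14) (.c 1))).exec σ₄ := rfl
  have s10 : σ₁.I 0 = n := (f₁.I 0 rfl).trans h.size
  have s21 : σ₂.I 1 = n := by simp [hσ₂, s10]
  have s20 : σ₂.I 0 = n := by simp [hσ₂, s10]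
  have s30 : σ₃.I 0 = n := (f₃.I 0 rfl).trans s20
  have s314 : σ₃.I 14 = σ.I 14 := (f₃.I 14 rfl).trans (f₁.I 14 rfl)
  have s414 : σ₄.I 14 = σ.I 14 := (f₄.I 14 rfl).trans s314
  have s3F1 : σ₃.F 1 = σ.F 1 := (f₃.F 1 rfl).trans (f₁.F 1 rfl)
  have s3F3 : σ₃.F 3 = σ.F 3 := (f₃.F 3 rfl).trans (f₁.F 3 rfl)
  have hs := sortItems_spec (2 * d) σ₂
  rw [s21, ← hσ₃] at hs
  obtain ⟨e, he⟩ := exists_perm_of_map_range hs.perm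
  have hkey : ∀ a : Fin n, itemKey (2 * d) σ₃ a =
      toLex fun l : Fin (2 * d) => -inner ℝ (rows d σ l) (v a) :=
    fun a => by
      rw [itemKey_eq, f₃.F 0 rfl, hσ₂]
      exact congrArg toLex (rowKeys_spec h a)
  -- The sort gives only weak inequalities; without ties between distinct points they are strict.
  have hB : ∀ s t, LexBeats v (rows d σ) (2 * d) (e s) (e t) ↔ s < t := by
    have hlt : ∀ s t, s < t → LexBeats v (rows d σ) (2 * d) (e s) (e t) := fun s t hst => by
      rcases LexBeats.total (htot (e s) (e t) fun h' => hst.ne (e.injective h')) with h' | h'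
      · exact h'
      · have := hs.le s t hst t.2
        rw [← he, ← he, hkey, hkey] at this
        exact absurd this (not_le_of_gt ((lexBeats_iff_lt _ _ _ _).1 h'))
    intro s t
    refine ⟨fun hst => ?_, hlt s t⟩
    rcases lt_trichotomy s t with h' | rfl | h'
    · exact h'
    · exact absurd hst (LexBeats.irrefl _ _ _)
    · exact absurd (hlt t s h') hst.asymm
  obtain ⟨h1, h2⟩ := sumSorted_spec (d := d) s314
  rw [← hσ₄, s30, s3F1] at h1
  rw [← hσ₄, s3F3] at h2
  rw [hfin]
  refine computed_push (by simp [s414]) (fun c => ?_) h2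
  rw [vertOf_eq_sum_range hB he (P := fun a => σ.F 1 ((d + 1) * a + d))
    (V := fun a => σ.F 1 ((d + 1) * a + c)) h.prob fun i => h.coord i c]
  exact h1 c c.2

theorem cost_emitVertex_le (d : ℕ) : ∃ C, ∀ σ : VState,
    (emitVertex d).cost σ ≤ C * (σ.I 0 + 1) * (Nat.clog 2 (σ.I 0) + 1) := by
  obtain ⟨C₁, hC₁⟩ := cost_sortItems_le (2 * d)
  obtain ⟨b₁, hb₁⟩ : ∃ b, ∀ σ, (rowKeys d).cost σ ≤ 2 + 2 + σ.I 0 * b :=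
    ⟨_, fun σ => cost_loop_le_bound rfl rfl⟩
  obtain ⟨b₂, hb₂⟩ : ∃ b, ∀ σ, (Cmd.loop 20 (.c d) (.fset 3 (.add (.mulc d (.v 14)) (.v 20))
      (.c 0))).cost σ ≤ b := ⟨_, cost_le_bound _ rfl⟩
  obtain ⟨b₃, hb₃⟩ : ∃ b, ∀ σ, (sumSorted d).cost σ ≤ b₂ + (3 + (2 + 2 + σ.I 0 * b)) := by
    refine ⟨(sumStep d).bound + 5, fun σ => ?_⟩
    rw [sumSorted, cost_seq, cost_seq]
    exact add_le_add (hb₂ σ) (add_le_add (by simp) (cost_loop_le_bound (N := σ.I 0)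
      (by simpa using (frame_exec (Cmd.loop 20 (.c d) (.fset 3 (.add (.mulc d (.v 14)) (.v 20))
        (.c 0))) σ).I 0 rfl) rfl))
  refine ⟨C₁ + (b₁ + b₂ + b₃ + 30), fun σ => ?_⟩
  rw [emitVertex, cost_seq, cost_seq, cost_seq, cost_seq]
  have s1 : ((rowKeys d).exec σ).I 0 = σ.I 0 := (frame_exec (rowKeys d) σ).I 0 rfl
  set σ₂ := (Cmd.iset 1 (.v 0)).exec ((rowKeys d).exec σ) with hσ₂
  have s21 : σ₂.I 1 = σ.I 0 := by simp [hσ₂, s1]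
  have s20 : σ₂.I 0 = σ.I 0 := by simp [hσ₂, s1]
  have s3 : ((sortItems (2 * d)).exec σ₂).I 0 = σ.I 0 :=
    ((frame_exec (sortItems (2 * d)) σ₂).I 0 rfl).trans s20
  have t1 := hb₁ σ
  have t2 := hC₁ σ₂
  have t3 := hb₃ ((sortItems (2 * d)).exec σ₂)
  rw [s21] at t2
  rw [s3] at t3
  simp only [cost_iset, IExp.cost]
  have hX := Nat.le_mul_of_pos_right ((b₁ + b₂ + b₃ + 30) * (σ.I 0 + 1))
    (Nat.succ_pos (Nat.clog 2 (σ.I 0)))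
  have hs : (C₁ + (b₁ + b₂ + b₃ + 30)) * (σ.I 0 + 1) * (Nat.clog 2 (σ.I 0) + 1) =
    C₁ * (σ.I 0 + 1) * (Nat.clog 2 (σ.I 0) + 1) +
    (b₁ + b₂ + b₃ + 30) * (σ.I 0 + 1) * (Nat.clog 2 (σ.I 0) + 1) := by ring
  have hY : (b₁ + b₂ + b₃ + 30) * (σ.I 0 + 1) =
    σ.I 0 * b₁ + σ.I 0 * b₃ + b₂ + (σ.I 0 * b₂ + 30 * σ.I 0 + b₁ + b₃ + 30) := by ring
  rw [Nat.succ_eq_add_one] at hX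
  rw [hs]
  omega

end

/-! ### Enumeration of the candidate directions

Integer variables: `21` index of a basis vector, `40 + 2 * m` and `41 + 2 * m` indices of the points
of which row `m + 1` is the difference. -/

section

variable {d n : ℕ} {v : Fin n → EuclideanSpace ℝ (Fin d)} {p : Fin n → ℝ}

/-- Treat a candidate direction with row `0` a multiple of a basis vector. -/
def tryUnit (d : ℕ) (z : ℤ) : Cmd :=
  .seq (unitRow d z) (.seq (orthRows d 0 (d - 1)) (emitVertex d))

/-- Treat all candidate directions with the given rows above row `m`. -/
def tryRows (d : ℕ) : ℕ → Cmd
  | 0 => .loop 21 (.c d) (.seq (tryUnit d (-1)) (.seq (tryUnit d 0) (tryUnit d 1)))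
  | m + 1 => .loop (41 + 2 * m) (.v 0) (.loop (40 + 2 * m) (.v 0)
      (.seq (diffRow d (m + 1) (41 + 2 * m) (40 + 2 * m))
        (.seq (orthRows d (m + 1) (d - 1 - (m + 1))) (tryRows d m))))

/-- Rows up to `m` are overwritten before they are read. The program may therefore leave the remains
of earlier iterations in them. -/
theorem candRows_congr {m : ℕ} {r r' : ℕ → EuclideanSpace ℝ (Fin d)} (h : ∀ l, m < l → r l = r' l) :
    candRows v m r = candRows v m r' := by
  induction m generalizing r r' with
  | zero =>
    simp only [candRows]
    refine Set.iUnion_congr fun q => Set.iUnion_congr fun s => ?_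
    rw [orthReduce_congr h]
    congr 1
    funext l
    by_cases hl : l = 0
    · simp [hl]
    · rw [Function.update_of_ne hl, Function.update_of_ne hl, h l (by omega)]
  | succ m ih =>
    simp only [candRows]
    refine Set.iUnion_congr fun i => Set.iUnion_congr fun j => ih fun l hl => ?_
    rw [orthReduce_congr h]
    by_cases hl' : l = m + 1
    · simp [hl']
    · rw [Function.update_of_ne hl', Function.update_of_ne hl', h l (by omega)]

/-- The effect of a command that emits the vertices in `S` and changes only the rows up to `m` and
the variables below `b`, except variable `0`. -/
structure Emits (d : ℕ) (S : Set (EuclideanSpace ℝ (Fin d))) (N m b : ℕ) (σ τ : VState) :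
    Prop where
  computed_eq : computed d τ = computed d σ ∪ S
  count : τ.I 14 = σ.I 14 + N
  I0 : τ.I 0 = σ.I 0
  I : ∀ y, b ≤ y → τ.I y = σ.I y
  F1 : τ.F 1 = σ.F 1
  rows_eq : ∀ l, m < l → rows d τ l = rows d σ l

theorem Emits.refl (m b : ℕ) (σ : VState) : Emits d ∅ 0 m b σ σ :=
  ⟨by simp, rfl, rfl, fun _ _ => rfl, rfl, fun _ _ => rfl⟩

theorem Emits.trans {S S' : Set (EuclideanSpace ℝ (Fin d))} {N N' m b : ℕ} {σ τ τ' : VState}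
    (h : Emits d S N m b σ τ) (h' : Emits d S' N' m b τ τ') : Emits d (S ∪ S') (N + N') m b σ τ' :=
  ⟨by rw [h'.computed_eq, h.computed_eq, Set.union_assoc], by rw [h'.count, h.count, add_assoc],
    h'.I0.trans h.I0, fun y hy => (h'.I y hy).trans (h.I y hy), h'.F1.trans h.F1,
    fun l hl => (h'.rows_eq l hl).trans (h.rows_eq l hl)⟩

theorem Emits.mono {S : Set (EuclideanSpace ℝ (Fin d))} {N m m' b b' : ℕ} {σ τ : VState}
    (h : Emits d S N m b σ τ) (hm : m ≤ m') (hb : b ≤ b') : Emits d S N m' b' σ τ :=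
  ⟨h.computed_eq, h.count, h.I0, fun y hy => h.I y (hb.trans hy), h.F1,
    fun l hl => h.rows_eq l (hm.trans_lt hl)⟩

theorem Emits.setI {m b x k : ℕ} {σ : VState} (hx : x < b) (h0 : x ≠ 0) (h14 : x ≠ 14) :
    Emits d ∅ 0 m b σ (σ.setI x k) :=
  ⟨by simp [computed, h14.symm], by simp [h14.symm], by simp [h0.symm],
    fun y hy => by simp [show y ≠ x by omega], rfl, fun _ _ => rfl⟩

theorem computed_congr {σ τ : VState} (h14 : τ.I 14 = σ.I 14) (h3 : τ.F 3 = σ.F 3) :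
    computed d τ = computed d σ := by
  simp only [computed, h14, h3]

/-- A loop of commands that emit vertices. -/
theorem Emits.loop {x : ℕ} {e : IExp} {P : Cmd} {σ : VState} {K N m b : ℕ} (hK : e.eval σ = K)
    (hx : x < b) (h0 : x ≠ 0) (h14 : x ≠ 14) {S : Fin K → Set (EuclideanSpace ℝ (Fin d))}
    (h : ∀ k : Fin K, ∀ τ ρ, Emits d ρ (N * k) m b σ τ →
      Emits d (S k) N m b (τ.setI x k) (P.exec (τ.setI x k))) :
    Emits d (⋃ k, S k) (K * N) m b σ ((Cmd.loop x e P).exec σ) := by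
  have key : (fun k (τ : VState) => Emits d (⋃ i : Fin K, ⋃ _ : (i : ℕ) < k, S i) (N * k) m b σ τ)
      K ((Cmd.loop x e P).exec σ) := by
    refine loop_induction hK (fun k (τ : VState) =>
      Emits d (⋃ i : Fin K, ⋃ _ : (i : ℕ) < k, S i) (N * k) m b σ τ) ?_ fun k hk τ _ hp => ?_
    · simpa using Emits.refl m b σ
    · have := (hp.trans (Emits.setI hx h0 h14 (k := k))).trans (h ⟨k, hk⟩ τ _ hp)
      rw [Set.union_empty, add_zero, ← Nat.mul_succ] at this
      convert this using 1
      ext y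
      simp only [Set.mem_iUnion, Set.mem_union, exists_prop]
      constructor
      · rintro ⟨i, hi, hy⟩
        rcases Nat.lt_succ_iff_lt_or_eq.1 hi with hi | hi
        · exact Or.inl ⟨i, hi, hy⟩
        · exact Or.inr (by rwa [show i = ⟨k, hk⟩ from Fin.ext hi] at hy)
      · rintro (⟨i, hi, hy⟩ | hy)
        · exact ⟨i, by omega, hy⟩
        · exact ⟨⟨k, hk⟩, Nat.lt_succ_self k, hy⟩
  have e1 : (⋃ i : Fin K, ⋃ _ : (i : ℕ) < K, S i) = ⋃ k, S k := by simp
  rw [← e1, mul_comm]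
  exact key

theorem HasInput.of_emits {S : Set (EuclideanSpace ℝ (Fin d))} {N m b : ℕ} {σ τ : VState}
    (h : HasInput v p σ) (he : Emits d S N m b σ τ) : HasInput v p τ := h.of_eq he.I0 he.F1

theorem emits_emitVertex (hv : Function.Injective v) {σ : VState} (h : HasInput v p σ)
    (hb : HasBasisRows (rows d σ)) :
    Emits d {vertOf v p (LexBeats v (rows d σ) (2 * d))} 1 0 40 σ ((emitVertex d).exec σ) := by
  -- The final increment of variable `14` is left out here, so that the frame conditions apply to
  -- that variable.
  have f := frame_exec (.seq (rowKeys d) (.seq (.iset 1 (.v 0)) (.seq (sortItems (2 * d))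
    (sumSorted d)))) σ
  have f' := frame_exec (emitVertex d) σ
  refine ⟨emitVertex_spec h (hb.exists_inner_ne_zero hv), ?_, f'.I 0 rfl, fun y hy => f'.I y ?_,
    f'.F 1 rfl, fun l _ => congrFun (rows_congr (f'.F 2 rfl)) l⟩
  · have := f.I 14 rfl
    simp only [exec_seq] at this
    simpa [emitVertex] using this
  · simp [emitVertex, rowKeys, sumCmd, sumSorted, sumStep, keepsI, sortItems, logItems, mergePass,
      mergeBlock, mergeSelect, mergeMove, copyBack, lexCmp]
    omega

theorem emits_tryUnit (hv : Function.Injective v) {σ : VState} (h : HasInput v p σ)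
    (hb : HasBasisRows (rows d σ)) {q : Fin d} (hq : σ.I 21 = q) (z : ℤ) :
    Emits d {vertOf v p (LexBeats v (Function.update (rows d σ) 0 (orthReduce (rows d σ) 0 (d - 1)
      (EuclideanSpace.single q (z : ℝ)))) (2 * d))} 1 0 40 σ ((tryUnit d z).exec σ) := by
  set σ₁ := (unitRow d z).exec σ with hσ₁
  have f₁ := frame_exec (unitRow d z) σ
  set σ₂ := (orthRows d 0 (d - 1)).exec σ₁ with hσ₂
  obtain ⟨g1, -, g3⟩ := frame_orthRows (d := d) 0 (d - 1) σ₁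
  have r₁ : rows d σ₁ = _ := rows_unitRow hq z
  have r₂ : rows d σ₂ = Function.update (rows d σ) 0 (orthReduce (rows d σ) 0 (d - 1)
      (EuclideanSpace.single q (z : ℝ))) := by
    rw [hσ₂, rows_orthRows, r₁, Function.update_idem, Function.update_self]
    congr 1
    exact orthReduce_congr (fun l hl => by rw [Function.update_of_ne (by omega)]) _ _
  have hF1 : σ₂.F 1 = σ.F 1 := (g3 1 (by decide)).trans (f₁.F 1 rfl)
  have hI : ∀ y, y ≠ 20 → σ₂.I y = σ.I y := fun y hy => (g1 y hy).trans (f₁.I y (by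
    simpa [unitRow, keepsI] using hy.symm))
  have e₂ : Emits d ∅ 0 0 40 σ σ₂ := by
    refine ⟨?_, hI 14 (by norm_num), hI 0 (by norm_num), fun y hy => hI y (by omega), hF1,
      fun l hl => ?_⟩
    · rw [Set.union_empty]
      exact computed_congr (hI 14 (by norm_num)) ((g3 3 (by decide)).trans (f₁.F 3 rfl))
    · rw [r₂, Function.update_of_ne (by omega)]
  have e₃ := emits_emitVertex hv (h.of_emits e₂) fun l => by
    rw [e₂.rows_eq _ (by omega), hb l]
  have := e₂.trans e₃
  rwa [Set.empty_union, zero_add, r₂] at this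

/-- The program follows the recursion of `candRows`. Treating a candidate changes only rows up to
`m`, so every iteration starts from the same rows above `m`, and these are all that the set of
candidates depends on. -/
theorem emits_tryRows (hv : Function.Injective v) {m : ℕ} (hm : m < d) {σ : VState}
    (h : HasInput v p σ) (hb : HasBasisRows (rows d σ)) :
    Emits d ((fun r => vertOf v p (LexBeats v r (2 * d))) '' candRows v m (rows d σ))
      (n ^ (2 * m) * (d * 3)) m (40 + 2 * m) σ ((tryRows d m).exec σ) := by
  induction m generalizing σ with
  | zero =>
    have := Emits.loop (d := d) (x := 21) (e := .c d) (P := .seq (tryUnit d (-1))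
      (.seq (tryUnit d 0) (tryUnit d 1))) (σ := σ) (K := d) (N := 3) (m := 0) (b := 40) rfl
      (by norm_num) (by norm_num) (by norm_num) (S := fun q => ⋃ s : Fin 3,
        {vertOf v p (LexBeats v (Function.update (rows d σ) 0 (orthReduce (rows d σ) 0 (d - 1)
          (EuclideanSpace.single q ((s : ℕ) - 1 : ℝ)))) (2 * d))}) fun q τ ρ hτ => by
      have hupd : ∀ τ' : VState, (∀ l, 0 < l → rows d τ' l = rows d σ l) → ∀ y,
          Function.update (rows d τ') 0 (orthReduce (rows d τ') 0 (d - 1) y) =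
          Function.update (rows d σ) 0 (orthReduce (rows d σ) 0 (d - 1) y) := fun τ' h' y => by
        rw [orthReduce_congr h']
        funext l
        by_cases hl : l = 0
        · simp [hl]
        · rw [Function.update_of_ne hl, Function.update_of_ne hl, h' l (by omega)]
      have hone : ∀ τ' : VState, HasInput v p τ' → (∀ l, 0 < l → rows d τ' l = rows d σ l) →
          τ'.I 21 = q → ∀ z, _ := fun τ' h1 h2 h3 z =>
        emits_tryUnit hv h1 (fun l => by rw [h2 _ (by omega), hb l]) h3 z
      have k21 : ∀ τ' z, ((tryUnit d z).exec τ').I 21 = τ'.I 21 := fun τ' z => by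
        have f₁ := (frame_exec (unitRow d z) τ').I 21 rfl
        have f₂ := (frame_orthRows (d := d) 0 (d - 1) ((unitRow d z).exec τ')).1 21 (by norm_num)
        have f₃ := (frame_exec (emitVertex d) ((orthRows d 0 (d - 1)).exec
          ((unitRow d z).exec τ'))).I 21 rfl
        exact f₃.trans (f₂.trans f₁)
      have h0 : HasInput v p (τ.setI 21 q) := (h.of_emits hτ).of_eq rfl rfl
      have l0 : ∀ l, 0 < l → rows d (τ.setI 21 q) l = rows d σ l := hτ.rows_eq
      have e1 := hone _ h0 l0 (by simp) (-1)
      have l1 := fun l hl => (e1.rows_eq l hl).trans (l0 l hl)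
      have e2 := hone _ (h0.of_emits e1) l1 (by rw [k21]; simp) 0
      have l2 := fun l hl => (e2.rows_eq l hl).trans (l1 l hl)
      have e3 := hone _ ((h0.of_emits e1).of_emits e2) l2 (by rw [k21, k21]; simp) 1
      have := e1.trans (e2.trans e3)
      rw [hupd _ l0, hupd _ l1, hupd _ l2] at this
      convert this using 1
      · ext y
        simp only [Set.mem_iUnion, Fin.exists_fin_succ, Set.mem_union]
        norm_num
      · rfl
    convert this using 1
    · rw [candRows]
      simp only [Set.image_iUnion, Set.image_singleton]
    · ring
    · rfl
  | succ m ih =>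
    set S : Fin n → Fin n → Set (EuclideanSpace ℝ (Fin d)) := fun i j =>
      (fun r => vertOf v p (LexBeats v r (2 * d))) '' candRows v m (Function.update (rows d σ) (m + 1)
          (orthReduce (rows d σ) (m + 1) (d - 1 - (m + 1)) (v i - v j))) with hS
    have := Emits.loop (d := d) (x := 41 + 2 * m) (e := .v 0) (P := .loop (40 + 2 * m) (.v 0)
      (.seq (diffRow d (m + 1) (41 + 2 * m) (40 + 2 * m))
        (.seq (orthRows d (m + 1) (d - 1 - (m + 1))) (tryRows d m)))) (σ := σ) (K := n)
      (N := n * (n ^ (2 * m) * (d * 3))) (m := m + 1) (b := 40 + 2 * (m + 1)) h.size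
      (by omega) (by omega) (by omega) (S := fun i => ⋃ j, S i j) fun i τ ρ hτ => ?_
    · convert this using 1
      · rw [candRows]
        simp only [Set.image_iUnion, hS]
      · ring
      · rfl
    have hτi := h.of_emits hτ
    set τ₀ := τ.setI (41 + 2 * m) i with hτ₀
    have hin₀ : HasInput v p τ₀ := hτi.of_eq (by simp [hτ₀]; omega) rfl
    have hr₀ : ∀ l, m + 1 < l → rows d τ₀ l = rows d σ l := hτ.rows_eq
    have hi₀ : τ₀.I (41 + 2 * m) = i := by simp [hτ₀]
    -- Each level has its own pair of counters. The bound `41 + 2 * m` records that the inner loop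
    -- leaves the outer counter alone.
    refine (Emits.loop (e := .v 0) (b := 41 + 2 * m) hin₀.size (by omega) (by omega) (by omega) (S := S i)
      fun j τ' ρ' hτ' => ?_).mono le_rfl (by omega)
    set τ₁ := τ'.setI (40 + 2 * m) j with hτ₁
    have hin₁ : HasInput v p τ₁ := (hin₀.of_emits hτ').of_eq (by simp [hτ₁]; omega) rfl
    have hr₁ : ∀ l, m + 1 < l → rows d τ₁ l = rows d σ l := fun l hl =>
      (hτ'.rows_eq l hl).trans (hr₀ l hl)
    have hi₁ : τ₁.I (41 + 2 * m) = i := by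
      rw [hτ₁, VState.setI_I, if_neg (by omega), hτ'.I _ le_rfl, hi₀]
    have hj₁ : τ₁.I (40 + 2 * m) = j := by simp [hτ₁]
    rw [exec_seq, exec_seq]
    set τ₂ := (diffRow d (m + 1) (41 + 2 * m) (40 + 2 * m)).exec τ₁ with hτ₂
    have f₂ := frame_exec (diffRow d (m + 1) (41 + 2 * m) (40 + 2 * m)) τ₁
    have r₂ : rows d τ₂ = _ := rows_diffRow hin₁ (by omega) (by omega) hi₁ hj₁ (m + 1)
    set τ₃ := (orthRows d (m + 1) (d - 1 - (m + 1))).exec τ₂ with hτ₃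
    obtain ⟨g1, -, g3⟩ := frame_orthRows (d := d) (m + 1) (d - 1 - (m + 1)) τ₂
    have r₃ : rows d τ₃ = Function.update (rows d τ₁) (m + 1)
        (orthReduce (rows d τ₁) (m + 1) (d - 1 - (m + 1)) (v i - v j)) := by
      rw [hτ₃, rows_orthRows, r₂, Function.update_idem, Function.update_self]
      congr 1
      exact orthReduce_congr (fun l hl => by rw [Function.update_of_ne (by omega)]) _ _
    have hI : ∀ y, y ≠ 20 → τ₃.I y = τ₁.I y := fun y hy => (g1 y hy).trans (f₂.I y (by
      simpa [diffRow, keepsI] using hy.symm))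
    have e₃ : Emits d ∅ 0 (m + 1) (41 + 2 * m) τ₁ τ₃ := by
      refine ⟨?_, hI 14 (by norm_num), hI 0 (by norm_num), fun y hy => hI y (by omega),
        (g3 1 (by decide)).trans (f₂.F 1 rfl), fun l hl => ?_⟩
      · rw [Set.union_empty]
        exact computed_congr (hI 14 (by norm_num)) ((g3 3 (by decide)).trans (f₂.F 3 rfl))
      · rw [r₃, Function.update_of_ne (by omega)]
    have e₄ := ih (by omega) (hin₁.of_emits e₃) fun l => by
      rw [e₃.rows_eq _ (by omega), hr₁ _ (by omega), hb l]
    have e₅ := e₃.trans (e₄.mono (Nat.le_succ m) (by omega))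
    have hc : candRows v m (rows d τ₃) = candRows v m (Function.update (rows d σ) (m + 1)
        (orthReduce (rows d σ) (m + 1) (d - 1 - (m + 1)) (v i - v j))) := by
      refine candRows_congr fun l hl => ?_
      rw [r₃, orthReduce_congr hr₁]
      by_cases hl' : l = m + 1
      · simp [hl']
      · rw [Function.update_of_ne hl', Function.update_of_ne hl', hr₁ l (by omega)]
    rwa [Set.empty_union, zero_add, hc] at e₅

theorem keepsI_zero_orthRows (d m k : ℕ) : (orthRows d m k).keepsI 0 = true := by
  induction k with
  | zero => rfl
  | succ k ih => rw [orthRows, keepsI, ih]; rfl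

theorem keepsI_zero_tryRows (d m : ℕ) : (tryRows d m).keepsI 0 = true := by
  induction m with
  | zero =>
    simp [tryRows, keepsI, tryUnit, keepsI_zero_orthRows]
    exact ⟨⟨rfl, rfl⟩, ⟨rfl, rfl⟩, rfl, rfl⟩
  | succ m ih =>
    simp [tryRows, keepsI, keepsI_zero_orthRows, ih, diffRow]

/-- Each level multiplies the time by the number `n ^ 2` of pairs; `1 ≤ n` lets this factor absorb
the overhead of the loops. -/
theorem cost_tryRows_le (d m : ℕ) : ∃ C, ∀ σ : VState, 1 ≤ σ.I 0 →
    (tryRows d m).cost σ ≤ C * (σ.I 0 ^ (2 * m) * ((σ.I 0 + 1) * (Nat.clog 2 (σ.I 0) + 1))) := by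
  induction m with
  | zero =>
    obtain ⟨C, hC⟩ := cost_emitVertex_le d
    have hu : ∃ b, ∀ z σ, (tryUnit d z).cost σ ≤ (b + C) * ((σ.I 0 + 1) * (Nat.clog 2 (σ.I 0) + 1)) ∧
        ((tryUnit d z).exec σ).I 0 = σ.I 0 := by
      refine ⟨(unitRow d 0).bound + (orthRows d 0 (d - 1)).bound, fun z σ => ?_⟩
      have h1 : (unitRow d z).cost σ ≤ (unitRow d 0).bound := cost_le_bound (unitRow d z) rfl σ
      have h2 := cost_le_bound _ (orthRows_isStatic d 0 (d - 1)) ((unitRow d z).exec σ)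
      have i1 : ((unitRow d z).exec σ).I 0 = σ.I 0 := (frame_exec (unitRow d z) σ).I 0 rfl
      have i2 : ((orthRows d 0 (d - 1)).exec ((unitRow d z).exec σ)).I 0 = σ.I 0 :=
        ((frame_exec _ _).I 0 (keepsI_zero_orthRows d 0 (d - 1))).trans i1
      have h3 := hC ((orthRows d 0 (d - 1)).exec ((unitRow d z).exec σ))
      rw [i2] at h3
      refine ⟨?_, ?_⟩
      · rw [tryUnit, cost_seq, cost_seq, add_mul]
        have := Nat.le_mul_of_pos_right ((unitRow d 0).bound + (orthRows d 0 (d - 1)).bound)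
          (show 0 < (σ.I 0 + 1) * (Nat.clog 2 (σ.I 0) + 1) by positivity)
        rw [mul_assoc] at h3
        omega
      · rw [tryUnit, exec_seq, exec_seq, (frame_exec (emitVertex d) _).I 0 rfl, i2]
    obtain ⟨b, hb⟩ := hu
    refine ⟨3 + d * (3 * (b + C) + 5), fun σ _ => ?_⟩
    set T := (σ.I 0 + 1) * (Nat.clog 2 (σ.I 0) + 1) with hT
    have hT1 : 1 ≤ T := Nat.succ_le_of_lt (by positivity)
    have := cost_loop_le (x := 21) (e := .c d) (P := .seq (tryUnit d (-1))
      (.seq (tryUnit d 0) (tryUnit d 1))) (σ := σ) (3 * (b + C) * T) fun k _ τ hτ => by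
        have i0 : (τ.setI 21 k).I 0 = σ.I 0 := by
          simpa using hτ.I 0 (keepsI_zero_tryRows d 0)
        obtain ⟨a1, a2⟩ := hb (-1) (τ.setI 21 k)
        obtain ⟨b1, b2⟩ := hb 0 ((tryUnit d (-1)).exec (τ.setI 21 k))
        obtain ⟨c1, -⟩ := hb 1 ((tryUnit d 0).exec ((tryUnit d (-1)).exec (τ.setI 21 k)))
        rw [i0] at a1 a2
        rw [a2] at b1 b2
        rw [b2] at c1
        rw [cost_seq, cost_seq]
        rw [← hT] at a1 b1 c1
        linarith
    simp only [IExp.eval, IExp.cost] at this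
    rw [tryRows, mul_zero, pow_zero, one_mul]
    have h5 : d * 1 ≤ d * T := Nat.mul_le_mul_left d hT1
    nlinarith
  | succ m ih =>
    obtain ⟨C, hC⟩ := ih
    set b := (diffRow d (m + 1) (41 + 2 * m) (40 + 2 * m)).bound +
      (orthRows d (m + 1) (d - 1 - (m + 1))).bound with hbdef
    refine ⟨18 + b + C, fun σ hn => ?_⟩
    set n := σ.I 0 with hnd
    set X := n ^ (2 * m) * ((n + 1) * (Nat.clog 2 n + 1)) with hX
    have hX1 : 1 ≤ X := Nat.succ_le_of_lt (by positivity)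
    have hk1 : (tryRows d (m + 1)).keepsI 0 = true := keepsI_zero_tryRows d (m + 1)
    rw [tryRows] at hk1
    have hk2 := hk1
    rw [keepsI, Bool.and_eq_true] at hk2
    have hk3 := hk2.2
    rw [keepsI, Bool.and_eq_true, keepsI, Bool.and_eq_true] at hk3
    have houter := cost_loop_le (x := 41 + 2 * m) (e := .v 0) (P := .loop (40 + 2 * m) (.v 0)
      (.seq (diffRow d (m + 1) (41 + 2 * m) (40 + 2 * m))
        (.seq (orthRows d (m + 1) (d - 1 - (m + 1))) (tryRows d m)))) (σ := σ)
      (4 + n * (b + C * X + 5)) fun i _ τ hτ => by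
        have i0 : (τ.setI (41 + 2 * m) i).I 0 = n := by
          rw [VState.setI_I, if_neg (by omega), hτ.I 0 hk1]
        have := cost_loop_le (x := 40 + 2 * m) (e := .v 0) (P :=
          .seq (diffRow d (m + 1) (41 + 2 * m) (40 + 2 * m))
            (.seq (orthRows d (m + 1) (d - 1 - (m + 1))) (tryRows d m)))
          (σ := τ.setI (41 + 2 * m) i) (b + C * X) fun j _ τ' hτ' => by
            have j0 : (τ'.setI (40 + 2 * m) j).I 0 = n := by
              rw [VState.setI_I, if_neg (by omega), hτ'.I 0 hk2.2, i0]
            rw [cost_seq, cost_seq]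
            set ρ := τ'.setI (40 + 2 * m) j
            set ρ₁ := (diffRow d (m + 1) (41 + 2 * m) (40 + 2 * m)).exec ρ
            have h1 : (diffRow d (m + 1) (41 + 2 * m) (40 + 2 * m)).cost ρ ≤ _ :=
              cost_le_bound _ rfl _
            have h2 := cost_le_bound _ (orthRows_isStatic d (m + 1) (d - 1 - (m + 1))) ρ₁
            have j1 : ρ₁.I 0 = n := ((frame_exec _ _).I 0 hk3.2.1).trans j0
            have j2 : ((orthRows d (m + 1) (d - 1 - (m + 1))).exec ρ₁).I 0 = n :=
              ((frame_exec _ _).I 0 (keepsI_zero_orthRows _ _ _)).trans j1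
            have h3 := hC _ (j2.symm ▸ hn)
            rw [j2, ← hX] at h3
            omega
        simp only [IExp.eval, IExp.cost, i0] at this
        omega
    simp only [IExp.eval, IExp.cost, ← hnd] at houter
    rw [tryRows]
    refine houter.trans ?_
    have e : (18 + b + C) * (n ^ (2 * (m + 1)) * ((n + 1) * (Nat.clog 2 n + 1))) =
        (18 + b + C) * (n * (n * X)) := by rw [hX]; ring
    rw [e]
    have h1 : n ≤ n * (n * X) := Nat.le_mul_of_pos_right _ (by positivity)
    have h2 : n * (n * 1) ≤ n * (n * X) := Nat.mul_le_mul_left _ (Nat.mul_le_mul_left _ hX1)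
    have h3 : (5 + b) * (n * (n * 1)) ≤ (5 + b) * (n * (n * X)) := Nat.mul_le_mul_left _ h2
    have h4 : 2 + 2 + n * (4 + n * (b + C * X + 5) + 5) =
      4 + 9 * n + (5 + b) * (n * (n * 1)) + C * (n * (n * X)) := by ring
    rw [h4, show (18 + b + C) * (n * (n * X)) =
      13 * (n * (n * X)) + (5 + b) * (n * (n * X)) + C * (n * (n * X)) by ring]
    omega

/-! ### Running times -/

/-- Sorting polynomially many points costs only a constant factor in the logarithm, since `log (a *
n ^ k)` is at most `k * log n` plus a constant. -/
theorem clog_bound (a k : ℕ) : ∃ C, ∀ n N : ℕ, 1 ≤ n → N ≤ a * n ^ k →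
    (N + 1) * (Nat.clog 2 N + 1) ≤ C * (n ^ k * (Nat.clog 2 n + 1)) := by
  refine ⟨(a + 1) * (k + a + 1), fun n N hn hN => ?_⟩
  have h1 : N + 1 ≤ (a + 1) * n ^ k := by
    have : 1 ≤ n ^ k := Nat.one_le_pow _ _ hn
    rw [add_mul, one_mul]
    omega
  have h2 : Nat.clog 2 N ≤ k * Nat.clog 2 n + a := by
    refine Nat.clog_le_of_le_pow (hN.trans ?_)
    rw [pow_add, mul_comm k, pow_mul, mul_comm]
    exact Nat.mul_le_mul (Nat.pow_le_pow_left (Nat.le_pow_clog (by norm_num) n) k)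
      Nat.lt_two_pow_self.le
  calc (N + 1) * (Nat.clog 2 N + 1) ≤ ((a + 1) * n ^ k) * ((k + a + 1) * (Nat.clog 2 n + 1)) := by
        refine Nat.mul_le_mul h1 ?_
        nlinarith
    _ = _ := by ring

/-- The shift to `n + 1` makes the right-hand side positive also for `n = 1`, where the program
still takes some steps. -/
theorem clog_le_log {n : ℕ} (hn : 1 ≤ n) :
    ((Nat.clog 2 n : ℝ) + 1) * Real.log 2 ≤ 3 * Real.log (n + 1) := by
  have h1 : (Nat.clog 2 n : ℝ) ≤ Nat.log 2 n + 1 := by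
    have : Nat.clog 2 n ≤ Nat.log 2 n + 1 :=
      Nat.clog_le_of_le_pow (Nat.lt_pow_succ_log_self (by norm_num) n).le
    exact_mod_cast this
  have hn' : (1 : ℝ) ≤ n := by exact_mod_cast hn
  have h2 : (Nat.log 2 n : ℝ) * Real.log 2 ≤ Real.log (n + 1) := by
    rw [← Real.log_pow]
    refine Real.log_le_log (by positivity) ?_
    have : 2 ^ Nat.log 2 n ≤ n := Nat.pow_log_le_self 2 (by omega)
    have : (2 : ℝ) ^ Nat.log 2 n ≤ n := by exact_mod_cast this
    linarith
  have h3 : Real.log 2 ≤ Real.log (n + 1) := Real.log_le_log (by norm_num) (by linarith)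
  have h4 : 0 < Real.log 2 := Real.log_pos (by norm_num)
  nlinarith

/-- A program that computes the vertices of `M`, with repetitions, yields a program of the RAM. -/
theorem computesMInTime_of_count {k : ℕ} (hk : 1 ≤ k) (P : Cmd) (a C : ℕ)
    (hP : ∀ (n : ℕ) (v : Fin n → EuclideanSpace ℝ (Fin d)) (p : Fin n → ℝ),
      1 ≤ n → Function.Injective v → (∀ i, 0 < p i ∧ p i < 1) → ∀ σ, HasInput v p σ →
        computed d (P.exec σ) = (minkowskiM v p).extremePoints ℝ ∧
        (P.exec σ).I 14 ≤ a * n ^ k ∧ P.cost σ ≤ C * (n ^ k * (Nat.clog 2 n + 1))) :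
    ComputesMInTime d fun n => (n : ℝ) ^ k * Real.log ((n : ℝ) + 1) := by
  obtain ⟨C₁, h₁⟩ := cost_loadInput_le d
  obtain ⟨C₂, h₂⟩ := cost_finish_le d
  obtain ⟨C₃, h₃⟩ := clog_bound a k
  refine computesMInTime_of_cmd P ((2 * C₁ + C + C₂ * C₃ : ℕ) * (3 / Real.log 2))
    fun n v p hn hv hp σ hσ => ⟨(hP n v p hn hv hp σ hσ).1, ?_⟩
  have hin := loadInput_spec v p
  obtain ⟨-, g2, g3⟩ := hP n v p hn hv hp _ hin
  rw [cost_seq, cost_seq]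
  set s := (ramInput v p).toVState with hs
  have t1 := h₁ s
  have e0 : s.I 0 = n := by simp [hs, RAMState.toVState, ramInput]
  rw [e0] at t1
  have t2 := h₂ (P.exec ((loadInput d).exec s))
  have t3 := h₃ n _ hn g2
  set X := n ^ k * (Nat.clog 2 n + 1) with hX
  have t4 : n + 1 ≤ 2 * X := by
    have h5 : n ≤ n ^ k := Nat.le_self_pow (by omega) n
    have h6 : n ^ k ≤ X := Nat.le_mul_of_pos_right _ (Nat.succ_pos _)
    omega
  have t5 := Nat.mul_le_mul_left C₁ t4
  have t6 := Nat.mul_le_mul_left C₂ t3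
  have hnat : (loadInput d).cost s + (P.cost ((loadInput d).exec s) +
      (finish d).cost (P.exec ((loadInput d).exec s))) ≤ (2 * C₁ + C + C₂ * C₃) * X := by
    rw [mul_assoc] at t2
    rw [show (2 * C₁ + C + C₂ * C₃) * X = C₁ * (2 * X) + C * X + C₂ * (C₃ * X) by ring]
    omega
  have h4 : 0 < Real.log 2 := Real.log_pos (by norm_num)
  have hXr : (X : ℝ) ≤ 3 / Real.log 2 * ((n : ℝ) ^ k * Real.log (n + 1)) := by
    rw [hX, div_mul_eq_mul_div, le_div_iff₀ h4]
    push_cast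
    have := mul_le_mul_of_nonneg_left (clog_le_log hn) (show (0 : ℝ) ≤ (n : ℝ) ^ k by positivity)
    linarith
  calc _ ≤ (((2 * C₁ + C + C₂ * C₃) * X : ℕ) : ℝ) := by exact_mod_cast hnat
    _ = ((2 * C₁ + C + C₂ * C₃ : ℕ) : ℝ) * X := by push_cast; ring
    _ ≤ _ := by
      rw [mul_assoc]
      exact mul_le_mul_of_nonneg_left hXr (Nat.cast_nonneg _)

/-- Computation of the vertices in any dimension. -/
def vertexCmd (d : ℕ) : Cmd := .seq (.iset 14 (.c 0)) (.seq (basisRows d) (tryRows d (d - 1)))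

theorem computesMInTime (hd : 1 ≤ d) :
    ComputesMInTime d fun n => (n : ℝ) ^ (2 * d - 1) * Real.log ((n : ℝ) + 1) := by
  obtain ⟨C, hC⟩ := cost_tryRows_le d (d - 1)
  refine computesMInTime_of_count (by omega) (vertexCmd d) (d * 3)
    (3 + (basisRows d).bound + 2 * C) fun n v p hn hv hp σ hσ => ?_
  set σ₁ := (Cmd.iset 14 (.c 0)).exec σ with hσ₁
  set σ₂ := (basisRows d).exec σ₁ with hσ₂
  have f₂ := frame_exec (basisRows d) σ₁
  have h2 : HasInput v p σ₂ := (hσ.of_eq (τ := σ₁) (by simp [hσ₁]) rfl).of_eq (f₂.I 0 rfl)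
    (f₂.F 1 rfl)
  have hb := basisRows_spec (d := d) σ₁
  have h14 : σ₂.I 14 = 0 := by rw [hσ₂, f₂.I 14 rfl, hσ₁]; simp
  have he := emits_tryRows hv (m := d - 1) (by omega) h2 hb
  have hpow : n ^ (2 * d - 1) = n * n ^ (2 * (d - 1)) := by
    rw [← pow_succ']
    congr 1
    omega
  have hX1 : 1 ≤ n ^ (2 * (d - 1)) := Nat.one_le_pow _ _ hn
  refine ⟨?_, ?_, ?_⟩
  · refine he.computed_eq.trans ?_
    rw [extremePoints_eq_candRows (by omega) (by omega) hv hp hb]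
    rw [← hσ₂, show computed d σ₂ = ∅ by simp [computed, h14], Set.empty_union]
  -- There are only `O(n ^ (2 * d - 2))` computed points; the exponent is raised by one to match the
  -- bound for the running time.
  · refine he.count.le.trans ?_
    rw [h14, zero_add, hpow, mul_comm]
    exact Nat.mul_le_mul_left _ (Nat.le_mul_of_pos_left _ hn)
  · rw [vertexCmd, cost_seq, cost_seq]
    have c1 := cost_le_bound (basisRows d) rfl σ₁
    have c2 := hC σ₂ (h2.size.symm ▸ hn)
    rw [h2.size] at c2
    rw [hpow]
    set X := n ^ (2 * (d - 1))
    set L := Nat.clog 2 n + 1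
    have hY : 1 ≤ n * X * L := Nat.succ_le_of_lt (by positivity)
    have c3 : X * ((n + 1) * L) ≤ 2 * (n * X * L) := by
      have : n + 1 ≤ 2 * n := by omega
      calc X * ((n + 1) * L) = (n + 1) * (X * L) := by ring
        _ ≤ 2 * n * (X * L) := Nat.mul_le_mul_right _ this
        _ = _ := by ring
    have c4 := Nat.mul_le_mul_left C c3
    have c5 := Nat.mul_le_mul_left (3 + (basisRows d).bound) hY
    rw [← hσ₁, ← hσ₂]
    simp only [cost_iset, IExp.cost]
    rw [show (3 + (basisRows d).bound + 2 * C) * (n * X * L) =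
      (3 + (basisRows d).bound) * (n * X * L) + C * (2 * (n * X * L)) by ring]
    omega

end

/-! ### Rotational sweep in the plane -/

section

/-- The first component of the angular key of a vector: `0` on the open positive half of the first
axis, `1` above the first axis, `2` on the other half of the axis, `3` below the axis. -/
def angleClass (x y : ℝ) : ℝ :=
  if 0 < y then 1 else if y < 0 then 3 else if 0 < x then 0 else 2

/-- The angular key; its order is that of the angles in `[0, 2π)`. -/
def angleKey (x y : ℝ) : Lex (Fin 2 → ℝ) := toLex ![angleClass x y, -(x / y)]

theorem toLex_pair_le_iff {a b c e : ℝ} :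
    (toLex ![a, b] : Lex (Fin 2 → ℝ)) ≤ toLex ![c, e] ↔ a < c ∨ a = c ∧ b ≤ e := by
  have : (toLex ![c, e] : Lex (Fin 2 → ℝ)) < toLex ![a, b] ↔ c < a ∨ c = a ∧ e < b := by
    constructor
    · rintro ⟨l, h0, h⟩
      fin_cases l
      · exact Or.inl h
      · exact Or.inr ⟨h0 0 (by simp), h⟩
    · rintro (h | ⟨h0, h⟩)
      · exact ⟨0, fun l hl => by simp at hl, h⟩
      · refine ⟨1, fun l hl => ?_, h⟩
        obtain rfl : l = 0 := by
          fin_cases l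
          · rfl
          · simp at hl
        exact h0
  exact not_lt.symm.trans ((not_congr this).trans (by grind))

theorem angleKey_le_iff {x y z t : ℝ} : angleKey x y ≤ angleKey z t ↔
    angleClass x y < angleClass z t ∨ angleClass x y = angleClass z t ∧ -(x / y) ≤ -(z / t) :=
  toLex_pair_le_iff

theorem angleClass_pos {x y : ℝ} (h : 0 < y) : angleClass x y = 1 := by simp [angleClass, h]

theorem angleClass_neg {x y : ℝ} (h : y < 0) : angleClass x y = 3 := by
  simp [angleClass, h, h.le.not_gt]

theorem angleClass_zero_pos {x : ℝ} (h : 0 < x) : angleClass x 0 = 0 := by simp [angleClass, h]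

theorem angleClass_zero_neg {x : ℝ} (h : x < 0) : angleClass x 0 = 2 := by
  simp [angleClass, h.le.not_gt]

theorem angleClass_neg_lt_two_iff {x y : ℝ} (h : x ≠ 0 ∨ y ≠ 0) :
    angleClass (-x) (-y) < 2 ↔ ¬ angleClass x y < 2 := by
  rcases lt_trichotomy y 0 with hy | rfl | hy
  · rw [angleClass_neg hy, angleClass_pos (by linarith)]; norm_num
  · rcases lt_trichotomy x 0 with hx | rfl | hx
    · rw [neg_zero, angleClass_zero_neg hx, angleClass_zero_pos (by linarith)]; norm_num
    · simp at h
    · rw [neg_zero, angleClass_zero_pos hx, angleClass_zero_neg (by linarith)]; norm_num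
  · rw [angleClass_pos hy, angleClass_neg (by linarith)]; norm_num

/-- The quotient `-(x / y)` is minus the cotangent, which increases with the angle on either open
half plane. There the comparison of angles is the sign of a determinant. -/
theorem neg_div_le_neg_div_iff {x y z t : ℝ} (h : 0 < y * t) :
    -(x / y) ≤ -(z / t) ↔ 0 ≤ t * x - z * y := by
  have hy : y ≠ 0 := by rintro rfl; simp at h
  have ht : t ≠ 0 := by rintro rfl; simp at h
  have e : x / y - z / t = (t * x - z * y) / (y * t) := by field_simp
  rw [neg_le_neg_iff, ← sub_nonneg, e, le_div_iff₀ h, zero_mul]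

/-- A vector `(x, y)` of angle less than `π` lies in the half-open half plane to the right of
`(z, t)` if and only if, in the order of the angles, `(z, t)` separates it from its negative. -/
theorem sweep_iff {x y z t : ℝ} (hxy : x ≠ 0 ∨ y ≠ 0) (hzt : z ≠ 0 ∨ t ≠ 0)
    (h : angleClass x y < 2) :
    (angleKey x y ≤ angleKey z t ∧ ¬ angleKey (-x) (-y) ≤ angleKey z t) ↔
      0 < t * x - z * y ∨ t * x - z * y = 0 ∧ 0 < z * x + t * y := by
  rcases lt_trichotomy y 0 with hy | rfl | hy
  · rw [angleClass_neg hy] at h; norm_num at h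
  · have hx : 0 < x := by
      rcases lt_trichotomy x 0 with hx | rfl | hx
      · rw [angleClass_zero_neg hx] at h; norm_num at h
      · simp at hxy
      · exact hx
    rw [neg_zero, angleKey_le_iff, angleKey_le_iff, angleClass_zero_pos hx,
      angleClass_zero_neg (by linarith : -x < 0)]
    rcases lt_trichotomy t 0 with ht | rfl | ht
    · rw [angleClass_neg ht]
      have : t * x < 0 := mul_neg_of_neg_of_pos ht hx
      norm_num
      refine ⟨this.le, ?_⟩
      rintro (h' | h')
      · exact absurd h' ht.ne
      · exact absurd h' hx.ne'
    · rcases lt_trichotomy z 0 with hz | rfl | hz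
      · rw [angleClass_zero_neg hz]
        have := mul_neg_of_neg_of_pos hz hx
        norm_num
        exact this.le
      · simp at hzt
      · rw [angleClass_zero_pos hz]
        have := mul_pos hz hx
        norm_num
        exact this
    · rw [angleClass_pos ht]
      have := mul_pos ht hx
      norm_num
      exact Or.inl this
  · rw [angleKey_le_iff, angleKey_le_iff, angleClass_pos hy,
      angleClass_neg (by linarith : -y < 0)]
    rcases lt_trichotomy t 0 with ht | rfl | ht
    · rw [angleClass_neg ht, neg_div_le_neg_div_iff (by nlinarith : 0 < -y * t)]
      norm_num
      intro h1 h2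
      exfalso
      -- For parallel vectors this identity gives the sign of the inner product, and so tells equal
      -- from opposite directions.
      have h3 : t * (z * x + t * y) = (z * z + t * t) * y := by linear_combination z * h1
      have h4 : 0 < (z * z + t * t) * y := by
        have := mul_pos_of_neg_of_neg ht ht
        have := mul_self_nonneg z
        positivity
      have h5 := mul_neg_of_neg_of_pos ht h2
      linarith
    · rcases lt_trichotomy z 0 with hz | rfl | hz
      · rw [angleClass_zero_neg hz]
        have := mul_neg_of_neg_of_pos hz hy
        norm_num
        exact Or.inl this
      · simp at hzt
      · rw [angleClass_zero_pos hz]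
        have := mul_pos hz hy
        norm_num
        refine ⟨this.le, ?_⟩
        rintro (h' | h')
        · exact absurd h' hz.ne'
        · exact absurd h' hy.ne'
    · rw [angleClass_pos ht, neg_div_le_neg_div_iff (mul_pos hy ht)]
      norm_num
      constructor
      · intro h'
        rcases h'.lt_or_eq with h1 | h1
        · exact Or.inl (by linarith)
        · refine Or.inr ⟨by linarith, ?_⟩
          have h3 : t * (z * x + t * y) = (z * z + t * t) * y := by linear_combination -z * h1
          have h4 : 0 < (z * z + t * t) * y := by
            have := mul_pos ht ht
            have := mul_self_nonneg z
            positivity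
          rw [← h3] at h4
          exact (pos_iff_pos_of_mul_pos h4).1 ht
      · rintro (h' | ⟨h', -⟩) <;> linarith

/-! ### Events of the sweep and the orders it passes through -/

variable {n : ℕ} {v : Fin n → EuclideanSpace ℝ (Fin 2)} {p : Fin n → ℝ}

/-- The first coordinate of the event vector of an ordered pair of points: their difference, or `(-1, 0)`
if they are equal. -/
def eventX (v : Fin n → EuclideanSpace ℝ (Fin 2)) (i j : Fin n) : ℝ :=
  if i = j then -1 else v i 0 - v j 0

/-- The second coordinate of the event vector. -/
def eventY (v : Fin n → EuclideanSpace ℝ (Fin 2)) (i j : Fin n) : ℝ := v i 1 - v j 1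

/-- The angular key of an ordered pair of points. -/
def eventKey (v : Fin n → EuclideanSpace ℝ (Fin 2)) (i j : Fin n) : Lex (Fin 2 → ℝ) :=
  angleKey (eventX v i j) (eventY v i j)

/-- The event vector has angle less than `π`. -/
def IsUpper (v : Fin n → EuclideanSpace ℝ (Fin 2)) (i j : Fin n) : Prop :=
  angleClass (eventX v i j) (eventY v i j) < 2

theorem event_ne_zero (hv : Function.Injective v) (i j : Fin n) :
    eventX v i j ≠ 0 ∨ eventY v i j ≠ 0 := by
  by_cases hij : i = j
  · left; simp [eventX, hij]
  · by_contra! hc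
    refine hij (hv (PiLp.ext fun c => ?_))
    rw [eventX, if_neg hij, eventY, sub_eq_zero, sub_eq_zero] at hc
    fin_cases c
    · exact hc.1
    · exact hc.2

theorem eventX_swap {i j : Fin n} (hij : i ≠ j) : eventX v j i = -eventX v i j := by
  rw [eventX, eventX, if_neg hij, if_neg hij.symm, neg_sub]

theorem eventY_swap (i j : Fin n) : eventY v j i = -eventY v i j := by
  rw [eventY, eventY, neg_sub]

theorem isUpper_swap (hv : Function.Injective v) {i j : Fin n} (hij : i ≠ j) :
    IsUpper v j i ↔ ¬ IsUpper v i j := by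
  rw [IsUpper, eventX_swap hij, eventY_swap i j, angleClass_neg_lt_two_iff (event_ne_zero hv i j)]
  rfl

theorem eventKey_lt_swap (hv : Function.Injective v) {i j : Fin n} (hij : i ≠ j)
    (h : IsUpper v i j) : eventKey v i j < eventKey v j i := by
  have h' := (isUpper_swap hv hij.symm).1 h
  rw [IsUpper] at h h'
  refine lt_of_not_ge fun hle => ?_
  rcases angleKey_le_iff.1 hle with h1 | ⟨h1, -⟩ <;> linarith

/-- The value `(-1, 0)` on the diagonal makes every event vector a legitimate direction while no
pair `(i, i)` counts as upper. The program can then treat all `n * n` pairs alike. -/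
theorem not_isUpper_self (i : Fin n) : ¬ IsUpper v i i := by
  rw [IsUpper, eventX, eventY, if_pos rfl, sub_self, angleClass_zero_neg (by norm_num)]
  norm_num

/-- Point `i` comes after point `j` in the direction reached by the sweep when the events in `D`
have taken place. -/
def Swept (v : Fin n → EuclideanSpace ℝ (Fin 2)) (D : Fin n → Fin n → Prop) (i j : Fin n) : Prop :=
  i ≠ j ∧ (IsUpper v i j ∧ D i j ∧ ¬ D j i ∨ ¬ IsUpper v i j ∧ (¬ D j i ∨ D i j))

theorem Swept.congr {D D' : Fin n → Fin n → Prop} (h : ∀ i j, i ≠ j → (D i j ↔ D' i j)) :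
    Swept v D = Swept v D' := by
  funext i j
  refine propext (and_congr_right fun hij => ?_)
  rw [h i j hij, h j i hij.symm]

/-- A full turn brings back the initial order. -/
theorem swept_true_eq_swept_false : Swept v (fun _ _ => True) = Swept v fun _ _ => False := by
  funext i j
  simp [Swept]

/-- The rows that describe the order of the points just after the sweep has passed `(z, t)`. -/
def sweepRows (z t : ℝ) (l : ℕ) : EuclideanSpace ℝ (Fin 2) :=
  if l = 0 then !₂[t, -z] else !₂[z, t]

/-- Row `0` is `(z, t)` turned back by a right angle, and row `1` is the derivative of row `0` under
rotation. The second row thus breaks ties in favour of the directions just after the event. -/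
theorem lexBeats_sweepRows {z t : ℝ} {i j : Fin n} (hij : i ≠ j) :
    LexBeats v (sweepRows z t) 2 i j ↔
      0 < t * eventX v i j - z * eventY v i j ∨ t * eventX v i j - z * eventY v i j = 0 ∧
        0 < z * eventX v i j + t * eventY v i j := by
  have e0 : (inner ℝ (sweepRows z t 0) (v i - v j) : ℝ) =
      t * eventX v i j - z * eventY v i j := by
    simp [sweepRows, PiLp.inner_apply, Fin.sum_univ_two, eventX, eventY, hij]
    ring
  have e1 : (inner ℝ (sweepRows z t 1) (v i - v j) : ℝ) =
      z * eventX v i j + t * eventY v i j := by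
    simp [sweepRows, PiLp.inner_apply, Fin.sum_univ_two, eventX, eventY, hij]
    ring
  rw [← e0, ← e1, LexBeats]
  constructor
  · rintro ⟨l, hl, h0, h⟩
    interval_cases l
    · exact Or.inl h
    · exact Or.inr ⟨h0 0 (by norm_num), h⟩
  · rintro (h | ⟨h0, h⟩)
    · exact ⟨0, by norm_num, fun l hl => by omega, h⟩
    · refine ⟨1, by norm_num, fun l hl => ?_, h⟩
      rwa [show l = 0 by omega]

theorem exists_inner_sweepRows_ne_zero (hv : Function.Injective v) {z t : ℝ} (hzt : z ≠ 0 ∨ t ≠ 0)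
    (i j : Fin n) (hij : i ≠ j) :
    ∃ l < 2, (inner ℝ (sweepRows z t l) (v i - v j) : ℝ) ≠ 0 := by
  by_contra! hc
  have h0 := hc 0 (by norm_num)
  have h1 := hc 1 (by norm_num)
  have hne := event_ne_zero hv i j
  simp [sweepRows, PiLp.inner_apply, Fin.sum_univ_two] at h0 h1
  rw [eventX, eventY, if_neg hij] at hne
  generalize v i 0 - v j 0 = x at *
  generalize v i 1 - v j 1 = y at *
  -- The two rows are orthogonal of equal length, so a vector orthogonal to both is zero.
  have e : (z ^ 2 + t ^ 2) * (x ^ 2 + y ^ 2) = 0 := by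
    linear_combination (x * t - y * z) * h0 + (x * z + y * t) * h1
  rcases mul_eq_zero.1 e with h | h
  · rcases hzt with h' | h'
    · have := sq_pos_of_ne_zero h'; nlinarith [sq_nonneg t]
    · have := sq_pos_of_ne_zero h'; nlinarith [sq_nonneg z]
  · rcases hne with h' | h'
    · have := sq_pos_of_ne_zero h'; nlinarith [sq_nonneg y]
    · have := sq_pos_of_ne_zero h'; nlinarith [sq_nonneg x]

/-- For upper pairs this is `sweep_iff`. The other pairs follow by exchanging `i` and `j`, because
both relations are asymmetric and total on distinct points. -/
theorem swept_iff_lexBeats (hv : Function.Injective v) {z t : ℝ} (hzt : z ≠ 0 ∨ t ≠ 0) :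
    Swept v (fun i j => eventKey v i j ≤ angleKey z t) = LexBeats v (sweepRows z t) 2 := by
  have hup : ∀ i j, i ≠ j → IsUpper v i j → ((eventKey v i j ≤ angleKey z t ∧
      ¬ eventKey v j i ≤ angleKey z t) ↔ LexBeats v (sweepRows z t) 2 i j) := fun i j hij h => by
    rw [lexBeats_sweepRows hij, ← sweep_iff (event_ne_zero hv i j) hzt h, eventKey, eventKey,
      eventX_swap hij, eventY_swap i j]
  funext i j
  refine propext ?_
  by_cases hij : i = j
  · subst hij
    simp [Swept, LexBeats.irrefl]
  by_cases h : IsUpper v i j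
  · simp only [Swept, ← hup i j hij h, h]
    tauto
  · have h' := hup j i (Ne.symm hij) ((isUpper_swap hv hij).2 h)
    have h2 : LexBeats v (sweepRows z t) 2 i j ↔ ¬ LexBeats v (sweepRows z t) 2 j i :=
      ⟨fun h => h.asymm, fun h => (LexBeats.total
        (exists_inner_sweepRows_ne_zero hv hzt i j hij)).resolve_right h⟩
    rw [h2, ← h']
    simp only [Swept, h]
    tauto

/-- `pos` is the position of the ordered pairs of points in an order by angles. -/
structure SweepOrder (v : Fin n → EuclideanSpace ℝ (Fin 2)) (pos : Fin n → Fin n → ℕ) : Prop where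
  lt : ∀ i j, pos i j < n * n
  surj : ∀ t < n * n, ∃ i j, pos i j = t
  inj : ∀ i j i' j', pos i j = pos i' j' → i = i' ∧ j = j'
  le : ∀ i j i' j', pos i j < pos i' j' → eventKey v i j ≤ eventKey v i' j'

/-- After `t + 1` events, no further event of the same angle follows. -/
def IsCut (v : Fin n → EuclideanSpace ℝ (Fin 2)) (pos : Fin n → Fin n → ℕ) (t : ℕ) : Prop :=
  t < n * n ∧ ∀ i j i' j', pos i j = t → pos i' j' = t + 1 → eventKey v i j ≠ eventKey v i' j'

/-- Events of equal angle may be sorted in any order, and the orders between them need not come from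
a direction. At a cut the events done are exactly those of angle up to the current one. -/
theorem SweepOrder.lt_succ_iff {pos : Fin n → Fin n → ℕ} (h : SweepOrder v pos) {t : ℕ}
    (ht : IsCut v pos t) {i j : Fin n} (hij : pos i j = t) (i' j' : Fin n) :
    pos i' j' < t + 1 ↔ eventKey v i' j' ≤ eventKey v i j := by
  constructor
  · intro h'
    rcases Nat.lt_succ_iff_lt_or_eq.1 h' with h' | h'
    · exact h.le _ _ _ _ (hij ▸ h')
    · obtain ⟨rfl, rfl⟩ := h.inj _ _ _ _ (h'.trans hij.symm)
      exact le_rfl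
  · intro h'
    by_contra hc
    obtain ⟨a, b, hab⟩ := h.surj (t + 1) (by have := h.lt i' j'; omega)
    have h1 : eventKey v i j < eventKey v a b :=
      lt_of_le_of_ne (h.le _ _ _ _ (by omega)) (ht.2 _ _ _ _ hij hab)
    have h2 : eventKey v a b ≤ eventKey v i' j' := by
      rcases Nat.lt_or_ge (t + 1) (pos i' j') with h2 | h2
      · exact h.le _ _ _ _ (by omega)
      · obtain ⟨rfl, rfl⟩ := h.inj a b i' j' (by omega)
        exact le_rfl
    exact absurd (h1.trans_le h2) (not_lt_of_ge h')

/-- A generic nonzero `u` is reached when the sweep passes `u` turned by a right angle; the last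
event up to there is a cut with the same order. Conversely, the order at a cut is lexicographic
without ties, hence gives a vertex. -/
theorem extremePoints_eq_sweep (hn : 1 ≤ n) (hv : Function.Injective v)
    (hp : ∀ i, 0 < p i ∧ p i < 1) {pos : Fin n → Fin n → ℕ} (h : SweepOrder v pos) :
    (minkowskiM v p).extremePoints ℝ =
      {x | ∃ t, IsCut v pos t ∧ x = vertOf v p (Swept v fun i j => pos i j < t + 1)} := by
  ext x
  constructor
  · intro hx
    obtain ⟨u, hu, rfl⟩ := exists_generic_of_mem_extremePoints hv hp hx
    rw [vertTop_eq_vertOf hu]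
    have hnn : 0 < n * n := Nat.mul_pos hn hn
    -- The last event is always a cut. It serves directions that precede all events, where the sweep
    -- has wrapped around, and the zero direction.
    have hlast : IsCut v pos (n * n - 1) := ⟨by omega, fun _ _ i' j' _ h' => by
      have := h.lt i' j'
      omega⟩
    by_cases hu0 : u 1 ≠ 0 ∨ u 0 ≠ 0
    · have hzt : -u 1 ≠ 0 ∨ u 0 ≠ 0 := hu0.imp_left neg_ne_zero.2
      have hB : vertOf v p (Beats v u) =
          vertOf v p (Swept v fun i j => eventKey v i j ≤ angleKey (-u 1) (u 0)) := by
        rw [swept_iff_lexBeats hv hzt, ← vertTop_eq_vertOf hu]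
        refine vertTop_eq_of_lexBeats hu fun i j hb => ⟨0, by norm_num, fun l hl => by omega, ?_⟩
        rw [Beats, ← sub_pos, ← inner_sub_right] at hb
        convert hb using 2
        ext c
        fin_cases c <;> simp [sweepRows]
      rw [hB]
      by_cases hex : ∃ i j, eventKey v i j ≤ angleKey (-u 1) (u 0)
      · obtain ⟨⟨i, j⟩, hij, hmax⟩ := (univ.filter fun q : Fin n × Fin n =>
          eventKey v q.1 q.2 ≤ angleKey (-u 1) (u 0)).exists_max_image (fun q => pos q.1 q.2)
          (by obtain ⟨i, j, h'⟩ := hex; exact ⟨(i, j), by simpa using h'⟩)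
        simp only [mem_filter, mem_univ, true_and, Prod.forall] at hij hmax
        have hcut : IsCut v pos (pos i j) := ⟨h.lt i j, fun a b a' b' hab hab' he => by
          obtain ⟨rfl, rfl⟩ := h.inj _ _ _ _ hab
          have := hmax a' b' (he ▸ hij)
          omega⟩
        refine ⟨_, hcut, congrArg _ (Swept.congr fun a b _ => ?_)⟩
        rw [h.lt_succ_iff hcut rfl]
        refine ⟨fun h' => ?_, fun h' => h'.trans hij⟩
        rw [← h.lt_succ_iff hcut rfl]
        exact Nat.lt_succ_of_le (hmax a b h')
      · push Not at hex
        refine ⟨_, hlast, congrArg _ ?_⟩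
        have e1 : (fun i j => eventKey v i j ≤ angleKey (-u 1) (u 0)) = fun _ _ => False := by
          funext i j
          exact eq_false (not_le_of_gt (hex i j))
        have e2 : (fun i j => pos i j < n * n - 1 + 1) = fun _ _ => True := by
          funext i j
          have := h.lt i j
          exact eq_true (by omega)
        rw [e1, e2, swept_true_eq_swept_false]
    -- The zero vector is generic only if there are no two distinct indices, and then all orders
    -- agree.
    · push Not at hu0
      refine ⟨_, hlast, vertOf_congr (fun i j hij => ?_) (Beats.irrefl u) (fun i hi => hi.1 rfl)⟩
      exact absurd (by simp [PiLp.inner_apply, Fin.sum_univ_two, hu0]) (hu i j hij)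
  · rintro ⟨t, ht, rfl⟩
    obtain ⟨i, j, hij⟩ := h.surj t ht.1
    have e : (Swept v fun i j => pos i j < t + 1) =
        LexBeats v (sweepRows (eventX v i j) (eventY v i j)) 2 := by
      rw [← swept_iff_lexBeats hv (event_ne_zero hv i j)]
      exact Swept.congr fun a b _ => h.lt_succ_iff ht hij a b
    rw [e]
    exact vertOf_lexBeats_mem_extremePoints hp
      (exists_inner_sweepRows_ne_zero hv (event_ne_zero hv i j))

end

/-! ### Coefficients of the points during the sweep -/

section

variable {n : ℕ} {p : Fin n → ℝ}

open Classical in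
/-- The probability that `i` is present and no point that comes after `i` is. -/
def coef (p : Fin n → ℝ) (B : Fin n → Fin n → Prop) (i : Fin n) : ℝ :=
  p i * ∏ j with B j i, (1 - p j)

theorem vertOf_apply {d : ℕ} (v : Fin n → EuclideanSpace ℝ (Fin d)) (B : Fin n → Fin n → Prop)
    (c : Fin d) : vertOf v p B c = ∑ i, coef p B i * v i c := by
  simp only [vertOf, coef, WithLp.ofLp_sum, WithLp.ofLp_smul, Finset.sum_apply, Pi.smul_apply,
    smul_eq_mul]

theorem coef_congr {B B' : Fin n → Fin n → Prop} {i : Fin n} (h : ∀ j, B j i ↔ B' j i) :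
    coef p B i = coef p B' i := by
  rw [coef, coef]
  congr 1
  refine prod_congr ?_ fun _ _ => rfl
  ext j
  simp [h]

theorem coef_insert {B B' : Fin n → Fin n → Prop} {i j : Fin n} (h : ¬ B j i)
    (h' : ∀ k, B' k i ↔ k = j ∨ B k i) : coef p B' i = coef p B i * (1 - p j) := by
  classical
  have : univ.filter (fun k => B' k i) = insert j (univ.filter fun k => B k i) := by
    ext k
    simp [h']
  rw [coef, coef, mul_assoc]
  congr 1
  rw [show (∏ k with B' k i, (1 - p k)) = ∏ k ∈ univ.filter (fun k => B' k i), (1 - p k) by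
    congr!, this, prod_insert (by simpa using h), mul_comm]

variable {v : Fin n → EuclideanSpace ℝ (Fin 2)} {pos : Fin n → Fin n → ℕ}

/-- An upper event has angle less than `π` and its opposite has not, so each pair of points first
takes one order and later returns. -/
theorem SweepOrder.lt_swap (h : SweepOrder v pos) (hv : Function.Injective v) {i j : Fin n}
    (hij : i ≠ j) (hup : IsUpper v i j) : pos i j < pos j i := by
  by_contra hc
  rcases (not_lt.1 hc).lt_or_eq with h' | h'
  · exact absurd (eventKey_lt_swap hv hij hup) (not_lt_of_ge (h.le _ _ _ _ h'))
  · exact hij (h.inj _ _ _ _ h').1.symm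

/-- An event moves `i` after `j` and touches no other pair. This holds also inside a group of equal
angles, where the intermediate relation need not be an order. -/
theorem SweepOrder.swept_succ (h : SweepOrder v pos) (hv : Function.Injective v) {i j : Fin n}
    (a b : Fin n) : Swept v (fun a b => pos a b < pos i j + 1) a b ↔
      (a = i ∧ b = j ∧ i ≠ j) ∨ ¬ (a = j ∧ b = i) ∧ Swept v (fun a b => pos a b < pos i j) a b := by
  have hlt : ∀ a b, pos a b < pos i j + 1 ↔ (a = i ∧ b = j) ∨ pos a b < pos i j := fun a b => by
    rw [Nat.lt_succ_iff_lt_or_eq, or_comm]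
    refine or_congr_left ⟨fun h' => h.inj _ _ _ _ h', ?_⟩
    rintro ⟨rfl, rfl⟩
    rfl
  by_cases hab : a = b
  · subst hab
    simp only [Swept, ne_eq, not_true_eq_false, false_and, and_false, or_false, false_iff]
    rintro ⟨rfl, rfl, h'⟩
    exact h' rfl
  have s1 := @h.lt_swap _ _ _ hv a b hab
  have s2 := @h.lt_swap _ _ _ hv b a (Ne.symm hab)
  have s3 := isUpper_swap hv hab
  simp only [Swept, hlt]
  by_cases e1 : a = i ∧ b = j
  · obtain ⟨rfl, rfl⟩ := e1
    by_cases hup : IsUpper v a b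
    · have := s1 hup
      simp [hab, Ne.symm hab, hup]
      omega
    · simp [hab, hup]
  · by_cases e2 : a = j ∧ b = i
    · obtain ⟨rfl, rfl⟩ := e2
      by_cases hup : IsUpper v a b
      · simp [hab, Ne.symm hab, hup]
      · have := s2 (s3.2 hup)
        simp [hab, Ne.symm hab, hup]
        omega
    · have e3 : ¬ (b = i ∧ a = j) := fun h => e2 ⟨h.2, h.1⟩
      simp only [e1, e2, e3, false_or, not_false_eq_true, true_and]
      simp only [← and_assoc, e1, false_and, false_or]

theorem SweepOrder.not_swept (h : SweepOrder v pos) (hv : Function.Injective v) {i j : Fin n} :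
    ¬ Swept v (fun a b => pos a b < pos i j) i j := by
  rintro ⟨hij, ⟨-, h', -⟩ | ⟨hup, h' | h'⟩⟩
  · exact lt_irrefl _ h'
  · exact h' (h.lt_swap hv (Ne.symm hij) ((isUpper_swap hv hij).2 hup))
  · exact lt_irrefl _ h'

theorem SweepOrder.swept_swap (h : SweepOrder v pos) (hv : Function.Injective v) {i j : Fin n}
    (hij : i ≠ j) : Swept v (fun a b => pos a b < pos i j) j i := by
  refine ⟨hij.symm, ?_⟩
  by_cases hup : IsUpper v j i
  · exact Or.inl ⟨hup, h.lt_swap hv hij.symm hup, lt_irrefl _⟩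
  · exact Or.inr ⟨hup, Or.inl (lt_irrefl _)⟩

/-- The effect of an event on the coefficients. -/
theorem SweepOrder.coef_succ (h : SweepOrder v pos) (hv : Function.Injective v)
    (hp : ∀ i, 0 < p i ∧ p i < 1) {i j : Fin n} (hij : i ≠ j) (k : Fin n) :
    coef p (Swept v fun a b => pos a b < pos i j + 1) k =
      if k = j then coef p (Swept v fun a b => pos a b < pos i j) j * (1 - p i)
      else if k = i then coef p (Swept v fun a b => pos a b < pos i j) i / (1 - p j)
      else coef p (Swept v fun a b => pos a b < pos i j) k := by
  split_ifs with h1 h2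
  · subst h1
    refine coef_insert (h.not_swept hv) fun a => ?_
    rw [h.swept_succ hv]
    simp [hij, Ne.symm hij]
  · subst h2
    have hne : 1 - p j ≠ 0 := by linarith [(hp j).2]
    rw [eq_div_iff hne]
    refine (coef_insert (fun hc => ?_) fun a => ?_).symm
    · rw [h.swept_succ hv] at hc
      rcases hc with ⟨h3, -, -⟩ | ⟨h3, -⟩
      · exact hij h3.symm
      · exact h3 ⟨rfl, rfl⟩
    · rw [h.swept_succ hv]
      have := h.swept_swap hv hij
      by_cases ha : a = j
      · subst ha; simp [this]
      · simp [ha, hij]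
  · refine coef_congr fun a => ?_
    rw [h.swept_succ hv]
    simp [h1, h2]

/-- At the start `j` comes after `i` exactly if `(i, j)` is upper, so the initial coefficients can
be accumulated while the events are created, without sorting. -/
theorem coef_swept_false (hv : Function.Injective v) (i : Fin n) :
    coef p (Swept v fun _ _ => False) i = coef p (fun j i => IsUpper v i j) i := by
  refine coef_congr fun j => ?_
  by_cases hij : j = i
  · subst hij
    simp [Swept, not_isUpper_self]
  · simp [Swept, hij, isUpper_swap hv hij]

end

/-! ### The program for the plane

Integer variables: `1` number of events, `30`, `31`, `32` loop counters, `33` current event, `34`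
and `35` its two points. Integer arrays `2` and `3` hold the points of the events. Real variables:
`1`, `2` event vector, `3` its class, `5`, `6` current vertex, `7` new coefficient. Real array `5`
holds the coefficients. -/

section

variable {n : ℕ} {v : Fin n → EuclideanSpace ℝ (Fin 2)} {p : Fin n → ℝ}

theorem HasInput.coord_zero {σ : VState} (h : HasInput v p σ) (i : Fin n) :
    σ.F 1 (3 * i) = v i 0 := h.coord i 0

theorem HasInput.coord_one {σ : VState} (h : HasInput v p σ) (i : Fin n) :
    σ.F 1 (3 * i + 1) = v i 1 := h.coord i 1

theorem HasInput.prob_two {σ : VState} (h : HasInput v p σ) (i : Fin n) :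
    σ.F 1 (3 * i + 2) = p i := h.prob i

/-- The current point is the combination of the points with the current coefficients. -/
structure IsCombination (v : Fin n → EuclideanSpace ℝ (Fin 2)) (σ : VState) : Prop where
  x : σ.R 5 = ∑ i : Fin n, σ.F 5 i * v i 0
  y : σ.R 6 = ∑ i : Fin n, σ.F 5 i * v i 1

theorem IsCombination.of_eq {σ τ : VState} (h : IsCombination v σ) (h5 : τ.R 5 = σ.R 5)
    (h6 : τ.R 6 = σ.R 6) (hF : τ.F 5 = σ.F 5) : IsCombination v τ :=
  ⟨by rw [h5, hF, h.x], by rw [h6, hF, h.y]⟩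

/-- Change a coefficient. -/
def setCoef (x : ℕ) (e : RExp) : Cmd :=
  .seq (.rset 7 e) (.seq
    (.rset 5 (.add (.v 5) (.mul (.sub (.v 7) (.a 5 (.v x))) (.a 1 (.mulc 3 (.v x)))))) (.seq
    (.rset 6 (.add (.v 6) (.mul (.sub (.v 7) (.a 5 (.v x))) (.a 1 (.add (.mulc 3 (.v x)) (.c 1))))))
    (.fset 5 (.v x) (.v 7))))

theorem sum_update_coef (f w : Fin n → ℝ) (a : ℝ) (i : Fin n) :
    ∑ k, (if k = i then a else f k) * w k = ∑ k, f k * w k + (a - f i) * w i := by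
  have : ∀ k, (if k = i then a else f k) * w k =
      f k * w k + if k = i then (a - f i) * w i else 0 := fun k => by
    split_ifs with h
    · subst h; ring
    · ring
  simp only [this, sum_add_distrib, sum_ite_eq', mem_univ, if_true]

/-- The combination changes by the new minus the old coefficient times the point. This makes an
event take constant time instead of a new summation. -/
theorem setCoef_spec {σ : VState} (h : HasInput v p σ) (hc : IsCombination v σ) {x : ℕ} {i : Fin n}
    (hx : σ.I x = i) (e : RExp) : IsCombination v ((setCoef x e).exec σ) ∧
      ∀ k : Fin n, ((setCoef x e).exec σ).F 5 k = if k = i then e.eval σ else σ.F 5 k := by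
  have hF : ∀ k : Fin n, ((setCoef x e).exec σ).F 5 k = if k = i then e.eval σ else σ.F 5 k := by
    intro k
    simp [setCoef, hx, Fin.ext_iff]
  refine ⟨⟨?_, ?_⟩, hF⟩
  · simp only [hF]
    rw [sum_update_coef (fun k : Fin n => σ.F 5 k) (fun k => v k 0), ← hc.x, ← h.coord_zero i]
    simp [setCoef, hx]
  · simp only [hF]
    rw [sum_update_coef (fun k : Fin n => σ.F 5 k) (fun k => v k 1), ← hc.y, ← h.coord_one i]
    simp [setCoef, hx]

theorem HasInput.setCoef {σ : VState} (h : HasInput v p σ) (x : ℕ) (e : RExp) :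
    HasInput v p ((setCoef x e).exec σ) := h.of_eq rfl ((frame_exec (_root_.setCoef x e) σ).F 1 rfl)

/-- Compute the event vector. -/
def eventVector : Cmd :=
  .seq (.rset 1 (.sub (.a 1 (.mulc 3 (.v 30))) (.a 1 (.mulc 3 (.v 31))))) (.seq
    (.rset 2 (.sub (.a 1 (.add (.mulc 3 (.v 30)) (.c 1))) (.a 1 (.add (.mulc 3 (.v 31)) (.c 1)))))
    (.ite (.ilt (.v 30) (.v 31)) .skip (.ite (.ilt (.v 31) (.v 30)) .skip (.rset 1 (.c (-1))))))

theorem eventVector_spec {σ : VState} (h : HasInput v p σ) {i j : Fin n} (hi : σ.I 30 = i)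
    (hj : σ.I 31 = j) : (eventVector.exec σ).R 1 = eventX v i j ∧
      (eventVector.exec σ).R 2 = eventY v i j := by
  simp only [eventVector, exec_seq, exec_rset, exec_ite, exec_skip, Tst.eval_ilt, IExp.eval,
    VState.setR_I, hi, hj]
  rcases lt_trichotomy i j with hij | rfl | hij
  · simp [Fin.lt_def.1 hij, hi, hj, h.coord_zero, h.coord_one, eventX, eventY, hij.ne]
  · simp [hi, hj, eventX, eventY]
  · simp [Fin.lt_def.1 hij, (Fin.lt_def.1 hij).le.not_gt, hi, hj, h.coord_zero, h.coord_one, eventX,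
      eventY, hij.ne']

/-- Compute the class of the event vector. -/
def eventClass : Cmd :=
  .ite (.rlt (.c 0) (.v 2)) (.rset 3 (.c 1)) (.ite (.rlt (.v 2) (.c 0)) (.rset 3 (.c 3))
    (.ite (.rlt (.c 0) (.v 1)) (.rset 3 (.c 0)) (.rset 3 (.c 2))))

theorem eventClass_spec (σ : VState) : (eventClass.exec σ).R 3 = angleClass (σ.R 1) (σ.R 2) := by
  simp only [eventClass, exec_ite, exec_rset, Tst.eval_rlt, RExp.eval, Int.cast_zero, angleClass]
  split_ifs <;> simp

/-- Create an event. -/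
def eventStep : Cmd :=
  .seq (.aset 2 (.v 1) (.v 30)) (.seq (.aset 3 (.v 1) (.v 31)) (.seq eventVector (.seq eventClass
    (.seq (.fset 0 (.mulc 2 (.v 1)) (.v 3)) (.seq
      (.fset 0 (.add (.mulc 2 (.v 1)) (.c 1)) (.sub (.c 0) (.div (.v 1) (.v 2)))) (.seq
      (.ite (.rlt (.v 3) (.c 2)) (setCoef 30 (.mul (.a 5 (.v 30))
        (.sub (.c 1) (.a 1 (.add (.mulc 3 (.v 31)) (.c 2)))))) .skip)
      (.iset 1 (.add (.v 1) (.c 1)))))))))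

open Classical in
theorem eventStep_spec {σ : VState} (h : HasInput v p σ) (hc : IsCombination v σ) {i j : Fin n}
    (hi : σ.I 30 = i) (hj : σ.I 31 = j) {E : ℕ} (hE : σ.I 1 = E) :
    (eventStep.exec σ).I 1 = E + 1 ∧
    (∀ e, (eventStep.exec σ).A 2 e = if e = E then (i : ℕ) else σ.A 2 e) ∧
    (∀ e, (eventStep.exec σ).A 3 e = if e = E then (j : ℕ) else σ.A 3 e) ∧
    (∀ e, itemKey 2 (eventStep.exec σ) e = if e = E then eventKey v i j else itemKey 2 σ e) ∧
    IsCombination v (eventStep.exec σ) ∧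
    ∀ k : Fin n, (eventStep.exec σ).F 5 k =
      if k = i ∧ IsUpper v i j then σ.F 5 i * (1 - p j) else σ.F 5 k := by
  set σ₁ := (Cmd.aset 3 (.v 1) (.v 31)).exec ((Cmd.aset 2 (.v 1) (.v 30)).exec σ) with hσ₁
  set σ₂ := eventVector.exec σ₁ with hσ₂
  have f₂ := frame_exec eventVector σ₁
  set σ₃ := eventClass.exec σ₂ with hσ₃
  have f₃ := frame_exec eventClass σ₂
  set σ₄ := (Cmd.fset 0 (.add (.mulc 2 (.v 1)) (.c 1)) (.sub (.c 0) (.div (.v 1) (.v 2)))).exec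
    ((Cmd.fset 0 (.mulc 2 (.v 1)) (.v 3)).exec σ₃) with hσ₄
  set Q : Cmd := .ite (.rlt (.v 3) (.c 2)) (setCoef 30 (.mul (.a 5 (.v 30))
        (.sub (.c 1) (.a 1 (.add (.mulc 3 (.v 31)) (.c 2)))))) .skip with hQ
  set σ₅ := Q.exec σ₄ with hσ₅
  have f₅ := frame_exec Q σ₄
  have hfin : eventStep.exec σ = (Cmd.iset 1 (.add (.v 1) (.c 1))).exec σ₅ := rfl
  have h1 : HasInput v p σ₁ := h.of_eq rfl rfl
  have I4 : ∀ y, σ₄.I y = σ.I y := fun y => (f₃.I y rfl).trans (f₂.I y rfl)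
  have I5 : ∀ y, σ₅.I y = σ.I y := fun y => (f₅.I y rfl).trans (I4 y)
  obtain ⟨v1, v2⟩ := eventVector_spec h1 hi hj
  rw [← hσ₂] at v1 v2
  have v3 := eventClass_spec σ₂
  rw [← hσ₃, v1, v2] at v3
  have r1 : σ₃.R 1 = eventX v i j := (f₃.R 1 rfl).trans v1
  have r2 : σ₃.R 2 = eventY v i j := (f₃.R 2 rfl).trans v2
  have h4 : HasInput v p σ₄ := h.of_eq (I4 0) ((f₃.F 1 rfl).trans (f₂.F 1 rfl))
  have hF4 : σ₄.F 5 = σ.F 5 := (f₃.F 5 rfl).trans (f₂.F 5 rfl)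
  have hc4 : IsCombination v σ₄ := hc.of_eq ((f₃.R 5 rfl).trans (f₂.R 5 rfl))
    ((f₃.R 6 rfl).trans (f₂.R 6 rfl)) hF4
  have hA5 : ∀ y, σ₅.A y = σ₁.A y := fun y => (f₅.A y rfl).trans ((f₃.A y rfl).trans (f₂.A y rfl))
  have hk4 : ∀ e, itemKey 2 σ₄ e = if e = E then eventKey v i j else itemKey 2 σ e := fun e => by
    have e0 : σ₃.F 0 = σ.F 0 := (f₃.F 0 rfl).trans (f₂.F 0 rfl)
    have e1 : σ₃.I 1 = E := ((f₃.I 1 rfl).trans (f₂.I 1 rfl)).trans hE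
    simp only [itemKey_eq]
    rw [rowOf_update (f := σ.F 0) (x := E) (r := ofLex (eventKey v i j))]
    · split_ifs <;> rfl
    · intro c
      fin_cases c
      · simp [hσ₄, e1, v3, eventKey, angleKey]
      · simp [hσ₄, e1, r1, r2, eventKey, angleKey]
    · intro l hl
      simp only [hσ₄, exec_fset, VState.setF_F, VState.setF_I, IExp.eval, IExp.eval_mulc, e1, e0]
      rw [if_neg (by omega), if_neg (by omega)]
  have hQ5 : IsCombination v σ₅ ∧ ∀ k : Fin n, σ₅.F 5 k =
      if k = i ∧ IsUpper v i j then σ.F 5 i * (1 - p j) else σ.F 5 k := by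
    have r3 : σ₄.R 3 = angleClass (eventX v i j) (eventY v i j) := v3
    rw [hσ₅, hQ, exec_ite]
    by_cases hup : IsUpper v i j
    · rw [if_pos (by simpa [r3, IsUpper] using hup)]
      obtain ⟨g1, g2⟩ := setCoef_spec h4 hc4 (x := 30) (i := i) (by rw [I4, hi]) (.mul (.a 5 (.v 30))
        (.sub (.c 1) (.a 1 (.add (.mulc 3 (.v 31)) (.c 2)))))
      refine ⟨g1, fun k => ?_⟩
      rw [g2 k]
      simp [I4, hi, hj, hF4, hup, h4.prob_two]
    · rw [if_neg (by simpa [r3, IsUpper] using hup)]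
      exact ⟨hc4, fun k => by simp [hup, hF4]⟩
  rw [hfin]
  refine ⟨by simp [I5, hE], fun e => ?_, fun e => ?_, fun e => ?_, hQ5.1.of_eq rfl rfl rfl, hQ5.2⟩
  · rw [exec_iset, VState.setI_A, hA5, hσ₁]
    simp [hE, hi]
  · rw [exec_iset, VState.setI_A, hA5, hσ₁]
    simp [hE, hj]
  · rw [← hk4 e]
    have : σ₅.F 0 = σ₄.F 0 := f₅.F 0 rfl
    rw [itemKey_eq, itemKey_eq, exec_iset, VState.setI_F, this]

/-- Create the events, and compute the initial coefficients. -/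
def createEvents : Cmd :=
  .seq (.rset 5 (.c 0)) (.seq (.rset 6 (.c 0)) (.seq (.iset 1 (.c 0)) (.seq
    (.loop 30 (.v 0) (.fset 5 (.v 30) (.c 0)))
    (.loop 30 (.v 0) (.seq (setCoef 30 (.a 1 (.add (.mulc 3 (.v 30)) (.c 2))))
      (.loop 31 (.v 0) eventStep))))))

/-- The first `E` events have been created. -/
structure HasEvents (v : Fin n → EuclideanSpace ℝ (Fin 2)) (E : ℕ) (σ : VState) : Prop where
  count : σ.I 1 = E
  fst : ∀ i j : Fin n, n * i + j < E → σ.A 2 (n * i + j) = i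
  snd : ∀ i j : Fin n, n * i + j < E → σ.A 3 (n * i + j) = j
  key : ∀ i j : Fin n, n * i + j < E → itemKey 2 σ (n * i + j) = eventKey v i j
  comb : IsCombination v σ

theorem HasEvents.of_eq {E : ℕ} {σ τ : VState} (h : HasEvents v E σ) (h1 : τ.I 1 = σ.I 1)
    (hA2 : τ.A 2 = σ.A 2) (hA3 : τ.A 3 = σ.A 3) (hF : τ.F 0 = σ.F 0) (hc : IsCombination v τ) :
    HasEvents v E τ :=
  ⟨h1.trans h.count, fun i j hij => by rw [hA2, h.fst i j hij],
    fun i j hij => by rw [hA3, h.snd i j hij],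
    fun i j hij => by rw [← h.key i j hij, itemKey_eq, itemKey_eq, hF], hc⟩

/-- The RAM cannot multiply or divide integers in one step, so the number `n * i + j` arises by
counting, and arrays `2` and `3` record the pair it stands for. -/
theorem HasEvents.step {σ : VState} (h : HasInput v p σ) {i j : Fin n}
    (he : HasEvents v (n * i + j) σ) (hi : σ.I 30 = i) (hj : σ.I 31 = j) :
    HasEvents v (n * i + (j + 1)) (eventStep.exec σ) := by
  obtain ⟨g1, g2, g3, g4, g5, -⟩ := eventStep_spec h he.comb hi hj he.count
  have hcase : ∀ a b : Fin n, n * (a : ℕ) + b < n * i + (j + 1) →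
      n * (a : ℕ) + b < n * i + j ∨ n * (a : ℕ) + b = n * i + j ∧ a = i ∧ b = j := fun a b hab => by
    rcases Nat.lt_succ_iff_lt_or_eq.1 (show n * (a : ℕ) + b < n * i + j + 1 by omega) with h' | h'
    · exact Or.inl h'
    · have e1 : (i : ℕ) = a := by
        have hb := b.2
        have hj := j.2
        exact (row_index j.2 a i).1 ⟨by omega, by omega⟩
      refine Or.inr ⟨h', Fin.ext e1.symm, Fin.ext ?_⟩
      rw [e1] at h'
      omega
  refine ⟨g1, fun a b hab => ?_, fun a b hab => ?_, fun a b hab => ?_, g5⟩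
  · rw [g2]
    rcases hcase a b hab with h' | ⟨h', rfl, rfl⟩
    · rw [if_neg h'.ne, he.fst a b h']
    · rw [if_pos rfl]
  · rw [g3]
    rcases hcase a b hab with h' | ⟨h', rfl, rfl⟩
    · rw [if_neg h'.ne, he.snd a b h']
    · rw [if_pos rfl]
  · rw [g4]
    rcases hcase a b hab with h' | ⟨h', rfl, rfl⟩
    · rw [if_neg h'.ne, he.key a b h']
    · rw [if_pos rfl]

open Classical in
theorem createEvents_spec (hv : Function.Injective v) {σ : VState} (h : HasInput v p σ) :
    HasEvents v (n * n) (createEvents.exec σ) ∧ ∀ i : Fin n,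
      (createEvents.exec σ).F 5 i = coef p (Swept v fun _ _ => False) i := by
  set σ₁ := (Cmd.iset 1 (.c 0)).exec ((Cmd.rset 6 (.c 0)).exec ((Cmd.rset 5 (.c 0)).exec σ))
    with hσ₁
  have h1 : HasInput v p σ₁ := h.of_eq (by simp [hσ₁]) rfl
  set L : Cmd := .loop 30 (.v 0) (.fset 5 (.v 30) (.c 0)) with hL
  set σ₂ := L.exec σ₁ with hσ₂
  have f₂ := frame_exec L σ₁
  have h2 : HasInput v p σ₂ := h1.of_eq (f₂.I 0 rfl) (f₂.F 1 rfl)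
  have hz : (fun k (τ : VState) => ∀ i < k, τ.F 5 i = 0) n σ₂ := by
    refine loop_induction (e := .v 0) (N := n) h1.size (fun k (τ : VState) => ∀ i < k, τ.F 5 i = 0)
      (fun i hi => by omega) fun k _ τ _ hp i hi => ?_
    simp only [exec_fset, VState.setF_F, IExp.eval, VState.setI_I, if_true, true_and, RExp.eval,
      Int.cast_zero, VState.setI_F]
    split_ifs with hik
    · rfl
    · exact hp i (by omega)
  have hc2 : IsCombination v σ₂ := by
    refine ⟨?_, ?_⟩
    · rw [sum_eq_zero fun i _ => by rw [hz i i.2, zero_mul], hσ₂, f₂.R 5 rfl]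
      simp [hσ₁]
    · rw [sum_eq_zero fun i _ => by rw [hz i i.2, zero_mul], hσ₂, f₂.R 6 rfl]
      simp [hσ₁]
  have he2 : HasEvents v (n * 0) σ₂ := by
    refine ⟨?_, fun i j hij => by omega, fun i j hij => by omega, fun i j hij => by omega, hc2⟩
    rw [hσ₂, f₂.I 1 rfl]
    simp [hσ₁]
  set P : Cmd := .seq (setCoef 30 (.a 1 (.add (.mulc 3 (.v 30)) (.c 2))))
    (.loop 31 (.v 0) eventStep) with hP
  have hfin : createEvents.exec σ = (Cmd.loop 30 (.v 0) P).exec σ₂ := rfl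
  rw [hfin]
  have key : (fun k (τ : VState) => HasEvents v (n * k) τ ∧ ∀ i : Fin n, (i : ℕ) < k →
      τ.F 5 i = coef p (Swept v fun _ _ => False) i) n ((Cmd.loop 30 (.v 0) P).exec σ₂) := by
    refine loop_induction (e := .v 0) (N := n) h2.size (fun k (τ : VState) => HasEvents v (n * k) τ ∧
      ∀ i : Fin n, (i : ℕ) < k → τ.F 5 i = coef p (Swept v fun _ _ => False) i)
      ⟨he2, fun i hi => by omega⟩ fun k hk τ hτ hp => ?_
    rw [hP, exec_seq]
    set i : Fin n := ⟨k, hk⟩ with hi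
    set τ₀ := τ.setI 30 k with hτ₀
    have ht0 : HasInput v p τ₀ := (h2.of_eq (hτ.I 0 rfl) (hτ.F 1 rfl)).of_eq rfl rfl
    have i0 : τ₀.I 30 = i := by simp [hτ₀, hi]
    obtain ⟨g1, g2⟩ := setCoef_spec ht0 (hp.1.comb.of_eq rfl rfl rfl) i0
      (.a 1 (.add (.mulc 3 (.v 30)) (.c 2)))
    have ht1 := ht0.setCoef 30 (.a 1 (.add (.mulc 3 (.v 30)) (.c 2)))
    set τ₁ := (setCoef 30 (.a 1 (.add (.mulc 3 (.v 30)) (.c 2)))).exec τ₀ with hτ₁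
    have fS := frame_exec (setCoef 30 (.a 1 (.add (.mulc 3 (.v 30)) (.c 2)))) τ₀
    have he1 : HasEvents v (n * k + 0) τ₁ := hp.1.of_eq rfl rfl rfl (fS.F 0 rfl) g1
    -- During row `i` the coefficient of `i` is the product over the upper pairs met so far; the
    -- coefficients of earlier points are complete.
    have key2 : (fun m (ρ : VState) => HasEvents v (n * k + m) ρ ∧
        (∀ a : Fin n, (a : ℕ) < k → ρ.F 5 a = coef p (Swept v fun _ _ => False) a) ∧
        ρ.F 5 i = p i * ∏ j ∈ univ.filter (fun j : Fin n => (j : ℕ) < m ∧ IsUpper v i j), (1 - p j)) n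
        ((Cmd.loop 31 (.v 0) eventStep).exec τ₁) := by
      refine loop_induction (e := .v 0) (N := n) ht1.size (fun m (ρ : VState) => HasEvents v (n * k + m) ρ ∧
        (∀ a : Fin n, (a : ℕ) < k → ρ.F 5 a = coef p (Swept v fun _ _ => False) a) ∧
        ρ.F 5 i = p i * ∏ j ∈ univ.filter (fun j : Fin n => (j : ℕ) < m ∧ IsUpper v i j), (1 - p j))
        ⟨he1, fun a ha => ?_, ?_⟩ fun m hm ρ hρ hq => ?_
      · rw [g2, if_neg (by rintro rfl; exact absurd ha (lt_irrefl _))]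
        exact hp.2 a ha
      · rw [g2, if_pos rfl]
        simp [i0, ht0.prob_two]
      · set j : Fin n := ⟨m, hm⟩ with hj
        set ρ₀ := ρ.setI 31 m with hρ₀
        have hr0 : HasInput v p ρ₀ := (ht1.of_eq (hρ.I 0 rfl) (hρ.F 1 rfl)).of_eq rfl rfl
        have ri : ρ₀.I 30 = i := (hρ.I 30 rfl).trans i0
        have rj : ρ₀.I 31 = j := by simp [hρ₀, hj]
        have hre : HasEvents v (n * i + j) ρ₀ :=
          hq.1.of_eq rfl rfl rfl rfl (hq.1.comb.of_eq rfl rfl rfl)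
        obtain ⟨-, -, -, -, -, g6⟩ := eventStep_spec hr0 hre.comb ri rj hre.count
        refine ⟨hre.step hr0 ri rj, fun a ha => ?_, ?_⟩
        · rw [g6, if_neg (by rintro ⟨rfl, -⟩; exact absurd ha (lt_irrefl _))]
          exact hq.2.1 a ha
        · have hins : ∀ a : Fin n, (a : ℕ) < m + 1 ↔ a = j ∨ (a : ℕ) < m := fun a => by
            rw [Fin.ext_iff, hj]
            simp only
            omega
          rw [g6]
          have e5 : ρ₀.F 5 i = _ := hq.2.2
          rw [e5]
          split_ifs with hu
          · have : univ.filter (fun a : Fin n => (a : ℕ) < m + 1 ∧ IsUpper v i a) =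
                insert j (univ.filter fun a : Fin n => (a : ℕ) < m ∧ IsUpper v i a) := by
              ext a
              simp only [mem_filter, mem_univ, true_and, mem_insert, hins]
              constructor
              · rintro ⟨h1 | h1, h2⟩
                · exact Or.inl h1
                · exact Or.inr ⟨h1, h2⟩
              · rintro (rfl | ⟨h1, h2⟩)
                · exact ⟨Or.inl rfl, hu.2⟩
                · exact ⟨Or.inr h1, h2⟩
            rw [this, prod_insert (by simp [hj])]
            ring
          · congr 2
            ext a
            simp only [mem_filter, mem_univ, true_and, hins]
            constructor
            · rintro ⟨h1, h2⟩
              exact ⟨Or.inr h1, h2⟩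
            · rintro ⟨rfl | h1, h2⟩
              · exact absurd ⟨rfl, h2⟩ hu
              · exact ⟨h1, h2⟩
    refine ⟨key2.1, fun a ha => ?_⟩
    rcases Nat.lt_succ_iff_lt_or_eq.1 ha with ha | ha
    · exact key2.2.1 a ha
    · have : a = i := Fin.ext ha
      subst this
      rw [key2.2.2, coef_swept_false hv, coef]
      congr 2
      ext j
      simp
  exact ⟨key.1, fun i => key.2 i i.2⟩

end

/-! ### Processing the sorted events -/

section

variable {n : ℕ} {v : Fin n → EuclideanSpace ℝ (Fin 2)} {p : Fin n → ℝ} {pos : Fin n → Fin n → ℕ}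

/-- `pos` is the position of the events in the sorted list. -/
structure IsSweepState (v : Fin n → EuclideanSpace ℝ (Fin 2)) (p : Fin n → ℝ)
    (pos : Fin n → Fin n → ℕ) (σ : VState) : Prop where
  input : HasInput v p σ
  order : SweepOrder v pos
  events : HasEvents v (n * n) σ
  event : ∀ i j, σ.A 0 (pos i j) = n * i + j

theorem event_lt (i j : Fin n) : n * (i : ℕ) + j < n * n := by
  have := Nat.mul_le_mul_left n (show (i : ℕ) + 1 ≤ n from i.2)
  have := j.2
  linarith

theorem IsSweepState.of_eq {σ τ : VState} (h : IsSweepState v p pos σ) (h0 : τ.I 0 = σ.I 0)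
    (h1 : τ.I 1 = σ.I 1) (hA0 : τ.A 0 = σ.A 0) (hA2 : τ.A 2 = σ.A 2) (hA3 : τ.A 3 = σ.A 3)
    (hF0 : τ.F 0 = σ.F 0) (hF1 : τ.F 1 = σ.F 1) (hc : IsCombination v τ) :
    IsSweepState v p pos τ :=
  ⟨h.input.of_eq h0 hF1, h.order, h.events.of_eq h1 hA2 hA3 hF0 hc,
    fun i j => by rw [hA0, h.event]⟩

/-- Positions are given by the inverse of the sorting permutation, applied to the number `n * i + j`
of the event. -/
theorem exists_isSweepState {σ : VState} (h : HasInput v p σ) (he : HasEvents v (n * n) σ) :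
    ∃ pos, IsSweepState v p pos ((sortItems 2).exec σ) := by
  have hs := sortItems_spec 2 σ
  have f := frame_exec (sortItems 2) σ
  set τ := (sortItems 2).exec σ
  have he' : HasEvents v (n * n) τ := he.of_eq (f.I 1 rfl) (f.A 2 rfl) (f.A 3 rfl) (f.F 0 rfl)
    (he.comb.of_eq (f.R 5 rfl) (f.R 6 rfl) (f.F 5 rfl))
  rw [he.count] at hs
  obtain ⟨e, hA⟩ := exists_perm_of_map_range hs.perm
  have hpos : ∀ i j, τ.A 0 (e.symm ⟨n * (i : Fin n) + (j : Fin n), event_lt i j⟩) = n * i + j :=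
    fun i j => by rw [← hA, Equiv.apply_symm_apply]
  refine ⟨fun i j => e.symm ⟨n * i + j, event_lt i j⟩, h.of_eq (f.I 0 rfl) (f.F 1 rfl),
    ⟨fun i j => (e.symm _).2, fun t ht => ?_, fun i j i' j' hij => ?_, fun i j i' j' hij => ?_⟩,
    he', hpos⟩
  · have hn : 0 < n := Nat.pos_of_ne_zero fun h0 => by simp [h0] at ht
    have hm := (e ⟨t, ht⟩).2
    refine ⟨⟨(e ⟨t, ht⟩ : ℕ) / n, Nat.div_lt_of_lt_mul hm⟩, ⟨(e ⟨t, ht⟩ : ℕ) % n,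
      Nat.mod_lt _ hn⟩, ?_⟩
    simp only [Nat.div_add_mod, Fin.eta, Equiv.symm_apply_apply]
  · have h1 := congrArg Fin.val (e.symm.injective (Fin.ext hij))
    simp only at h1
    have h2 : (i : ℕ) = i' := by
      have := j.2
      have := j'.2
      exact (row_index j.2 i' i).1 ⟨by omega, by omega⟩
    refine ⟨Fin.ext h2, Fin.ext ?_⟩
    rw [h2] at h1
    omega
  · have := hs.le _ _ hij (e.symm _).2
    rwa [hpos, hpos, he'.key _ _ (event_lt i j), he'.key _ _ (event_lt i' j')] at this

/-- Decide whether no further event of the same angle follows. -/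
def cutTest : Cmd :=
  .ite (.ilt (.add (.v 32) (.c 1)) (.v 1)) (.seq (.iset 12 (.a 0 (.v 32)))
    (.seq (.iset 13 (.a 0 (.add (.v 32) (.c 1)))) (lexCmp 2))) (.iset 10 (.c 1))

/-- Only the next event in the sorted list has to be compared. Without a next event the flag is set
to `1`, since the last event is a cut. -/
theorem cutTest_spec {σ : VState} (h : IsSweepState v p pos σ) {t : ℕ} (ht : t < n * n)
    (h32 : σ.I 32 = t) : 0 < (cutTest.exec σ).I 10 ↔ IsCut v pos t := by
  rw [cutTest, exec_ite]
  split_ifs with hlt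
  · simp only [Tst.eval_ilt, IExp.eval, h32, h.events.count] at hlt
    obtain ⟨-, s2, -⟩ := lexCmp_spec 2 ((Cmd.iset 13 (.a 0 (.add (.v 32) (.c 1)))).exec
      ((Cmd.iset 12 (.a 0 (.v 32))).exec σ))
    have e : ∀ x, itemKey 2 ((Cmd.iset 13 (.a 0 (.add (.v 32) (.c 1)))).exec
      ((Cmd.iset 12 (.a 0 (.v 32))).exec σ)) x = itemKey 2 σ x := fun x => rfl
    rw [e, e] at s2
    simp only [exec_iset, IExp.eval, VState.setI_I, VState.setI_A] at s2
    norm_num at s2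
    rw [h32] at s2
    simp only [exec_seq, exec_iset, IExp.eval, VState.setI_I, VState.setI_A]
    norm_num
    rw [h32, Nat.pos_iff_ne_zero, ne_eq, s2]
    obtain ⟨i, j, hij⟩ := h.order.surj t ht
    obtain ⟨i', j', hij'⟩ := h.order.surj (t + 1) hlt
    rw [← hij', ← hij, h.event, h.event, h.events.key _ _ (event_lt i j),
      h.events.key _ _ (event_lt i' j'), hij]
    refine ⟨fun hne => ⟨ht, fun a b a' b' hab hab' => ?_⟩, fun hc => hc.2 _ _ _ _ hij hij'⟩
    obtain ⟨rfl, rfl⟩ := h.order.inj _ _ _ _ (hab.trans hij.symm)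
    obtain ⟨rfl, rfl⟩ := h.order.inj _ _ _ _ (hab'.trans hij'.symm)
    exact hne
  · simp only [Tst.eval_ilt, IExp.eval, h32, h.events.count] at hlt
    refine ⟨fun _ => ⟨ht, fun a b a' b' _ hab' => ?_⟩, fun _ => by simp⟩
    have := h.order.lt a' b'
    omega

/-- Update the coefficients at an event. -/
def updateCoefs : Cmd :=
  .seq (.iset 33 (.a 0 (.v 32))) (.seq (.iset 34 (.a 2 (.v 33))) (.seq (.iset 35 (.a 3 (.v 33)))
    (.seq (setCoef 34 (.div (.a 5 (.v 34)) (.sub (.c 1) (.a 1 (.add (.mulc 3 (.v 35)) (.c 2))))))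
      (setCoef 35 (.mul (.a 5 (.v 35)) (.sub (.c 1) (.a 1 (.add (.mulc 3 (.v 34)) (.c 2)))))))))

theorem updateCoefs_spec (hv : Function.Injective v) (hp : ∀ i, 0 < p i ∧ p i < 1) {σ : VState}
    (h : IsSweepState v p pos σ) {t : ℕ} (ht : t < n * n) (h32 : σ.I 32 = t)
    (hF : ∀ k : Fin n, σ.F 5 k = coef p (Swept v fun a b => pos a b < t) k) :
    IsSweepState v p pos (updateCoefs.exec σ) ∧ ∀ k : Fin n,
      (updateCoefs.exec σ).F 5 k = coef p (Swept v fun a b => pos a b < t + 1) k := by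
  obtain ⟨i, j, hij⟩ := h.order.surj t ht
  set σ₁ := (Cmd.iset 35 (.a 3 (.v 33))).exec ((Cmd.iset 34 (.a 2 (.v 33))).exec
    ((Cmd.iset 33 (.a 0 (.v 32))).exec σ)) with hσ₁
  have h1 : IsSweepState v p pos σ₁ := h.of_eq (by simp [hσ₁]) (by simp [hσ₁]) rfl rfl rfl rfl rfl
    (h.events.comb.of_eq rfl rfl rfl)
  have e33 : σ.A 0 t = n * i + j := by rw [← hij, h.event]
  have e34 : σ₁.I 34 = i := by simp [hσ₁, h32, e33, h.events.fst i j (event_lt i j)]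
  have e35 : σ₁.I 35 = j := by simp [hσ₁, h32, e33, h.events.snd i j (event_lt i j)]
  have hF1 : σ₁.F 5 = σ.F 5 := rfl
  set E₁ : RExp := .div (.a 5 (.v 34)) (.sub (.c 1) (.a 1 (.add (.mulc 3 (.v 35)) (.c 2))))
  set E₂ : RExp := .mul (.a 5 (.v 35)) (.sub (.c 1) (.a 1 (.add (.mulc 3 (.v 34)) (.c 2))))
  obtain ⟨g1, g2⟩ := setCoef_spec h1.input h1.events.comb e34 E₁
  have f₂ := frame_exec (setCoef 34 E₁) σ₁
  set σ₂ := (setCoef 34 E₁).exec σ₁ with hσ₂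
  have h2 : IsSweepState v p pos σ₂ := h1.of_eq rfl rfl rfl rfl rfl (f₂.F 0 rfl) (f₂.F 1 rfl) g1
  obtain ⟨g3, g4⟩ := setCoef_spec h2.input g1 (x := 35) (i := j) e35 E₂
  have f₃ := frame_exec (setCoef 35 E₂) σ₂
  have hfin : updateCoefs.exec σ = (setCoef 35 E₂).exec σ₂ := rfl
  rw [hfin]
  refine ⟨h2.of_eq rfl rfl rfl rfl rfl (f₃.F 0 rfl) (f₃.F 1 rfl) g3, fun k => ?_⟩
  have v1 : E₁.eval σ₁ = σ.F 5 i / (1 - p j) := by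
    simp [E₁, e34, e35, h1.input.prob_two, hF1]
  have v2 : E₂.eval σ₂ = σ₂.F 5 j * (1 - p i) := by
    have e34' : σ₂.I 34 = i := e34
    have e35' : σ₂.I 35 = j := e35
    simp [E₂, e34', e35', h2.input.prob_two]
  rw [g4, v2, g2, g2, v1, hF1, hF, hF, hF]
  -- For a diagonal event the second assignment multiplies by the factor by which the first one has
  -- just divided, so nothing changes, as it should.
  by_cases hne : i = j
  · subst hne
    have h3 : 1 - p i ≠ 0 := by linarith [(hp i).2]
    have h4 : Swept v (fun a b => pos a b < t + 1) = Swept v fun a b => pos a b < t :=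
      Swept.congr fun a b hab => by
        rw [Nat.lt_succ_iff_lt_or_eq, or_iff_left]
        intro h5
        obtain ⟨rfl, rfl⟩ := h.order.inj _ _ _ _ (h5.trans hij.symm)
        exact hab rfl
    rw [h4, if_pos rfl, div_mul_cancel₀ _ h3]
    split_ifs with h5
    · rw [h5]
    · rfl
  · rw [if_neg (Ne.symm hne), ← hij, h.order.coef_succ hv hp hne k]

/-- Emit the current point. -/
def emitPoint : Cmd :=
  .seq (.fset 3 (.mulc 2 (.v 14)) (.v 5)) (.seq (.fset 3 (.add (.mulc 2 (.v 14)) (.c 1)) (.v 6))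
    (.iset 14 (.add (.v 14) (.c 1))))

theorem emitPoint_spec {σ : VState} {y : EuclideanSpace ℝ (Fin 2)} (h5 : σ.R 5 = y 0)
    (h6 : σ.R 6 = y 1) : computed 2 (emitPoint.exec σ) = computed 2 σ ∪ {y} := by
  refine computed_push (by simp [emitPoint]) (fun c => ?_) fun j hj => ?_
  · fin_cases c
    · simp [emitPoint, h5]
    · simp [emitPoint, h6]
  · simp only [emitPoint, exec_seq, exec_fset, exec_iset, VState.setI_F, VState.setF_F,
      VState.setF_I, IExp.eval, IExp.eval_mulc]
    rw [if_neg (by omega), if_neg (by omega)]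

/-- Process an event. -/
def sweepStep : Cmd :=
  .seq updateCoefs (.seq cutTest (.ite (.ilt (.c 0) (.v 10)) emitPoint .skip))

theorem sweepStep_spec (hv : Function.Injective v) (hp : ∀ i, 0 < p i ∧ p i < 1) {σ : VState}
    (h : IsSweepState v p pos σ) {t : ℕ} (ht : t < n * n) (h32 : σ.I 32 = t)
    (hF : ∀ k : Fin n, σ.F 5 k = coef p (Swept v fun a b => pos a b < t) k) :
    IsSweepState v p pos (sweepStep.exec σ) ∧
    (∀ k : Fin n,
      (sweepStep.exec σ).F 5 k = coef p (Swept v fun a b => pos a b < t + 1) k) ∧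
    computed 2 (sweepStep.exec σ) = computed 2 σ ∪
      {x | IsCut v pos t ∧ x = vertOf v p (Swept v fun a b => pos a b < t + 1)} ∧
    (sweepStep.exec σ).I 14 ≤ σ.I 14 + 1 := by
  obtain ⟨h1, hF1⟩ := updateCoefs_spec hv hp h ht h32 hF
  have f₁ := frame_exec updateCoefs σ
  set σ₁ := updateCoefs.exec σ with hσ₁
  have hcut := cutTest_spec h1 ht ((f₁.I 32 rfl).trans h32)
  have f₂ := frame_exec cutTest σ₁
  set σ₂ := cutTest.exec σ₁ with hσ₂
  have h14 : σ₂.I 14 = σ.I 14 := (f₂.I 14 rfl).trans (f₁.I 14 rfl)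
  have hF2 : σ₂.F 5 = σ₁.F 5 := f₂.F 5 rfl
  have hc2 : IsCombination v σ₂ := h1.events.comb.of_eq (f₂.R 5 rfl) (f₂.R 6 rfl) hF2
  have h2 : IsSweepState v p pos σ₂ := h1.of_eq (f₂.I 0 rfl) (f₂.I 1 rfl) (f₂.A 0 rfl) (f₂.A 2 rfl)
    (f₂.A 3 rfl) (f₂.F 0 rfl) (f₂.F 1 rfl) hc2
  have hcomp : computed 2 σ₂ = computed 2 σ :=
    computed_congr h14 ((f₂.F 3 rfl).trans (f₁.F 3 rfl))
  have hfin : sweepStep.exec σ = (Cmd.ite (.ilt (.c 0) (.v 10)) emitPoint .skip).exec σ₂ := rfl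
  rw [hfin, exec_ite]
  split_ifs with hpos
  · have hc := hcut.1 (by simpa using hpos)
    have f₃ := frame_exec emitPoint σ₂
    refine ⟨h2.of_eq (f₃.I 0 rfl) (f₃.I 1 rfl) rfl rfl rfl (f₃.F 0 rfl) (f₃.F 1 rfl)
      (hc2.of_eq rfl rfl (f₃.F 5 rfl)), fun k => by rw [f₃.F 5 rfl, hF2, hF1], ?_, ?_⟩
    · rw [emitPoint_spec (y := vertOf v p (Swept v fun a b => pos a b < t + 1)), hcomp]
      · simp [hc]
      · rw [vertOf_apply, hc2.x]
        exact sum_congr rfl fun k _ => by rw [hF2, hF1]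
      · rw [vertOf_apply, hc2.y]
        exact sum_congr rfl fun k _ => by rw [hF2, hF1]
    · simp [emitPoint, h14]
  · have hc : ¬ IsCut v pos t := fun hc => hpos (by simpa using hcut.2 hc)
    refine ⟨h2, fun k => by rw [exec_skip, hF2, hF1], ?_, ?_⟩
    · rw [exec_skip, hcomp]
      simp [hc]
    · rw [exec_skip, h14]
      omega

/-- Computation of the vertices in the plane. -/
def planeCmd : Cmd :=
  .seq (.iset 14 (.c 0)) (.seq createEvents (.seq (sortItems 2) (.loop 32 (.v 1) sweepStep)))

theorem planeCmd_spec (hn : 1 ≤ n) (hv : Function.Injective v) (hp : ∀ i, 0 < p i ∧ p i < 1)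
    {σ : VState} (h : HasInput v p σ) :
    computed 2 (planeCmd.exec σ) = (minkowskiM v p).extremePoints ℝ ∧
      (planeCmd.exec σ).I 14 ≤ n * n := by
  set σ₁ := (Cmd.iset 14 (.c 0)).exec σ with hσ₁
  have h1 : HasInput v p σ₁ := h.of_eq (by simp [hσ₁]) rfl
  obtain ⟨h2, hF2⟩ := createEvents_spec hv h1
  have f₂ := frame_exec createEvents σ₁
  set σ₂ := createEvents.exec σ₁ with hσ₂
  have hin2 : HasInput v p σ₂ := h1.of_eq (f₂.I 0 rfl) (f₂.F 1 rfl)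
  obtain ⟨pos, h3⟩ := exists_isSweepState hin2 h2
  have f₃ := frame_exec (sortItems 2) σ₂
  set σ₃ := (sortItems 2).exec σ₂ with hσ₃
  have h14 : σ₃.I 14 = 0 := by rw [hσ₃, f₃.I 14 rfl, hσ₂, f₂.I 14 rfl, hσ₁]; simp
  have hfin : planeCmd.exec σ = (Cmd.loop 32 (.v 1) sweepStep).exec σ₃ := rfl
  rw [hfin]
  have key : (fun t (τ : VState) => IsSweepState v p pos τ ∧
      (∀ k : Fin n, τ.F 5 k = coef p (Swept v fun a b => pos a b < t) k) ∧
      computed 2 τ = {x | ∃ s < t, IsCut v pos s ∧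
        x = vertOf v p (Swept v fun a b => pos a b < s + 1)} ∧ τ.I 14 ≤ t) (n * n)
      ((Cmd.loop 32 (.v 1) sweepStep).exec σ₃) := by
    refine loop_induction (e := .v 1) (N := n * n) h3.events.count (fun t (τ : VState) =>
      IsSweepState v p pos τ ∧
      (∀ k : Fin n, τ.F 5 k = coef p (Swept v fun a b => pos a b < t) k) ∧
      computed 2 τ = {x | ∃ s < t, IsCut v pos s ∧
        x = vertOf v p (Swept v fun a b => pos a b < s + 1)} ∧ τ.I 14 ≤ t)
      ⟨h3, fun k => ?_, ?_, h14.le⟩ fun t ht τ _ hq => ?_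
    · rw [f₃.F 5 rfl, hF2]
      simp
    · simp [computed, h14]
    · obtain ⟨q1, q2, q3, q4⟩ := hq
      have hq1 : IsSweepState v p pos (τ.setI 32 t) := q1.of_eq (by simp) (by simp) rfl rfl rfl rfl
        rfl (q1.events.comb.of_eq rfl rfl rfl)
      obtain ⟨r1, r2, r3, r4⟩ := sweepStep_spec hv hp hq1 ht (by simp) q2
      -- The points emitted so far come from the cuts before `t`, and the current step adds at most
      -- one point.
      refine ⟨r1, r2, ?_, ?_⟩
      · rw [r3, computed_congr (σ := τ) (τ := τ.setI 32 t) (by simp) rfl, q3]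
        ext x
        simp only [Set.mem_union, Set.mem_ofPred_eq]
        constructor
        · rintro (⟨s, hs, h4⟩ | h4)
          · exact ⟨s, by omega, h4⟩
          · exact ⟨t, by omega, h4⟩
        · rintro ⟨s, hs, h4⟩
          rcases Nat.lt_succ_iff_lt_or_eq.1 hs with h5 | rfl
          · exact Or.inl ⟨s, h5, h4⟩
          · exact Or.inr h4
      · have : (τ.setI 32 t).I 14 = τ.I 14 := by simp
        omega
  refine ⟨?_, key.2.2.2⟩
  rw [key.2.2.1, extremePoints_eq_sweep hn hv hp h3.order]
  ext x
  simp only [Set.mem_ofPred_eq]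
  exact ⟨fun ⟨s, _, h4⟩ => ⟨s, h4⟩, fun ⟨s, h4⟩ => ⟨s, h4.1.1, h4⟩⟩

/-- Creating and processing an event takes constant time, and there are `n ^ 2` of them. Only the
sort contributes the logarithm, which is `O(log n)` by `clog_bound`. -/
theorem cost_planeCmd_le : ∃ C, ∀ (n : ℕ) (v : Fin n → EuclideanSpace ℝ (Fin 2)) (p : Fin n → ℝ),
    1 ≤ n → Function.Injective v → ∀ σ, HasInput v p σ →
      planeCmd.cost σ ≤ C * (n ^ 2 * (Nat.clog 2 n + 1)) := by
  obtain ⟨C₁, hC₁⟩ := cost_sortItems_le 2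
  obtain ⟨C₂, hC₂⟩ := clog_bound 1 2
  obtain ⟨b, hb⟩ : ∃ b, b = eventStep.bound := ⟨_, rfl⟩
  set S : Cmd := setCoef 30 (.a 1 (.add (.mulc 3 (.v 30)) (.c 2))) with hS
  obtain ⟨s, hs⟩ : ∃ s, s = S.bound := ⟨_, rfl⟩
  obtain ⟨w, hw⟩ : ∃ w, w = sweepStep.bound := ⟨_, rfl⟩
  obtain ⟨z, hz⟩ : ∃ z, z = (Cmd.fset 5 (.v 30) (.c 0)).bound := ⟨_, rfl⟩
  refine ⟨60 + b + s + w + z + C₁ * C₂, fun n v p hn hv σ h => ?_⟩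
  set σ₁ := (Cmd.iset 14 (.c 0)).exec σ with hσ₁
  have h1 : HasInput v p σ₁ := h.of_eq (by simp [hσ₁]) rfl
  obtain ⟨h2, -⟩ := createEvents_spec hv h1
  set σ₂ := createEvents.exec σ₁ with hσ₂
  have i3 : ((sortItems 2).exec σ₂).I 1 = n * n :=
    ((frame_exec (sortItems 2) σ₂).I 1 rfl).trans h2.count
  have t2 := hC₁ σ₂
  rw [h2.count] at t2
  have t2' := hC₂ n (n * n) hn (by rw [one_mul, sq])
  have t3 : (Cmd.loop 32 (.v 1) sweepStep).cost ((sortItems 2).exec σ₂) ≤ _ :=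
    cost_loop_le_bound i3 rfl
  have t1 : createEvents.cost σ₁ ≤
      10 + (4 + n * (z + 5)) + (4 + n * (s + (4 + n * (b + 5)) + 5)) := by
    rw [createEvents, ← hS]
    simp only [cost_seq]
    set L : Cmd := .loop 30 (.v 0) (.fset 5 (.v 30) (.c 0)) with hL
    set ρ := (Cmd.iset 1 (.c 0)).exec ((Cmd.rset 6 (.c 0)).exec ((Cmd.rset 5 (.c 0)).exec σ₁))
      with hρ
    have iρ : ρ.I 0 = n := by simpa [hρ] using h1.size
    have iL : (L.exec ρ).I 0 = n := ((frame_exec L ρ).I 0 rfl).trans iρ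
    have c1 : L.cost ρ ≤ _ := cost_loop_le_bound iρ rfl
    have c2 := cost_loop_le (x := 30) (e := .v 0) (P := .seq S (.loop 31 (.v 0) eventStep))
      (σ := L.exec ρ) (s + (4 + n * (b + 5))) fun i _ τ hτ => by
        rw [cost_seq]
        have d1 : S.cost (τ.setI 30 i) ≤ S.bound := cost_le_bound _ rfl _
        have i1 : (S.exec (τ.setI 30 i)).I 0 = n :=
          ((frame_exec S (τ.setI 30 i)).I 0 rfl).trans ((hτ.I 0 rfl).trans iL)
        have d2 : (Cmd.loop 31 (.v 0) eventStep).cost (S.exec (τ.setI 30 i)) ≤ _ :=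
          cost_loop_le_bound i1 rfl
        rw [← hb] at d2
        rw [← hs] at d1
        simp only [IExp.cost] at d2
        omega
    rw [← hz] at c1
    simp only [IExp.cost, IExp.eval, iL] at c1 c2
    simp only [cost_rset, cost_iset, IExp.cost, RExp.cost]
    omega
  rw [planeCmd, cost_seq, cost_seq, cost_seq, ← hσ₁, ← hσ₂]
  rw [← hw] at t3
  simp only [cost_iset, IExp.cost] at t3 ⊢
  rw [mul_assoc] at t2
  have t4 := Nat.mul_le_mul_left C₁ t2'
  set X := n ^ 2 * (Nat.clog 2 n + 1) with hX
  have hX2 : n * n ≤ X := by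
    rw [← sq]
    exact Nat.le_mul_of_pos_right _ (Nat.succ_pos _)
  have hX1 : n ≤ X := (Nat.le_mul_of_pos_right n hn).trans hX2
  have hX0 : 1 ≤ X := hn.trans hX1
  have m1 := Nat.mul_le_mul_right (z + 5) hX1
  have m2 := Nat.mul_le_mul_right (b + 5) hX2
  have m3 := Nat.mul_le_mul_right (s + 9) hX1
  have m4 := Nat.mul_le_mul_right (w + 5) hX2
  have e1 : n * (s + (4 + n * (b + 5)) + 5) = n * (s + 9) + n * n * (b + 5) := by ring
  rw [e1] at t1
  rw [show (60 + b + s + w + z + C₁ * C₂) * X = 36 * X + X * (z + 5) + X * (b + 5) + X * (s + 9) +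
    X * (w + 5) + C₁ * (C₂ * X) by ring]
  linarith

theorem computesMInTime_plane :
    ComputesMInTime 2 fun n => (n : ℝ) ^ 2 * Real.log ((n : ℝ) + 1) := by
  obtain ⟨C, hC⟩ := cost_planeCmd_le
  refine computesMInTime_of_count (by norm_num) planeCmd 1 C fun n v p hn hv hp σ hσ => ?_
  obtain ⟨h1, h2⟩ := planeCmd_spec hn hv hp hσ
  exact ⟨h1, by rwa [one_mul, sq], hC n v p hn hv σ hσ⟩

end

end

/-! ### The main theorem -/

theorem mainTheorem3 :
    (∀ (d n : ℕ) (v : Fin n → EuclideanSpace ℝ (Fin d)) (p : Fin n → ℝ),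
      1 ≤ d → 1 ≤ n → Function.Injective v → (∀ i, 0 < p i ∧ p i < 1) →
        ((minkowskiM v p).extremePoints ℝ).Finite ∧
        minkowskiM v p = convexHull ℝ ((minkowskiM v p).extremePoints ℝ) ∧
        (∀ u, supportFn (minkowskiM v p) u = expectedSupport v p u) ∧
        (∃ φ : arrangementCones v ≃ (minkowskiM v p).extremePoints ℝ,
          ∀ C : arrangementCones v, ∀ u ∈ interior (C : Set (EuclideanSpace ℝ (Fin d))),
            HasGradientAt (supportFn (minkowskiM v p))
              (φ C : EuclideanSpace ℝ (Fin d)) u) ∧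
        ((minkowskiM v p).extremePoints ℝ).ncard = (arrangementCones v).ncard) ∧
    (∀ d : ℕ, 1 ≤ d → ∃ K : ℝ,
      ∀ (n : ℕ) (v : Fin n → EuclideanSpace ℝ (Fin d)) (p : Fin n → ℝ),
        1 ≤ n → Function.Injective v → (∀ i, 0 < p i ∧ p i < 1) →
          (((minkowskiM v p).extremePoints ℝ).ncard : ℝ) ≤ K * (n : ℝ) ^ (2 * d - 2)) ∧
    (∀ d : ℕ, 1 ≤ d →
      ComputesMInTime d (fun n => (n : ℝ) ^ (2 * d - 1) * Real.log ((n : ℝ) + 1))) ∧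
    ComputesMInTime 2 (fun n => (n : ℝ) ^ 2 * Real.log ((n : ℝ) + 1)) := by
  refine ⟨fun d n v p hd hn hv hp => ?_, fun d hd => ⟨d * 3, fun n v p hn hv hp => ?_⟩,
    fun d hd => computesMInTime hd, computesMInTime_plane⟩
  · obtain ⟨φ, hφ⟩ := exists_equiv_arrangementCones hv hp
    exact ⟨finite_extremePoints v p, minkowskiM_eq_convexHull_extremePoints v p,
      supportFn_eq_expectedSupport hp, ⟨φ, hφ⟩, (Nat.card_congr φ).symm⟩
  · have h := ncard_extremePoints_le hn hd hv hp
    rw [mul_comm ((d : ℝ) * 3)]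
    exact_mod_cast h
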